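/- Let $\mathcal X$ be a complex Banach space and let $T$ be a sectorial operator on $\mathcal X$ of angle $\omega\in[0,\pi/2)$: $T$ is closed and densely defined, its spectrum lies in the closed sector $\{z: z=0\text{ or }|\arg z|\le\omega\}$, and for every $\theta\in(\omega,\pi]$ there is $c_\theta>0$ with $\|(z-T)^{-1}\|\le c_\theta/|z|$ for all $z\neq0$ with $|\arg z|\ge\theta$. For $t>0$ let $$e^{-tT}=\frac1{2\pi i}\int_{\Gamma}e^{-t\zeta}(\zeta-T)^{-1}\,d\zeta ,$$ where $\Gamma$ is the positively oriented boundary of the translated sector $-1+\{z\ne0:|\arg z|<\alpha\}$, for any fixed $\alpha\in(\omega,\pi/2)$. For $0<\sigma<1$ let $$T^\sigma x=\frac1{\Gamma(-\sigma)}\int_0^\infty(e^{-tT}-1)x\,\frac{dt}{t^{1+\sigma}}=\lim_{\varepsilon\to0^+}\frac1{\Gamma(-\sigma)}\int_\varepsilon^\infty(e^{-tT}-1)x\,\frac{dt}{t^{1+\sigma}},$$ with domain $\mathcal D(T^\sigma)$ the set of all $x$ for which the limit exists. Let $0<\sigma<1$ and let $x_0\in\mathcal D(T^\sigma)$ lie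 in the closure of the range of $T$. Then for every $y>0$ the integral $$x(y)=\frac1{\Gamma(\sigma)}\int_0^\infty e^{-tT}\big((tT)^\sigma x_0\big)e^{-\frac{y^2}{4t}}\,\frac{dt}{t}=\lim_{N\to\infty}\frac1{\Gamma(\sigma)}\int_0^N t^{\sigma}e^{-tT}\big(T^\sigma x_0\big)e^{-\frac{y^2}{4t}}\,\frac{dt}{t}$$ converges in $\mathcal X$. Put $x(0)=x_0$. Then $x$ is infinitely differentiable on $(0,\infty)$, $x(y)\in\mathcal D(T)$ for all $y>0$, $x(y)\to x_0$ as $y\to0^+$, and $$-Tx(y)+\frac{1-2\sigma}{y}x'(y)+x''(y)=0\quad\text{in }\mathcal X\text{ for all }y>0 .$$ Moreover, $$\lim_{y\to0^+}\frac{x(y)-x_0}{y^{2\sigma}}=\frac{\Gamma(-\sigma)}{4^\sigma\Gamma(\sigma)}T^\sigma x_0=\frac1{2\sigma}\lim_{y\to0^+}y^{1-2\sigma}x'(y),$$ $$\frac1{2\sigma}\lim_{y\to0^+}y^{2-2\sigma}x''(y)=\frac{2\sigma-1}{4^\sigma}\frac{\Gamma(-\sigma)}{\Gamma(\sigma)}T^\sigma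 x_0 .$$ For every $y>0$ the Poisson formulas hold, with absolutely convergent integrals: $$x(y)=\frac{y^{2\sigma}}{4^\sigma\Gamma(\sigma)}\int_0^\infty e^{-tT}x_0\,e^{-\frac{y^2}{4t}}\frac{dt}{t^{1+\sigma}}=\frac1{\Gamma(\sigma)}\int_0^\infty e^{-\frac{y^2}{4r}T}x_0\,e^{-r}\frac{dr}{r^{1-\sigma}} .$$ For every integer $n\ge0$ there is a constant $C$ (depending on $n$, $\sigma$, $T$, but not on $x_0$ or $y$) with $$\Big\|\frac{d^n}{dy^n}x(y)\Big\|\le\frac{C}{y^n}\|x_0\|\quad\text{for all }y>0,$$ and there is a constant $C$ (depending on $\sigma$, $T$, but not on $x_0$ or $y$) such that $x(y)\in\mathcal D(T^\sigma)$ and $\|T^\sigma x(y)\|\le C\|T^\sigma x_0\|$ for all $y>0$. Finally, if moreover $x_0\in\mathcal D(T)$, then $Tx(y)\to Tx_0$ as $y\to0^+$. -/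

import Mathlib

open Set Filter Topology MeasureTheory

noncomputable section

namespace SectorialOp

variable {X : Type*} [NormedAddCommGroup X] [NormedSpace ℂ X]

/-- `R` is the bounded two-sided inverse `(z - T)⁻¹` of `z - T : D(T) → X`. -/
def IsResolventAt (T : X →ₗ.[ℂ] X) (z : ℂ) (R : X →L[ℂ] X) : Prop :=
  (∀ x : X, ∃ h : R x ∈ T.domain, z • R x - T ⟨R x, h⟩ = x) ∧
    ∀ u : T.domain, R (z • (u : X) - T u) = u

/-- The resolvent set of an unbounded operator. -/
def resolventSet (T : X →ₗ.[ℂ] X) : Set ℂ := {z | ∃ R : X →L[ℂ] X, IsResolventAt T z R}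

/-- The spectrum (its finite part) of an unbounded operator. -/
def spectrumSet (T : X →ₗ.[ℂ] X) : Set ℂ := (resolventSet T)ᶜ

open Classical in
/-- The resolvent operator `(z - T)⁻¹`, set to `0` off the resolvent set. -/
def resolventOp (T : X →ₗ.[ℂ] X) (z : ℂ) : X →L[ℂ] X :=
  if h : ∃ R : X →L[ℂ] X, IsResolventAt T z R then h.choose else 0

/-- `T` is sectorial of angle `ω` (of type `ω`): it is closed and densely defined, its spectrum
lies in the closed sector `{z | z = 0 or |arg z| ≤ ω}` (Mathlib has `arg 0 = 0`), and for every
`θ ∈ (ω, π]` one has `‖(z - T)⁻¹‖ ≤ c_θ / |z|` for all nonzero `z` outside the open sector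
`{z ≠ 0 | |arg z| < θ}`. -/
structure IsSectorial (T : X →ₗ.[ℂ] X) (ω : ℝ) : Prop where
  isClosed : T.IsClosed
  dense_domain : Dense (T.domain : Set X)
  spectrum_subset : spectrumSet T ⊆ {z : ℂ | |z.arg| ≤ ω}
  resolvent_bound : ∀ θ : ℝ, ω < θ → θ ≤ Real.pi → ∃ c : ℝ, 0 < c ∧
    ∀ z : ℂ, z ≠ 0 → θ ≤ |z.arg| → ‖resolventOp T z‖ ≤ c / ‖z‖

/-- The point `-1 + r e^{iβ}`; for `β = α` and `β = -α` these points, `r ≥ 0`, form the boundary of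
the translate `-1 + Σ_α` of the open sector `Σ_α`. -/
def contourPt (β r : ℝ) : ℂ := -1 + (r : ℂ) * Complex.exp ((β : ℂ) * Complex.I)

/-- The integral of `e^{-tζ} (ζ - T)⁻¹ dζ` over the ray `ζ = -1 + r e^{iβ}`, `r` from `0` to `∞`. -/
def rayIntegral (T : X →ₗ.[ℂ] X) (β t : ℝ) : X →L[ℂ] X :=
  ∫ r in Ioi (0 : ℝ),
    (Complex.exp (-((t : ℂ) * contourPt β r)) * Complex.exp ((β : ℂ) * Complex.I)) •
      resolventOp T (contourPt β r)

/-- The operator `e^{-tT}`, `t > 0`, of a sectorial operator `T` of angle `ω < α < π / 2`, by the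
Cauchy integral `(2πi)⁻¹ ∫_Γ e^{-tζ} (ζ - T)⁻¹ dζ`, where `Γ` is the positively oriented boundary of
the sector `-1 + Σ_α` (in along `arg = α`, out along `arg = -α`). The vertex is at `-1` because `0`
may lie in the spectrum. -/
def expNeg (T : X →ₗ.[ℂ] X) (α t : ℝ) : X →L[ℂ] X :=
  (2 * (Real.pi : ℂ) * Complex.I)⁻¹ • (rayIntegral T (-α) t - rayIntegral T α t)

/-- The truncated integral `Γ(-σ)⁻¹ ∫_ε^∞ (e^{-tT} - 1) x t^{-1-σ} dt`. -/
def fracPowTrunc (T : X →ₗ.[ℂ] X) (α σ : ℝ) (x : X) (ε : ℝ) : X :=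
  (Real.Gamma (-σ))⁻¹ • ∫ t in Ioi ε, (t ^ (1 + σ))⁻¹ • (expNeg T α t x - x)

/-- The domain `D(T^σ)`: those `x` for which `Γ(-σ)⁻¹ ∫_0^∞ (e^{-tT} - 1) x t^{-1-σ} dt`
converges, as an integral that is improper at `0`. -/
def fracPowDomain (T : X →ₗ.[ℂ] X) (α σ : ℝ) : Set X :=
  {x | ∃ w : X, Tendsto (fracPowTrunc T α σ x) (𝓝[>] 0) (𝓝 w)}

/-- The fractional power `T^σ x = Γ(-σ)⁻¹ ∫_0^∞ (e^{-tT} - 1) x t^{-1-σ} dt`, `x ∈ D(T^σ)`. -/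
def fracPow (T : X →ₗ.[ℂ] X) (α σ : ℝ) (x : X) : X :=
  limUnder (𝓝[>] 0) (fracPowTrunc T α σ x)

/-- The integrand `e^{-tT} ((tT)^σ x₀) e^{-y²/(4t)} / t`, where `(tT)^σ = t^σ T^σ`. -/
def extIntegrand (T : X →ₗ.[ℂ] X) (α σ : ℝ) (x₀ : X) (y t : ℝ) : X :=
  (Real.exp (-(y ^ 2 / (4 * t))) / t) • expNeg T α t (t ^ σ • fracPow T α σ x₀)

/-- `Γ(σ)⁻¹ ∫_0^N e^{-tT} ((tT)^σ x₀) e^{-y²/(4t)} dt/t`. -/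
def extTrunc (T : X →ₗ.[ℂ] X) (α σ : ℝ) (x₀ : X) (y N : ℝ) : X :=
  (Real.Gamma σ)⁻¹ • ∫ t in Ioc 0 N, extIntegrand T α σ x₀ y t

open Classical in
/-- The extension `x(y)`: `x(0) = x₀`, and
`x(y) = Γ(σ)⁻¹ ∫_0^∞ e^{-tT} ((tT)^σ x₀) e^{-y²/(4t)} dt/t` for `y > 0`, the integral being improper
at `∞`. (The value for `y < 0` is irrelevant.) -/
def extension (T : X →ₗ.[ℂ] X) (α σ : ℝ) (x₀ : X) (y : ℝ) : X :=
  if 0 < y then limUnder atTop (extTrunc T α σ x₀ y) else x₀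

open Classical in
/-- `T x` for `x ∈ D(T)`; it is only used together with `x ∈ D(T)`. -/
def app (T : X →ₗ.[ℂ] X) (x : X) : X := if h : x ∈ T.domain then T ⟨x, h⟩ else 0

end SectorialOp

end

open SectorialOp

/-!
The proof passes from the operator `T` to its semigroup `S(t) = e^{-tT}` and then works with scalar
kernels only.

*The semigroup.* A contour integral `(2πi)⁻¹ ∫ e^{-tζ} Q(ζ) dζ` with `Q` holomorphic outside a smaller
sector does not depend on the vertex of the contour (`contourInt_vertex_eq`): moving the vertex `a`
changes both ray integrals at the same rate `-e^{-ta} Q(a)`. With the vertex `-1/t` this gives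
`O(t^{-m-1})` for `Q = O(|ζ|^m)`, uniformly in `t > 0`. Applied to the resolvent `R(ζ)` and to
`ζ R(ζ)`, `ζ⁻¹ R(ζ)`, it yields a bounded semigroup with `S' = -A`, `‖A(t)‖ = O(1/t)`, strongly
continuous at `0`, and tending to `0` at infinity on the closure of the range of `T`
(`IsSectorial.exists_isAnalyticSemigroup`). The unbounded operator `T` is from then on seen only
through the bounded operator `(-1 - T)⁻¹`, which satisfies `(-1 - T)⁻¹ (S(t) + A(t)) = -S(t)`.

*Convergence.* Let `w = T^σ x₀`. After smoothing by `S(s)` the fractional power is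
`T^σ = T^{-(1-σ)} T` (`HasFracPow.apply_eq`), and the beta integral shows that
`Γ(σ)⁻¹ ∫_0^N s^{σ-1} S(s) w ds` differs from `x₀ - S(N) x₀` by a multiple of
`sup_{t ≥ N} ‖t A(t) x₀‖` (`exists_norm_fracInt_sub_le`). Hence these integrals are bounded in `N` and
converge to `x₀`. The truncated integral defining `x(y)` is an average of them (`integral_ext_eq`),
whence `x(y) = Γ(σ)⁻¹ ∫_0^∞ e^{-r} r^{σ-1} S(y²/(4r)) x₀ dr` (`HasFracPow.tendsto_poissonOp`). These
Poisson operators are bounded by `sup ‖S‖`, commute with everything that commutes with `S`, and tend to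
the identity as `y → 0`; this gives the bound for `T^σ x(y)` and the limit of `T x(y)`.

*Smoothness and the equation.* With `z = y² / 4`, `x(y) = Γ(σ)⁻¹ z^σ L_σ(z)`, where
`L_β(z) = ∫_0^∞ ρ^{β-1} e^{-zρ} S(1/ρ) x₀ dρ` is a Laplace transform. It extends holomorphically to
`Re (y²) > 0`, and Cauchy's estimate on a disc of radius `y/4` bounds the derivatives. Since
`L_β' = -L_{β+1}`, the equation becomes `T φ = (1 - σ) φ' + z φ''` in the variable `z`, which is one
integration by parts (`laplace_deriv_eq`, `resolvent_poissonOp`).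

*Behaviour at `y = 0`.* In terms of `w`,
`x(y) - x₀ = Γ(σ)⁻¹ ∫_0^∞ ρ^{-1-σ} (e^{-zρ} - 1) S(1/ρ) w dρ` (`HasFracPow.poissonOp_sub_self`), and
its derivatives in `z` are Laplace transforms of `S(1/ρ) w`. As `S(1/ρ) w → w` for `ρ → ∞`, rescaling
`ρ` and dominated convergence give the limits.
-/

noncomputable section

namespace SectorialOp

/-! ### The region outside a sector and the rays of the contour -/

/-- The open region outside the closed sector of half-angle `θ` around the positive real axis,
for `0 < θ < π / 2`. -/
def sectorExt (θ : ℝ) : Set ℂ := {z | z.re * Real.sin θ < |z.im| * Real.cos θ}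

/-- The point `a + r e^{iβ}` of the ray with vertex `a` and direction `e^{iβ}`. -/
def rayPt (a β r : ℝ) : ℂ := a + r * Complex.exp (β * Complex.I)

lemma rayPt_re (a β r : ℝ) : (rayPt a β r).re = a + r * Real.cos β := by
  simp [rayPt, Complex.exp_ofReal_mul_I_re]

lemma rayPt_im (a β r : ℝ) : (rayPt a β r).im = r * Real.sin β := by
  simp [rayPt, Complex.exp_ofReal_mul_I_im]

lemma contourPt_eq (β r : ℝ) : contourPt β r = rayPt (-1) β r := by
  simp [contourPt, rayPt]

lemma isOpen_sectorExt (θ : ℝ) : IsOpen (sectorExt θ) :=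
  isOpen_lt (by fun_prop) (by fun_prop)

lemma ne_zero_of_mem_sectorExt {θ : ℝ} {z : ℂ} (hz : z ∈ sectorExt θ) : z ≠ 0 := by
  rintro rfl
  simp [sectorExt] at hz

lemma le_abs_arg_of_mem_sectorExt {θ : ℝ} (h1 : θ < Real.pi / 2) {z : ℂ}
    (hz : z ∈ sectorExt θ) : θ ≤ |z.arg| := by
  by_contra! h
  have hz' : z.re * Real.sin θ < |z.im| * Real.cos θ := hz
  have hn : 0 < ‖z‖ := norm_pos_iff.2 (ne_zero_of_mem_sectorExt hz)
  have hre : z.re = ‖z‖ * Real.cos |z.arg| := by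
    rw [Real.cos_abs, Complex.norm_mul_cos_arg]
  have him : |z.im| = ‖z‖ * Real.sin |z.arg| := by
    rw [← Complex.norm_mul_sin_arg z, abs_mul, abs_norm,
      Real.abs_sin_eq_sin_abs_of_abs_le_pi (Complex.abs_arg_le_pi z)]
  rw [hre, him] at hz'
  have h2 : Real.sin (θ - |z.arg|) < 0 := by
    rw [Real.sin_sub]
    nlinarith
  have h3 := Real.sin_pos_of_pos_of_lt_pi (x := θ - |z.arg|) (by linarith)
    (by linarith [abs_nonneg z.arg, Real.pi_pos])
  linarith

lemma neg_mem_sectorExt {θ : ℝ} (h0 : 0 < θ) (h1 : θ < Real.pi / 2) {a : ℝ} (ha : a < 0) :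
    (a : ℂ) ∈ sectorExt θ := by
  have := Real.sin_pos_of_pos_of_lt_pi h0 (by linarith [Real.pi_pos])
  simp only [sectorExt, mem_ofPred_eq, Complex.ofReal_re, Complex.ofReal_im, abs_zero, zero_mul]
  nlinarith

lemma cos_eq_of_abs_eq {α β : ℝ} (h : |β| = α) : Real.cos β = Real.cos α := by
  rw [← h, Real.cos_abs]

lemma abs_sin_eq_of_abs_eq {α β : ℝ} (hα : α < Real.pi / 2) (h : |β| = α) :
    |Real.sin β| = Real.sin α := by
  rw [← h, Real.abs_sin_eq_sin_abs_of_abs_le_pi]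
  linarith [Real.pi_pos]

section Ray

variable {θ α β : ℝ}

lemma rayPt_mem_sectorExt (h0 : 0 < θ) (h1 : θ < α) (h2 : α < Real.pi / 2) (hβ : |β| = α)
    {a r : ℝ} (ha : a < 0) (hr : 0 ≤ r) : rayPt a β r ∈ sectorExt θ := by
  have hs := Real.sin_pos_of_pos_of_lt_pi h0 (by linarith [Real.pi_pos])
  have hd := Real.sin_pos_of_pos_of_lt_pi (x := α - θ) (by linarith) (by linarith [Real.pi_pos])
  rw [Real.sin_sub] at hd
  simp only [sectorExt, mem_ofPred_eq, rayPt_re, rayPt_im, abs_mul, abs_of_nonneg hr,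
    cos_eq_of_abs_eq hβ, abs_sin_eq_of_abs_eq h2 hβ]
  nlinarith

lemma norm_rayPt_ge (h2 : α < Real.pi / 2) (hβ : |β| = α) {a r : ℝ} (ha : a < 0) :
    -a * Real.sin α ≤ ‖rayPt a β r‖ := by
  refine (sq_le_sq₀ ?_ (norm_nonneg _)).1 ?_
  · have := Real.sin_nonneg_of_nonneg_of_le_pi (x := α) (hβ ▸ abs_nonneg β)
      (by linarith [Real.pi_pos])
    nlinarith
  rw [Complex.sq_norm, Complex.normSq_apply, rayPt_re, rayPt_im, cos_eq_of_abs_eq hβ]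
  have e : Real.sin β ^ 2 = Real.sin α ^ 2 := by
    rw [← sq_abs, abs_sin_eq_of_abs_eq h2 hβ]
  have e' := Real.sin_sq_add_cos_sq α
  have : (a + r * Real.cos α) * (a + r * Real.cos α) + r * Real.sin β * (r * Real.sin β) -
      (-a * Real.sin α) ^ 2 = (r + a * Real.cos α) ^ 2 := by
    linear_combination r ^ 2 * e + (r ^ 2 - a ^ 2) * e'
  linarith [sq_nonneg (r + a * Real.cos α)]

lemma norm_rayPt_le {a r : ℝ} (ha : a < 0) (hr : 0 ≤ r) : ‖rayPt a β r‖ ≤ -a + r := by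
  refine (norm_add_le _ _).trans ?_
  rw [norm_mul, Complex.norm_exp_ofReal_mul_I, Complex.norm_real, Complex.norm_real,
    Real.norm_of_nonneg hr, Real.norm_of_nonpos ha.le, mul_one]

lemma norm_exp_rayPt (t a β r : ℝ) :
    ‖Complex.exp (-((t : ℂ) * rayPt a β r)) * Complex.exp ((β : ℂ) * Complex.I)‖ =
      Real.exp (-(t * a)) * Real.exp (-(t * Real.cos β * r)) := by
  rw [norm_mul, Complex.norm_exp_ofReal_mul_I, mul_one, Complex.norm_exp, Complex.neg_re,
    Complex.re_ofReal_mul, rayPt_re, ← Real.exp_add]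
  ring_nf

lemma hasDerivAt_rayPt (a β r : ℝ) :
    HasDerivAt (fun r : ℝ => rayPt a β r) (Complex.exp (β * Complex.I)) r := by
  have := (((hasDerivAt_id r).ofReal_comp).mul_const (Complex.exp (β * Complex.I))).const_add
    (a : ℂ)
  simpa [rayPt] using this

lemma hasDerivAt_rayPt_vertex (a β r : ℝ) :
    HasDerivAt (fun a : ℝ => rayPt a β r) 1 a := by
  have := ((hasDerivAt_id a).ofReal_comp).add_const (r * Complex.exp (β * Complex.I))
  simpa [rayPt] using this

lemma continuous_rayPt (a β : ℝ) : Continuous (fun r : ℝ => rayPt a β r) := by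
  unfold rayPt; fun_prop

lemma exists_pow_le_exp (n : ℕ) {b : ℝ} (hb : 0 < b) {q : ℝ} (hq : 0 < q) :
    ∃ C : ℝ, 0 < C ∧ ∀ r : ℝ, 0 ≤ r → (q + r) ^ n ≤ C * Real.exp (b * r) := by
  refine ⟨n.factorial / b ^ n * Real.exp (b * q), by positivity, fun r hr => ?_⟩
  have := Real.pow_div_factorial_le_exp (x := b * (q + r)) (by positivity) n
  rw [div_le_iff₀ (by positivity), mul_pow] at this
  rw [mul_assoc, ← Real.exp_add, ← mul_add, div_mul_eq_mul_div, le_div_iff₀ (by positivity)]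
  linarith

lemma exists_zpow_le_exp (m : ℤ) {p q b : ℝ} (hp : 0 < p) (hq : 0 < q) (hb : 0 < b) :
    ∃ C : ℝ, 0 < C ∧ ∀ x r : ℝ, p ≤ x → x ≤ q + r → 0 ≤ r → x ^ m ≤ C * Real.exp (b * r) := by
  obtain ⟨n, rfl | rfl⟩ := m.eq_nat_or_neg
  · obtain ⟨C, hC, h⟩ := exists_pow_le_exp n hb hq
    refine ⟨C, hC, fun x r h1 h2 h3 => ?_⟩
    rw [zpow_natCast]
    exact (pow_le_pow_left₀ (hp.le.trans h1) h2 n).trans (h r h3)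
  · refine ⟨(p ^ n)⁻¹, by positivity, fun x r h1 h2 h3 => ?_⟩
    rw [zpow_neg, zpow_natCast]
    have : (x ^ n)⁻¹ ≤ (p ^ n)⁻¹ := by gcongr
    have h4 : 1 ≤ Real.exp (b * r) := Real.one_le_exp (by positivity)
    have h5 : 0 < (p ^ n)⁻¹ := by positivity
    nlinarith

/-- Powers of the modulus grow subexponentially along the rays, uniformly for vertices in a compact
subset of the negative half-line. -/
lemma exists_norm_rayPt_zpow_le (m : ℤ) (h0 : 0 < α) (h2 : α < Real.pi / 2)
    {p q b : ℝ} (hp : 0 < p) (hq : 0 < q) (hb : 0 < b) :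
    ∃ C : ℝ, 0 < C ∧ ∀ β a r : ℝ, |β| = α → p ≤ -a → -a ≤ q → 0 ≤ r →
      ‖rayPt a β r‖ ^ m ≤ C * Real.exp (b * r) := by
  have hs := Real.sin_pos_of_pos_of_lt_pi h0 (by linarith [Real.pi_pos])
  obtain ⟨C, hC, h⟩ := exists_zpow_le_exp m (mul_pos hp hs) hq hb
  refine ⟨C, hC, fun β a r hβ h3 h4 hr => h _ _ ?_ ?_ hr⟩
  · exact le_trans (by gcongr) (norm_rayPt_ge h2 hβ (by linarith))
  · exact (norm_rayPt_le (by linarith) hr).trans (by linarith)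

end Ray

/-! ### Contour integrals of families with power bounds -/

section Contour

variable {E : Type*} [NormedAddCommGroup E] [NormedSpace ℂ E]

/-- The integrand of `∫ e^{-tζ} Q(ζ) dζ` along the ray `ζ = a + r e^{iβ}`. -/
def rayIntegrand (Q : ℂ → E) (a β t r : ℝ) : E :=
  (Complex.exp (-((t : ℂ) * rayPt a β r)) * Complex.exp ((β : ℂ) * Complex.I)) • Q (rayPt a β r)

/-- `∫ e^{-tζ} Q(ζ) dζ` over the ray `ζ = a + r e^{iβ}`, `r` from `0` to `∞`. -/
def rayInt (Q : ℂ → E) (a β t : ℝ) : E := ∫ r in Ioi (0 : ℝ), rayIntegrand Q a β t r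

/-- `(2πi)⁻¹ ∫ e^{-tζ} Q(ζ) dζ` over the positively oriented boundary of the translate by `a` of the
sector of half-angle `α`. -/
def contourInt (Q : ℂ → E) (α a t : ℝ) : E :=
  (2 * (Real.pi : ℂ) * Complex.I)⁻¹ • (rayInt Q a (-α) t - rayInt Q a α t)

/-- Holomorphy outside the sector of half-angle `θ`, with `Q(ζ) = O(|ζ|^m)` and
`Q'(ζ) = O(|ζ|^(m-1))` there. -/
def IsSectorBdd (θ : ℝ) (m : ℤ) (Q : ℂ → E) : Prop :=
  ∃ c : ℝ, 0 < c ∧ ∀ z ∈ sectorExt θ, DifferentiableAt ℂ Q z ∧ ‖Q z‖ ≤ c * ‖z‖ ^ m ∧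
    ‖deriv Q z‖ ≤ c * ‖z‖ ^ (m - 1)

/-- Continuity and subexponential growth of `Q` along the ray `a + r e^{iβ}`, `r ≥ 0`. -/
def IsRayBdd (a β : ℝ) (Q : ℂ → E) : Prop :=
  ContinuousOn (fun r => Q (rayPt a β r)) (Ici 0) ∧
    ∀ b : ℝ, 0 < b → ∃ C : ℝ, 0 < C ∧ ∀ r : ℝ, 0 ≤ r → ‖Q (rayPt a β r)‖ ≤ C * Real.exp (b * r)

variable {θ α β : ℝ}

lemma IsSectorBdd.id_smul {m : ℤ} {Q : ℂ → E} (h : IsSectorBdd θ m Q) :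
    IsSectorBdd θ (m + 1) (fun z => z • Q z) := by
  obtain ⟨c, hc, h⟩ := h
  refine ⟨2 * c, by positivity, fun z hz => ?_⟩
  obtain ⟨hd, hn, hn'⟩ := h z hz
  have hz0 : ‖z‖ ≠ 0 := norm_ne_zero_iff.2 (ne_zero_of_mem_sectorExt hz)
  have hp : 0 ≤ ‖z‖ ^ (m + 1) := zpow_nonneg (norm_nonneg _) _
  have hp' : 0 ≤ ‖z‖ ^ m := zpow_nonneg (norm_nonneg _) _
  have e1 : ‖z‖ * ‖z‖ ^ m = ‖z‖ ^ (m + 1) := by rw [zpow_add_one₀ hz0, mul_comm]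
  have e2 : ‖z‖ * ‖z‖ ^ (m - 1) = ‖z‖ ^ m := by rw [zpow_sub_one₀ hz0]; field_simp
  have hder : HasDerivAt (fun z => z • Q z) (z • deriv Q z + (1 : ℂ) • Q z) z :=
    (hasDerivAt_id z).smul hd.hasDerivAt
  refine ⟨hder.differentiableAt, ?_, ?_⟩
  · rw [norm_smul]
    have := mul_le_mul_of_nonneg_left hn (norm_nonneg z)
    rw [mul_left_comm, e1] at this
    nlinarith
  · rw [hder.deriv, add_sub_cancel_right]
    refine (norm_add_le _ _).trans ?_
    rw [norm_smul, one_smul]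
    have := mul_le_mul_of_nonneg_left hn' (norm_nonneg z)
    rw [mul_left_comm, e2] at this
    linarith

lemma IsSectorBdd.inv_smul {m : ℤ} {Q : ℂ → E} (h : IsSectorBdd θ m Q) :
    IsSectorBdd θ (m - 1) (fun z => z⁻¹ • Q z) := by
  obtain ⟨c, hc, h⟩ := h
  refine ⟨2 * c, by positivity, fun z hz => ?_⟩
  obtain ⟨hd, hn, hn'⟩ := h z hz
  have hzz := ne_zero_of_mem_sectorExt hz
  have hz0 : ‖z‖ ≠ 0 := norm_ne_zero_iff.2 hzz
  have hp' : 0 ≤ ‖z‖ ^ (m - 1) := zpow_nonneg (norm_nonneg _) _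
  have e1 : ‖z‖⁻¹ * ‖z‖ ^ m = ‖z‖ ^ (m - 1) := by rw [zpow_sub_one₀ hz0, mul_comm]
  have e2 : ‖z‖⁻¹ * ‖z‖ ^ (m - 1) = ‖z‖ ^ (m - 1 - 1) := by
    rw [zpow_sub_one₀ hz0 (m - 1), mul_comm]
  have e3 : (‖z‖ ^ 2)⁻¹ * ‖z‖ ^ m = ‖z‖ ^ (m - 1 - 1) := by
    rw [zpow_sub_one₀ hz0, zpow_sub_one₀ hz0]; field_simp
  have hder : HasDerivAt (fun z => z⁻¹ • Q z) (z⁻¹ • deriv Q z + (-(z ^ 2)⁻¹) • Q z) z :=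
    (hasDerivAt_inv hzz).smul hd.hasDerivAt
  refine ⟨hder.differentiableAt, ?_, ?_⟩
  · rw [norm_smul, norm_inv]
    have := mul_le_mul_of_nonneg_left hn (inv_nonneg.2 (norm_nonneg z))
    rw [mul_left_comm, e1] at this
    nlinarith
  · rw [hder.deriv]
    refine (norm_add_le _ _).trans ?_
    rw [norm_smul, norm_smul, norm_neg, norm_inv, norm_inv, norm_pow]
    have i1 := mul_le_mul_of_nonneg_left hn' (inv_nonneg.2 (norm_nonneg z))
    rw [mul_left_comm, e2] at i1
    have i2 := mul_le_mul_of_nonneg_left hn (inv_nonneg.2 (sq_nonneg ‖z‖))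
    rw [mul_left_comm, e3] at i2
    linarith

lemma IsSectorBdd.const (θ : ℝ) (v : E) : IsSectorBdd θ 0 (fun _ => v) := by
  refine ⟨‖v‖ + 1, by positivity, fun z _ => ⟨differentiableAt_const _, ?_, ?_⟩⟩
  · simp
  · rw [deriv_const, norm_zero]
    positivity

section

variable (h0 : 0 < θ) (h1 : θ < α) (h2 : α < Real.pi / 2)
include h0 h1 h2

lemma IsSectorBdd.exists_bound {m : ℤ} {Q : ℂ → E} (hQ : IsSectorBdd θ m Q)
    {p q b : ℝ} (hp : 0 < p) (hq : 0 < q) (hb : 0 < b) :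
    ∃ C : ℝ, 0 < C ∧ ∀ β a r : ℝ, |β| = α → p ≤ -a → -a ≤ q → 0 ≤ r →
      ‖Q (rayPt a β r)‖ ≤ C * Real.exp (b * r) ∧
      ‖deriv Q (rayPt a β r)‖ ≤ C * Real.exp (b * r) := by
  obtain ⟨c, hc, hQ⟩ := hQ
  obtain ⟨C, hC, h⟩ := exists_norm_rayPt_zpow_le m (h0.trans h1) h2 hp hq hb
  obtain ⟨C', hC', h'⟩ := exists_norm_rayPt_zpow_le (m - 1) (h0.trans h1) h2 hp hq hb
  refine ⟨c * (C + C'), by positivity, fun β a r hβ h3 h4 hr => ?_⟩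
  obtain ⟨-, hn, hn'⟩ := hQ _ (rayPt_mem_sectorExt h0 h1 h2 hβ (a := a) (by linarith) hr)
  have i1 := h β a r hβ h3 h4 hr
  have i2 := h' β a r hβ h3 h4 hr
  have e := Real.exp_pos (b * r)
  constructor
  · refine hn.trans ?_
    rw [mul_assoc]
    gcongr
    nlinarith
  · refine hn'.trans ?_
    rw [mul_assoc]
    gcongr
    nlinarith

lemma IsSectorBdd.isRayBdd {m : ℤ} {Q : ℂ → E} (hQ : IsSectorBdd θ m Q) {a : ℝ} (ha : a < 0)
    (hβ : |β| = α) : IsRayBdd a β Q := by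
  constructor
  · intro r hr
    obtain ⟨c, hc, hQ⟩ := hQ
    have := (hQ _ (rayPt_mem_sectorExt h0 h1 h2 hβ ha hr)).1.continuousAt
    exact (ContinuousAt.comp (f := fun r => rayPt a β r) this
      (continuous_rayPt a β).continuousAt).continuousWithinAt
  · intro b hb
    obtain ⟨C, hC, h⟩ := hQ.exists_bound h0 h1 h2 (p := -a) (q := -a) (by linarith) (by linarith) hb
    exact ⟨C, hC, fun r hr => (h β a r hβ le_rfl le_rfl hr).1⟩

end

lemma IsRayBdd.id_smul {a : ℝ} {Q : ℂ → E} (hQ : IsRayBdd a β Q) (ha : a < 0) :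
    IsRayBdd a β (fun z => z • Q z) := by
  refine ⟨(continuous_rayPt a β).continuousOn.smul hQ.1, fun b hb => ?_⟩
  obtain ⟨C, hC, h⟩ := hQ.2 (b / 2) (by positivity)
  obtain ⟨C', hC', h'⟩ := exists_pow_le_exp 1 (half_pos hb) (neg_pos.2 ha)
  refine ⟨C' * C, by positivity, fun r hr => ?_⟩
  rw [norm_smul]
  have i1 := h r hr
  have i2 := (norm_rayPt_le (β := β) ha hr).trans ((pow_one (-a + r)).symm.le.trans (h' r hr))
  calc _ ≤ (C' * Real.exp (b / 2 * r)) * (C * Real.exp (b / 2 * r)) := by gcongr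
    _ = C' * C * (Real.exp (b / 2 * r) * Real.exp (b / 2 * r)) := by ring
    _ = _ := by rw [← Real.exp_add]; ring_nf

lemma continuousOn_rayIntegrand {a : ℝ} {Q : ℂ → E} (hQ : IsRayBdd a β Q) (t : ℝ) :
    ContinuousOn (rayIntegrand Q a β t) (Ici 0) := by
  refine ContinuousOn.smul ?_ hQ.1
  have := continuous_rayPt a β
  fun_prop

lemma integrableOn_exp_neg_mul {b : ℝ} (hb : 0 < b) (C : ℝ) :
    IntegrableOn (fun r : ℝ => C * Real.exp (-(b * r))) (Ioi 0) := by
  have := (integrableOn_exp_mul_Ioi (neg_lt_zero.2 hb) 0).const_mul C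
  simpa only [neg_mul] using! this

lemma integral_exp_neg_mul {b : ℝ} (hb : 0 < b) (C : ℝ) :
    ∫ r in Ioi (0 : ℝ), C * Real.exp (-(b * r)) = C / b := by
  have := integral_exp_mul_Ioi (neg_lt_zero.2 hb) 0
  simp only [neg_mul, mul_zero, Real.exp_zero] at this
  rw [integral_const_mul, this]
  field_simp

lemma norm_rayIntegrand_le {a t r C b : ℝ} {Q : ℂ → E}
    (hC : ‖Q (rayPt a β r)‖ ≤ C * Real.exp (b * r)) :
    ‖rayIntegrand Q a β t r‖ ≤
      Real.exp (-(t * a)) * C * Real.exp (-((t * Real.cos β - b) * r)) := by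
  rw [rayIntegrand, norm_smul, norm_exp_rayPt]
  calc _ ≤ Real.exp (-(t * a)) * Real.exp (-(t * Real.cos β * r)) * (C * Real.exp (b * r)) := by
        gcongr
    _ = Real.exp (-(t * a)) * C * (Real.exp (-(t * Real.cos β * r)) * Real.exp (b * r)) := by ring
    _ = _ := by rw [← Real.exp_add]; ring_nf

lemma integrableOn_rayIntegrand {a : ℝ} {Q : ℂ → E} (hQ : IsRayBdd a β Q) {t : ℝ} (ht : 0 < t)
    (hβ : 0 < Real.cos β) : IntegrableOn (rayIntegrand Q a β t) (Ioi 0) := by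
  obtain ⟨C, hC, h⟩ := hQ.2 (t * Real.cos β / 2) (by positivity)
  refine Integrable.mono' (integrableOn_exp_neg_mul (b := t * Real.cos β / 2) (by positivity)
    (Real.exp (-(t * a)) * C))
    (((continuousOn_rayIntegrand hQ t).mono Ioi_subset_Ici_self).aestronglyMeasurable
      measurableSet_Ioi) ?_
  refine (ae_restrict_mem measurableSet_Ioi).mono fun r hr => ?_
  refine (norm_rayIntegrand_le (h r (le_of_lt hr))).trans (le_of_eq ?_)
  ring_nf

lemma hasDerivAt_rayInt {a : ℝ} {Q : ℂ → E} (hQ : IsRayBdd a β Q) (ha : a < 0) {t : ℝ}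
    (ht : 0 < t) (hβ : 0 < Real.cos β) :
    HasDerivAt (rayInt Q a β) (-rayInt (fun z => z • Q z) a β t) t := by
  have hQ' := hQ.id_smul ha
  obtain ⟨C, hC, h⟩ := hQ'.2 (t * Real.cos β / 4) (by positivity)
  have key := hasDerivAt_integral_of_dominated_loc_of_deriv_le (μ := volume.restrict (Ioi (0 : ℝ)))
    (F := fun t r => rayIntegrand Q a β t r)
    (F' := fun t r => -rayIntegrand (fun z => z • Q z) a β t r) (x₀ := t)
    (s := Ioo (t / 2) (2 * t))
    (bound := fun r => Real.exp (-(2 * t * a)) * C * Real.exp (-(t * Real.cos β / 4 * r)))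
    (Ioo_mem_nhds (by linarith) (by linarith))
    (Eventually.of_forall fun x => ((continuousOn_rayIntegrand hQ x).mono
      Ioi_subset_Ici_self).aestronglyMeasurable measurableSet_Ioi)
    (integrableOn_rayIntegrand hQ ht hβ)
    (((continuousOn_rayIntegrand hQ' t).mono
      Ioi_subset_Ici_self).aestronglyMeasurable measurableSet_Ioi).neg
    ?_ (integrableOn_exp_neg_mul (by positivity) _) ?_
  · have := key.2
    rw [integral_neg] at this
    exact this
  · refine (ae_restrict_mem measurableSet_Ioi).mono fun r hr x hx => ?_
    have hr0 : (0 : ℝ) < r := hr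
    rw [norm_neg]
    refine (norm_rayIntegrand_le (h r (le_of_lt hr))).trans ?_
    gcongr ?_ * C * ?_
    · exact Real.exp_le_exp.2 (by nlinarith [hx.2])
    · apply Real.exp_le_exp.2
      have : t / 2 * Real.cos β ≤ x * Real.cos β := by gcongr; exact hx.1.le
      nlinarith
  · refine Eventually.of_forall fun r x hx => ?_
    have e1 : HasDerivAt (fun x : ℝ => Complex.exp (-((x : ℂ) * rayPt a β r)))
        (Complex.exp (-((x : ℂ) * rayPt a β r)) * (-(1 * rayPt a β r))) x :=
      (((hasDerivAt_id x).ofReal_comp.mul_const (rayPt a β r)).neg).cexp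
    have e2 := (e1.mul_const (Complex.exp ((β : ℂ) * Complex.I))).smul_const (Q (rayPt a β r))
    refine e2.congr_deriv ?_
    rw [rayIntegrand, smul_smul, ← neg_smul]
    congr 1
    ring

lemma cos_pos_of_abs_eq (h2 : α < Real.pi / 2) (hβ : |β| = α) : 0 < Real.cos β := by
  rw [cos_eq_of_abs_eq hβ]
  exact Real.cos_pos_of_mem_Ioo ⟨by linarith [abs_nonneg β, Real.pi_pos], h2⟩

end Contour

/-! ### Independence of the vertex of the contour -/

section ContourMoves

variable {E : Type*} [NormedAddCommGroup E] [NormedSpace ℂ E] {θ α β : ℝ}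

section

variable (h0 : 0 < θ) (h1 : θ < α) (h2 : α < Real.pi / 2)
include h0 h1 h2

/-- Moving the vertex `a` changes the ray integral at the rate `-e^{-ta} Q(a)`, which does not depend
on the direction of the ray. -/
lemma hasDerivAt_rayInt_vertex [CompleteSpace E] {m : ℤ} {Q : ℂ → E} (hQ : IsSectorBdd θ m Q)
    {a t : ℝ} (ha : a < 0) (ht : 0 < t) (hβ : |β| = α) :
    HasDerivAt (fun a => rayInt Q a β t) (-(Complex.exp (-((t : ℂ) * a)) • Q a)) a := by
  have hcos := cos_pos_of_abs_eq h2 hβ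
  obtain ⟨C, hC, h⟩ := hQ.exists_bound h0 h1 h2 (p := -a / 2) (q := -(2 * a))
    (b := t * Real.cos β / 2) (by linarith) (by linarith) (by positivity)
  -- the derivative of the integrand along the ray, without the direction factor
  let G : ℝ → ℝ → E := fun a r => rayIntegrand (fun z => deriv Q z - (t : ℂ) • Q z) a β t r
  have hG : ∀ a r : ℝ, rayPt a β r ∈ sectorExt θ → ∀ (w : ℂ) (p : ℝ → ℂ) (x : ℝ),
      p x = rayPt a β r → HasDerivAt p w x →
      HasDerivAt (fun x => Complex.exp (-((t : ℂ) * p x)) • Q (p x))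
        ((Complex.exp (-((t : ℂ) * rayPt a β r)) * w) • (deriv Q (rayPt a β r) -
          (t : ℂ) • Q (rayPt a β r))) x := by
    intro a r hm w p x hp hw
    obtain ⟨c, -, hQ'⟩ := hQ
    have d1 : HasDerivAt Q (deriv Q (rayPt a β r)) (p x) := hp ▸ (hQ' _ hm).1.hasDerivAt
    have d2 := (hw.const_mul (t : ℂ)).neg.cexp
    have d3 := d2.smul (HasDerivAt.scomp x d1 hw)
    refine d3.congr_deriv ?_
    simp only [Function.comp_apply, Pi.neg_apply, hp, smul_sub, smul_smul]
    rw [sub_eq_add_neg, ← neg_smul]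
    congr 2
    ring
  have hbd : ∀ x ∈ Ioo (2 * a) (a / 2), ∀ r : ℝ, 0 < r → ‖G x r‖ ≤
      Real.exp (-(2 * t * a)) * ((1 + t) * C) * Real.exp (-(t * Real.cos β / 2 * r)) := by
    intro x hx r hr
    obtain ⟨i1, i2⟩ := h β x r hβ (by linarith [hx.2]) (by linarith [hx.1]) hr.le
    have : ‖deriv Q (rayPt x β r) - (t : ℂ) • Q (rayPt x β r)‖ ≤
        ((1 + t) * C) * Real.exp (t * Real.cos β / 2 * r) := by
      refine (norm_sub_le _ _).trans ?_
      rw [norm_smul, Complex.norm_real, Real.norm_of_nonneg ht.le]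
      nlinarith
    refine (norm_rayIntegrand_le (Q := fun z => deriv Q z - (t : ℂ) • Q z) this).trans ?_
    have e : t * Real.cos β - t * Real.cos β / 2 = t * Real.cos β / 2 := by ring
    rw [e]
    gcongr ?_ * _ * _
    exact Real.exp_le_exp.2 (by nlinarith [hx.1])
  have hbi := integrableOn_exp_neg_mul (b := t * Real.cos β / 2) (by positivity)
    (Real.exp (-(2 * t * a)) * ((1 + t) * C))
  have hmem : ∀ x : ℝ, x < 0 → ∀ r : ℝ, 0 ≤ r → rayPt x β r ∈ sectorExt θ :=
    fun x hx r hr => rayPt_mem_sectorExt h0 h1 h2 hβ hx hr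
  have hGm : AEStronglyMeasurable (G a) (volume.restrict (Ioi 0)) := by
    have hc : ContinuousOn (fun r => Complex.exp (-((t : ℂ) * rayPt a β r)) •
        Q (rayPt a β r)) (Ici 0) := fun r hr =>
      ((hG a r (hmem a ha r hr) _ _ r rfl (hasDerivAt_rayPt a β r)).continuousAt).continuousWithinAt
    have hd : DifferentiableOn ℂ Q (sectorExt θ) := by
      obtain ⟨c, -, hQ'⟩ := hQ
      exact fun z hz => (hQ' z hz).1.differentiableWithinAt
    have hcd : ContinuousOn (deriv Q) (sectorExt θ) :=
      (hd.deriv (isOpen_sectorExt θ)).continuousOn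
    have hcr : ContinuousOn (fun r => rayPt a β r) (Ici 0) := (continuous_rayPt a β).continuousOn
    have : ContinuousOn (G a) (Ici 0) := by
      refine ContinuousOn.smul ?_ ?_
      · have := continuous_rayPt a β
        fun_prop
      · exact (hcd.comp hcr fun r hr => hmem a ha r hr).sub
          (((hd.continuousOn).comp hcr fun r hr => hmem a ha r hr).const_smul _)
    exact (this.mono Ioi_subset_Ici_self).aestronglyMeasurable measurableSet_Ioi
  have key := hasDerivAt_integral_of_dominated_loc_of_deriv_le (μ := volume.restrict (Ioi (0 : ℝ)))
    (F := fun a r => rayIntegrand Q a β t r) (F' := G) (x₀ := a) (s := Ioo (2 * a) (a / 2))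
    (Ioo_mem_nhds (by linarith) (by linarith)) ?_
    (integrableOn_rayIntegrand (hQ.isRayBdd h0 h1 h2 ha hβ) ht hcos) hGm ?_ hbi ?_
  · have hint : ∫ r in Ioi (0 : ℝ), G a r = -(Complex.exp (-((t : ℂ) * a)) • Q a) := by
      have hlim : Tendsto (fun r => Complex.exp (-((t : ℂ) * rayPt a β r)) • Q (rayPt a β r)) atTop
          (𝓝 0) := by
        have hz : Tendsto (fun r : ℝ => Real.exp (-(t * a)) * C *
            Real.exp (-((t * Real.cos β - t * Real.cos β / 2) * r))) atTop (𝓝 0) := by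
          have e : t * Real.cos β - t * Real.cos β / 2 = t * Real.cos β / 2 := by ring
          rw [e]
          have : Tendsto (fun r : ℝ => Real.exp (-(t * Real.cos β / 2 * r))) atTop (𝓝 0) :=
            Real.tendsto_exp_neg_atTop_nhds_zero.comp
              (tendsto_id.const_mul_atTop (by positivity))
          simpa using this.const_mul (Real.exp (-(t * a)) * C)
        refine squeeze_zero_norm' ?_ hz
        filter_upwards [eventually_ge_atTop 0] with r hr
        have := norm_rayIntegrand_le (β := β) (a := a) (t := t)
          (h β a r hβ (by linarith) (by linarith) hr).1
        refine le_trans (le_of_eq ?_) this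
        rw [rayIntegrand, mul_smul, smul_comm, norm_smul (Complex.exp (β * Complex.I)),
          Complex.norm_exp_ofReal_mul_I, one_mul]
      have := integral_Ioi_of_hasDerivAt_of_tendsto' (a := (0 : ℝ)) (f' := G a)
        (fun r hr => hG a r (hmem a ha r hr) _ _ r rfl (hasDerivAt_rayPt a β r))
        (Integrable.mono' hbi hGm ((ae_restrict_mem measurableSet_Ioi).mono fun r hr =>
          hbd a ⟨by linarith, by linarith⟩ r hr)) hlim
      rw [this]
      simp [rayPt]
    rw [← hint]
    exact key.2
  · filter_upwards [Iio_mem_nhds ha] with x hx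
    exact ((continuousOn_rayIntegrand (hQ.isRayBdd h0 h1 h2 hx hβ) t).mono
      Ioi_subset_Ici_self).aestronglyMeasurable measurableSet_Ioi
  · exact (ae_restrict_mem measurableSet_Ioi).mono fun r hr x hx => hbd x hx r hr
  · refine (ae_restrict_mem measurableSet_Ioi).mono fun r hr x hx => ?_
    have d := hG x r (hmem x (by linarith [hx.2]) r (le_of_lt hr)) _ _ x rfl
      (hasDerivAt_rayPt_vertex x β r)
    have d' := d.const_smul (Complex.exp (β * Complex.I))
    have e : (fun x => rayIntegrand Q x β t r) = fun y => Complex.exp (β * Complex.I) •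
        Complex.exp (-((t : ℂ) * rayPt y β r)) • Q (rayPt y β r) := by
      funext y
      rw [rayIntegrand, smul_smul, mul_comm]
    rw [e]
    refine d'.congr_deriv ?_
    simp only [G, rayIntegrand, smul_smul]
    congr 1
    ring

/-- The contour integral does not depend on the vertex `a < 0`. -/
lemma contourInt_vertex_eq [CompleteSpace E] {m : ℤ} {Q : ℂ → E} (hQ : IsSectorBdd θ m Q)
    {a b t : ℝ} (ha : a < 0) (hb : b < 0) (ht : 0 < t) :
    contourInt Q α a t = contourInt Q α b t := by
  have hα : |α| = α := abs_of_pos (h0.trans h1)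
  have hα' : |-α| = α := by rw [abs_neg, hα]
  have hd : ∀ x ∈ Iio (0 : ℝ), HasDerivAt (fun x => contourInt Q α x t) 0 x := by
    intro x hx
    have := ((hasDerivAt_rayInt_vertex h0 h1 h2 hQ hx ht hα').sub
      (hasDerivAt_rayInt_vertex h0 h1 h2 hQ hx ht hα)).const_smul
        (2 * (Real.pi : ℂ) * Complex.I)⁻¹
    refine this.congr_deriv ?_
    simp
  exact (convex_Iio 0).is_const_of_fderivWithin_eq_zero (𝕜 := ℝ)
    (fun x hx => (hd x hx).differentiableAt.differentiableWithinAt)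
    (fun x hx => by
      rw [fderivWithin_of_isOpen isOpen_Iio hx]
      ext
      simp [(hd x hx).deriv]) ha hb

/-- Choosing the vertex `-1/t` gives the scale-invariant bound for the contour integral. -/
lemma IsSectorBdd.exists_norm_contourInt_le [CompleteSpace E] {m : ℤ} {Q : ℂ → E}
    (hQ : IsSectorBdd θ m Q) :
    ∃ C : ℝ, 0 < C ∧ ∀ a t : ℝ, a < 0 → 0 < t → ‖contourInt Q α a t‖ ≤ C * t ^ (-m - 1) := by
  have hα : |α| = α := abs_of_pos (h0.trans h1)
  have hα' : |-α| = α := by rw [abs_neg, hα]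
  have hcos := cos_pos_of_abs_eq h2 hα
  obtain ⟨c, hc, hQ'⟩ := id hQ
  obtain ⟨C, hC, h⟩ := exists_norm_rayPt_zpow_le m (h0.trans h1) h2 (p := 1) (q := 1)
    (b := Real.cos α / 2) one_pos one_pos (by positivity)
  let K : ℝ := Real.exp 1 * (c * C) / (Real.cos α / 2)
  have hK : ∀ β t : ℝ, |β| = α → 0 < t → ‖rayInt Q (-(1 / t)) β t‖ ≤ K * t ^ (-m - 1) := by
    intro β t hβ ht
    have ha : -(1 / t) < 0 := by have := one_div_pos.2 ht; linarith
    have hsc : ∀ r : ℝ, rayPt (-(1 / t)) β r = ((1 / t : ℝ) : ℂ) * rayPt (-1) β (t * r) := by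
      intro r
      have : (t : ℂ) ≠ 0 := by exact_mod_cast ht.ne'
      simp only [rayPt]
      push_cast
      field_simp
    have hle : ∀ r ∈ Ioi (0 : ℝ), ‖rayIntegrand Q (-(1 / t)) β t r‖ ≤
        Real.exp 1 * (c * C) * t ^ (-m) * Real.exp (-(t * Real.cos α / 2 * r)) := by
      intro r hr
      have hr0 : (0 : ℝ) < r := hr
      have i1 : ‖Q (rayPt (-(1 / t)) β r)‖ ≤
          c * C * t ^ (-m) * Real.exp (t * Real.cos α / 2 * r) := by
        refine (hQ' _ (rayPt_mem_sectorExt h0 h1 h2 hβ ha hr0.le)).2.1.trans ?_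
        rw [hsc r, norm_mul, mul_zpow, Complex.norm_real, Real.norm_of_nonneg (by positivity),
          one_div, inv_zpow']
        have := h β (-1) (t * r) hβ (by norm_num) (by norm_num) (by positivity)
        calc _ ≤ c * (t ^ (-m) * (C * Real.exp (Real.cos α / 2 * (t * r)))) := by gcongr
          _ = _ := by ring_nf
      refine (norm_rayIntegrand_le i1).trans (le_of_eq ?_)
      have e1 : -(t * -(1 / t)) = 1 := by field_simp
      have e2 : t * Real.cos β - t * Real.cos α / 2 = t * Real.cos α / 2 := by
        rw [cos_eq_of_abs_eq hβ]; ring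
      rw [e1, e2]
      ring
    have hpos : 0 < t * Real.cos α / 2 := by positivity
    refine (norm_integral_le_of_norm_le (integrableOn_exp_neg_mul hpos _)
      ((ae_restrict_mem measurableSet_Ioi).mono hle)).trans (le_of_eq ?_)
    rw [integral_exp_neg_mul hpos, zpow_sub_one₀ ht.ne']
    simp only [K]
    field_simp
  have hKp : 0 < K := by positivity
  refine ⟨‖(2 * (Real.pi : ℂ) * Complex.I)⁻¹‖ * (2 * K), ?_, fun a t ha ht => ?_⟩
  · have : 0 < ‖(2 * (Real.pi : ℂ) * Complex.I)⁻¹‖ :=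
      norm_pos_iff.2 (inv_ne_zero Complex.two_pi_I_ne_zero)
    positivity
  · have ha' : -(1 / t) < 0 := by have := one_div_pos.2 ht; linarith
    rw [contourInt_vertex_eq h0 h1 h2 hQ ha ha' ht, contourInt, norm_smul]
    have hle : ‖rayInt Q (-(1 / t)) (-α) t - rayInt Q (-(1 / t)) α t‖ ≤
        2 * (K * t ^ (-m - 1)) :=
      (norm_sub_le _ _).trans (by linarith [hK (-α) t hα' ht, hK α t hα ht])
    refine (mul_le_mul_of_nonneg_left hle (norm_nonneg _)).trans (le_of_eq ?_)
    ring

end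

lemma hasDerivAt_contourInt {a : ℝ} {Q : ℂ → E} (hQ : ∀ β, |β| = α → IsRayBdd a β Q) (ha : a < 0)
    (h0 : 0 < α) (h2 : α < Real.pi / 2) {t : ℝ} (ht : 0 < t) :
    HasDerivAt (contourInt Q α a) (-contourInt (fun z => z • Q z) α a t) t := by
  have hα : |α| = α := abs_of_pos h0
  have hα' : |-α| = α := by rw [abs_neg, hα]
  have := ((hasDerivAt_rayInt (hQ _ hα') ha ht (cos_pos_of_abs_eq h2 hα')).sub
    (hasDerivAt_rayInt (hQ _ hα) ha ht (cos_pos_of_abs_eq h2 hα))).const_smul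
      (2 * (Real.pi : ℂ) * Complex.I)⁻¹
  refine this.congr_deriv ?_
  rw [contourInt, ← smul_neg]
  congr 1
  abel

omit [NormedSpace ℂ E] in
lemma IsRayBdd.add {a : ℝ} {P Q : ℂ → E} (hP : IsRayBdd a β P) (hQ : IsRayBdd a β Q) :
    IsRayBdd a β (fun z => P z + Q z) := by
  refine ⟨hP.1.add hQ.1, fun b hb => ?_⟩
  obtain ⟨C, hC, h⟩ := hP.2 b hb
  obtain ⟨C', hC', h'⟩ := hQ.2 b hb
  refine ⟨C + C', by positivity, fun r hr => ?_⟩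
  rw [add_mul]
  exact (norm_add_le _ _).trans (add_le_add (h r hr) (h' r hr))

lemma IsRayBdd.clm_comp {F : Type*} [NormedAddCommGroup F] [NormedSpace ℂ F] {a : ℝ}
    (L : E →L[ℂ] F) {Q : ℂ → E} (hQ : IsRayBdd a β Q) : IsRayBdd a β (fun z => L (Q z)) := by
  refine ⟨L.continuous.comp_continuousOn hQ.1, fun b hb => ?_⟩
  obtain ⟨C, hC, h⟩ := hQ.2 b hb
  refine ⟨(‖L‖ + 1) * C, by positivity, fun r hr => (L.le_opNorm _).trans ?_⟩
  rw [mul_assoc]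
  exact mul_le_mul (le_add_of_nonneg_right zero_le_one) (h r hr) (norm_nonneg _) (by positivity)

lemma contourInt_clm_comp {F : Type*} [NormedAddCommGroup F] [NormedSpace ℂ F]
    [CompleteSpace E] [CompleteSpace F] (L : E →L[ℂ] F) {a : ℝ} {Q : ℂ → E}
    (hQ : ∀ β, |β| = α → IsRayBdd a β Q)
    (h0 : 0 < α) (h2 : α < Real.pi / 2) {t : ℝ} (ht : 0 < t) :
    contourInt (fun z => L (Q z)) α a t = L (contourInt Q α a t) := by
  have hα : |α| = α := abs_of_pos h0
  have hα' : |-α| = α := by rw [abs_neg, hα]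
  have : ∀ β, |β| = α → rayInt (fun z => L (Q z)) a β t = L (rayInt Q a β t) := by
    intro β hβ
    rw [rayInt, rayInt, ← L.integral_comp_comm
      (integrableOn_rayIntegrand (hQ β hβ) ht (cos_pos_of_abs_eq h2 hβ))]
    simp [rayIntegrand]
  rw [contourInt, contourInt, this _ hα, this _ hα', map_smul, map_sub]

lemma contourInt_add {a : ℝ} {P Q : ℂ → E}
    (hP : ∀ β, |β| = α → IsRayBdd a β P) (hQ : ∀ β, |β| = α → IsRayBdd a β Q)
    (h0 : 0 < α) (h2 : α < Real.pi / 2) {t : ℝ} (ht : 0 < t) :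
    contourInt (fun z => P z + Q z) α a t = contourInt P α a t + contourInt Q α a t := by
  have hα : |α| = α := abs_of_pos h0
  have hα' : |-α| = α := by rw [abs_neg, hα]
  have : ∀ β, |β| = α →
      rayInt (fun z => P z + Q z) a β t = rayInt P a β t + rayInt Q a β t := by
    intro β hβ
    have hc := cos_pos_of_abs_eq h2 hβ
    rw [rayInt, rayInt, rayInt, ← integral_add (integrableOn_rayIntegrand (hP β hβ) ht hc)
      (integrableOn_rayIntegrand (hQ β hβ) ht hc)]
    simp [rayIntegrand]
  rw [contourInt, contourInt, contourInt, this _ hα, this _ hα', ← smul_add]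
  congr 1
  abel

lemma contourInt_congr {a : ℝ} {P Q : ℂ → E} (h0 : 0 < α)
    (h : ∀ β, |β| = α → ∀ r, 0 ≤ r → P (rayPt a β r) = Q (rayPt a β r)) (t : ℝ) :
    contourInt P α a t = contourInt Q α a t := by
  have hα : |α| = α := abs_of_pos h0
  have hα' : |-α| = α := by rw [abs_neg, hα]
  have : ∀ β, |β| = α → rayInt P a β t = rayInt Q a β t := by
    intro β hβ
    refine setIntegral_congr_fun measurableSet_Ioi fun r hr => ?_
    simp only [rayIntegrand]
    rw [h β hβ r (le_of_lt hr)]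
  rw [contourInt, contourInt, this _ hα, this _ hα']

end ContourMoves

/-! ### Contour integrals of scalar functions -/

section Scalar

variable {α β : ℝ}

lemma contourInt_const {E : Type*} [NormedAddCommGroup E] [NormedSpace ℂ E] [CompleteSpace E]
    (h0 : 0 < α) (h2 : α < Real.pi / 2) {t : ℝ} (ht : 0 < t) (v : E) :
    contourInt (fun _ => v) α (-1) t = 0 := by
  have h := contourInt_vertex_eq (half_pos h0) (half_lt_self h0) h2 (IsSectorBdd.const (α / 2) v)
    (a := -2) (b := -1) (by norm_num) (by norm_num) ht
  -- translating the contour by `-1` multiplies the integral of `e^{-tζ}` by `e^t`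
  have hr : ∀ β, rayInt (fun _ => v) (-2) β t = Complex.exp t • rayInt (fun _ => v) (-1) β t := by
    intro β
    rw [rayInt, rayInt, ← integral_smul]
    congr 1
    funext r
    rw [rayIntegrand, rayIntegrand, smul_smul]
    simp only [← Complex.exp_add]
    congr 2
    simp only [rayPt]
    push_cast
    ring
  have h' : contourInt (fun _ => v) α (-2) t =
      Complex.exp t • contourInt (fun _ => v) α (-1) t := by
    rw [contourInt, hr, hr, ← smul_sub, smul_comm, ← contourInt]
  rw [h'] at h
  have h3 : (Complex.exp t - 1) • contourInt (fun _ => v) α (-1) t = 0 := by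
    rw [sub_smul, h, one_smul, sub_self]
  refine (smul_eq_zero.1 h3).resolve_left fun h4 => ?_
  have h5 : Real.exp t = 1 := by
    have := sub_eq_zero.1 h4
    exact_mod_cast this
  have := Real.add_one_lt_exp ht.ne'
  linarith

lemma le_norm_rayPt_add_two (hβ : |β| = α) (r : ℝ) :
    1 + r * Real.cos α ≤ ‖rayPt (-1) β r + 2‖ := by
  refine le_trans (le_of_eq ?_) (Complex.re_le_norm _)
  rw [Complex.add_re, rayPt_re, cos_eq_of_abs_eq hβ, Complex.re_ofNat]
  ring

lemma rayPt_add_two_ne_zero (h2 : α < Real.pi / 2) (hβ : |β| = α) {r : ℝ} (hr : 0 ≤ r) :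
    rayPt (-1) β r + 2 ≠ 0 := by
  have hc := cos_pos_of_abs_eq h2 hβ
  rw [cos_eq_of_abs_eq hβ] at hc
  have := le_norm_rayPt_add_two hβ r
  intro h
  rw [h, norm_zero] at this
  nlinarith

lemma norm_inv_rayPt_add_two_le (h2 : α < Real.pi / 2) (hβ : |β| = α) {r : ℝ} (hr : 0 ≤ r) :
    ‖(rayPt (-1) β r + 2)⁻¹‖ ≤ 1 := by
  have hc := cos_pos_of_abs_eq h2 hβ
  rw [cos_eq_of_abs_eq hβ] at hc
  rw [norm_inv]
  refine inv_le_one_of_one_le₀ ((le_add_of_nonneg_right ?_).trans (le_norm_rayPt_add_two hβ r))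
  positivity

lemma isRayBdd_inv_add_two (h2 : α < Real.pi / 2) (hβ : |β| = α) :
    IsRayBdd (-1) β (fun z : ℂ => (z + 2)⁻¹) := by
  refine ⟨ContinuousOn.inv₀ ((continuous_rayPt _ _).add continuous_const).continuousOn
    fun r hr => rayPt_add_two_ne_zero h2 hβ hr, fun b hb => ⟨1, one_pos, fun r hr => ?_⟩⟩
  rw [one_mul]
  exact (norm_inv_rayPt_add_two_le h2 hβ hr).trans (Real.one_le_exp (by positivity))

/-- The pole `-2` lies to the left of the contour, so the integral vanishes: as a function of `t` it
solves `h' = 2 h` and is `O(e^t)`. -/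
lemma contourInt_inv_add_two (h0 : 0 < α) (h2 : α < Real.pi / 2) {t : ℝ} (ht : 0 < t) :
    contourInt (fun z : ℂ => (z + 2)⁻¹) α (-1) t = 0 := by
  have hα : |α| = α := abs_of_pos h0
  have hα' : |-α| = α := by rw [abs_neg, hα]
  have hcos := cos_pos_of_abs_eq h2 hα
  set h : ℝ → ℂ := contourInt (fun z : ℂ => (z + 2)⁻¹) α (-1) with hh
  have hR : ∀ β, |β| = α → IsRayBdd (-1) β (fun z : ℂ => (z + 2)⁻¹) :=
    fun β hβ => isRayBdd_inv_add_two h2 hβ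
  have hd : ∀ s : ℝ, 0 < s → HasDerivAt h (2 * h s) s := by
    intro s hs
    have d := hasDerivAt_contourInt (a := -1) hR (by norm_num) h0 h2 hs
    refine d.congr_deriv ?_
    have hc : ∀ β, |β| = α → IsRayBdd (-1) β (fun _ : ℂ => (-1 : ℂ)) := fun β hβ =>
      (IsSectorBdd.const (α / 2) (-1 : ℂ)).isRayBdd (half_pos h0) (half_lt_self h0) h2
        (by norm_num) hβ
    have e1 : contourInt (fun z : ℂ => (2 : ℂ) * (z + 2)⁻¹) α (-1) s = 2 * h s := by
      simpa using! contourInt_clm_comp (ContinuousLinearMap.mul ℂ ℂ 2) hR h0 h2 hs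
    have e2 : contourInt (fun z : ℂ => (-1 : ℂ) * (z • (z + 2)⁻¹)) α (-1) s =
        (-1 : ℂ) * contourInt (fun z : ℂ => z • (z + 2)⁻¹) α (-1) s := by
      simpa using! contourInt_clm_comp (ContinuousLinearMap.mul ℂ ℂ (-1))
        (fun β hβ => (hR β hβ).id_smul (by norm_num)) h0 h2 hs
    have e3 := contourInt_add hc (P := fun _ => (-1 : ℂ)) (Q := fun z : ℂ => (2 : ℂ) * (z + 2)⁻¹)
      (a := -1) (fun β hβ => by
        refine ⟨continuousOn_const.mul (hR β hβ).1, fun b hb => ?_⟩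
        obtain ⟨C, hC, h⟩ := (hR β hβ).2 b hb
        refine ⟨2 * C, by positivity, fun r hr => ?_⟩
        rw [norm_mul, mul_assoc, Complex.norm_ofNat]
        exact mul_le_mul_of_nonneg_left (h r hr) two_pos.le) h0 h2 hs
    rw [contourInt_const h0 h2 hs, zero_add, e1] at e3
    rw [← e3, ← neg_one_mul, ← e2]
    refine contourInt_congr h0 (fun β hβ r hr => ?_) s
    have := rayPt_add_two_ne_zero h2 hβ hr
    rw [smul_eq_mul]
    field_simp
    ring
  have hcst : ∀ s : ℝ, 0 < s → HasDerivAt (fun s : ℝ => Complex.exp (-(2 * s)) * h s) 0 s := by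
    intro s hs
    have e : HasDerivAt (fun s : ℝ => Complex.exp (-(2 * s)))
        (Complex.exp (-(2 * s)) * (-(2 * 1))) s :=
      (((hasDerivAt_id s).ofReal_comp.const_mul (2 : ℂ)).neg).cexp
    refine (e.mul (hd s hs)).congr_deriv ?_
    ring
  have heq : ∀ s : ℝ, 0 < s →
      Complex.exp (-(2 * s)) * h s = Complex.exp (-(2 * t)) * h t := fun s hs =>
    (convex_Ioi (0 : ℝ)).is_const_of_fderivWithin_eq_zero (𝕜 := ℝ)
      (fun x hx => (hcst x hx).differentiableAt.differentiableWithinAt)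
      (fun x hx => by
        rw [fderivWithin_of_isOpen isOpen_Ioi hx]
        ext
        simp [(hcst x hx).deriv]) hs ht
  let K : ℝ := ‖(2 * (Real.pi : ℂ) * Complex.I)⁻¹‖ * (2 * (1 / Real.cos α))
  have hbd : ∀ s : ℝ, 1 ≤ s → ‖h s‖ ≤ K * Real.exp s := by
    intro s hs
    have hr : ∀ β, |β| = α → ‖rayInt (fun z : ℂ => (z + 2)⁻¹) (-1) β s‖ ≤
        Real.exp s / Real.cos α := by
      intro β hβ
      refine (norm_integral_le_of_norm_le (integrableOn_exp_neg_mul hcos (Real.exp s))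
        ((ae_restrict_mem measurableSet_Ioi).mono fun r hr => ?_)).trans
        (le_of_eq (integral_exp_neg_mul hcos _))
      have hr0 : (0 : ℝ) < r := hr
      refine (norm_rayIntegrand_le (C := 1) (b := 0) ?_).trans ?_
      · simpa using norm_inv_rayPt_add_two_le h2 hβ hr0.le
      · rw [cos_eq_of_abs_eq hβ, mul_one, sub_zero, mul_neg_one, neg_neg]
        gcongr
        nlinarith
    rw [hh, contourInt, norm_smul]
    calc _ ≤ ‖(2 * (Real.pi : ℂ) * Complex.I)⁻¹‖ * (2 * (Real.exp s / Real.cos α)) := by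
          gcongr
          refine (norm_sub_le _ _).trans ?_
          linarith [hr _ hα', hr _ hα]
      _ = _ := by simp only [K]; ring
  have hz : Tendsto (fun s : ℝ => Complex.exp (-(2 * s)) * h s) atTop (𝓝 0) := by
    have hz' : Tendsto (fun s : ℝ => K * Real.exp (-s)) atTop (𝓝 0) := by
      simpa using Real.tendsto_exp_neg_atTop_nhds_zero.const_mul K
    refine squeeze_zero_norm' ?_ hz'
    filter_upwards [eventually_ge_atTop 1] with s hs
    rw [norm_mul, Complex.norm_exp]
    calc _ ≤ Real.exp (-(2 * s)) * (K * Real.exp s) := by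
          gcongr
          · simp
          · exact hbd s hs
      _ = K * (Real.exp (-(2 * s)) * Real.exp s) := by ring
      _ = _ := by rw [← Real.exp_add]; ring_nf
  have hlim : Tendsto (fun s : ℝ => Complex.exp (-(2 * s)) * h s) atTop
      (𝓝 (Complex.exp (-(2 * t)) * h t)) :=
    tendsto_const_nhds.congr' (by
      filter_upwards [eventually_gt_atTop 0] with s hs
      exact (heq s hs).symm)
  exact (mul_eq_zero.1 (tendsto_nhds_unique hlim hz)).resolve_left (Complex.exp_ne_zero _)

/-- `2 / (ζ (ζ + 2))` has the primitive `log (ζ / (ζ + 2))`; on the upper ray it runs from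
`log (-1) = πi` to `0`. -/
lemma integral_upper_ray (h0 : 0 < α) (h2 : α < Real.pi / 2)
    (hint : IntegrableOn (fun r : ℝ => Complex.exp (α * Complex.I) *
      ((rayPt (-1) α r)⁻¹ - (rayPt (-1) α r + 2)⁻¹)) (Ioi 0)) :
    ∫ r in Ioi (0 : ℝ), Complex.exp (α * Complex.I) *
      ((rayPt (-1) α r)⁻¹ - (rayPt (-1) α r + 2)⁻¹) = -(Real.pi * Complex.I) := by
  have hα : |α| = α := abs_of_pos h0
  have hsin := Real.sin_pos_of_pos_of_lt_pi h0 (by linarith [Real.pi_pos])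
  have hcos := cos_pos_of_abs_eq h2 hα
  have hne : ∀ r : ℝ, 0 ≤ r → rayPt (-1) α r + 2 ≠ 0 := fun r hr =>
    rayPt_add_two_ne_zero h2 hα hr
  have hne' : ∀ r : ℝ, 0 ≤ r → rayPt (-1) α r ≠ 0 := fun r hr =>
    ne_zero_of_mem_sectorExt (rayPt_mem_sectorExt (half_pos h0) (half_lt_self h0) h2 hα
      (by norm_num) hr)
  let w : ℝ → ℂ := fun r => 1 - 2 * (rayPt (-1) α r + 2)⁻¹
  have hw : ∀ r : ℝ, 0 ≤ r → w r = rayPt (-1) α r * (rayPt (-1) α r + 2)⁻¹ := by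
    intro r hr
    have := hne r hr
    simp only [w]
    field_simp
    ring
  have him : ∀ r : ℝ, (w r).im = 2 * (r * Real.sin α) / Complex.normSq (rayPt (-1) α r + 2) := by
    intro r
    simp only [w, Complex.sub_im, Complex.one_im, Complex.mul_im, Complex.inv_im, Complex.re_ofNat,
      Complex.im_ofNat, Complex.add_im, rayPt_im]
    ring
  have hderiv : ∀ r : ℝ, 0 ≤ r → HasDerivAt w
      (2 * Complex.exp (α * Complex.I) * ((rayPt (-1) α r + 2) ^ 2)⁻¹) r := by
    intro r hr
    have := (((hasDerivAt_rayPt (-1) α r).add_const (2 : ℂ)).inv (hne r hr)).const_mul (2 : ℂ)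
    refine (this.const_sub 1).congr_deriv ?_
    ring
  have hw0 : w 0 = -1 := by
    simp only [w, rayPt]
    push_cast
    norm_num
  have key := integral_Ioi_of_hasDerivAt_of_tendsto (a := (0 : ℝ)) (m := 0)
    (f := fun r => Complex.log (w r)) (f' := fun r : ℝ => Complex.exp (α * Complex.I) *
      ((rayPt (-1) α r)⁻¹ - (rayPt (-1) α r + 2)⁻¹)) ?_ ?_ hint ?_
  · rw [key, hw0, Complex.log_neg_one, zero_sub]
  · have h3 : ContinuousWithinAt Complex.log {z : ℂ | 0 ≤ z.im} (w 0) := by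
      refine Complex.continuousWithinAt_log_of_re_neg_of_im_zero ?_ ?_ <;> simp [hw0]
    refine ContinuousWithinAt.comp (t := {z : ℂ | 0 ≤ z.im}) h3
      (hderiv 0 le_rfl).continuousAt.continuousWithinAt fun r hr => ?_
    have hr0 : (0 : ℝ) ≤ r := hr
    have := Complex.normSq_nonneg (rayPt (-1) α r + 2)
    rw [mem_ofPred_eq, him]
    positivity
  · intro r hr
    have hr0 : (0 : ℝ) < r := hr
    have hsl : w r ∈ Complex.slitPlane := by
      right
      have := Complex.normSq_pos.2 (hne r hr0.le)
      rw [him]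
      positivity
    refine ((hderiv r hr0.le).clog_real hsl).congr_deriv ?_
    rw [hw r hr0.le]
    have e1 := hne r hr0.le
    have e2 := hne' r hr0.le
    field_simp
    ring
  · have h3 : Tendsto w atTop (𝓝 1) := by
      have h4 : Tendsto (fun r : ℝ => ‖rayPt (-1) α r + 2‖) atTop atTop := by
        refine tendsto_atTop_mono (fun r => le_norm_rayPt_add_two hα r) ?_
        exact tendsto_atTop_add_const_left _ _ (tendsto_id.atTop_mul_const hcos)
      have h5 : Tendsto (fun r : ℝ => (rayPt (-1) α r + 2)⁻¹) atTop (𝓝 0) := by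
        rw [tendsto_zero_iff_norm_tendsto_zero]
        simpa using! h4.inv_tendsto_atTop
      simpa [w] using (h5.const_mul 2).const_sub 1
    have := (continuousAt_clog Complex.one_mem_slitPlane).tendsto.comp h3
    simpa using! this

lemma exists_norm_inv_sub_inv_le (h0 : 0 < α) (h2 : α < Real.pi / 2) :
    ∃ K : ℝ, 0 < K ∧ ∀ β r : ℝ, |β| = α → 0 ≤ r →
      ‖(rayPt (-1) β r)⁻¹ - (rayPt (-1) β r + 2)⁻¹‖ ≤ K * (1 + r ^ 2)⁻¹ := by
  have hsin := Real.sin_pos_of_pos_of_lt_pi h0 (by linarith [Real.pi_pos])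
  have hcos := cos_pos_of_abs_eq h2 (abs_of_pos h0)
  have hcos1 := Real.cos_le_one α
  have hsin1 := Real.sin_le_one α
  refine ⟨8 / (Real.sin α * Real.cos α), by positivity, fun β r hβ hr => ?_⟩
  have hne := rayPt_add_two_ne_zero h2 hβ hr
  have hne' := ne_zero_of_mem_sectorExt (rayPt_mem_sectorExt (half_pos h0) (half_lt_self h0) h2 hβ
    (a := -1) (by norm_num) hr)
  have e : (rayPt (-1) β r)⁻¹ - (rayPt (-1) β r + 2)⁻¹ =
      2 * ((rayPt (-1) β r) * (rayPt (-1) β r + 2))⁻¹ := by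
    field_simp
    ring
  have i1 : Real.cos α * (1 + r) ≤ ‖rayPt (-1) β r + 2‖ := by
    refine le_trans ?_ (le_norm_rayPt_add_two hβ r)
    nlinarith
  have i2 : Real.sin α / 4 * (1 + r) ≤ ‖rayPt (-1) β r‖ := by
    rcases le_total r 3 with h | h
    · refine le_trans ?_ (norm_rayPt_ge h2 hβ (by norm_num))
      nlinarith
    · have : r - 1 ≤ ‖rayPt (-1) β r‖ := by
        have := norm_sub_norm_le (r * Complex.exp (β * Complex.I)) (-(((-1 : ℝ) : ℂ)))
        rw [norm_mul, Complex.norm_exp_ofReal_mul_I, Complex.norm_real,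
          Real.norm_of_nonneg hr] at this
        refine le_trans (le_trans (by simp) this) (le_of_eq ?_)
        rw [rayPt]
        congr 1
        ring
      nlinarith
  rw [e, norm_mul, norm_inv, norm_mul, Complex.norm_ofNat]
  have i3 : Real.sin α * Real.cos α / 4 * (1 + r ^ 2) ≤
      ‖rayPt (-1) β r‖ * ‖rayPt (-1) β r + 2‖ := by
    refine le_trans ?_ (mul_le_mul i2 i1 (by positivity) (norm_nonneg _))
    have : 0 < Real.sin α * Real.cos α := by positivity
    nlinarith
  calc 2 * (‖rayPt (-1) β r‖ * ‖rayPt (-1) β r + 2‖)⁻¹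
      ≤ 2 * (Real.sin α * Real.cos α / 4 * (1 + r ^ 2))⁻¹ := by gcongr
    _ = _ := by field_simp; norm_num

/-- Cauchy's formula `(2πi)⁻¹ ∫ e^{-tζ} ζ⁻¹ dζ = 1`: the integral does not depend on `t`, and as
`t → 0` it tends to the integral of `ζ⁻¹ - (ζ + 2)⁻¹`. -/
lemma contourInt_inv (h0 : 0 < α) (h2 : α < Real.pi / 2) {t : ℝ} (ht : 0 < t) :
    contourInt (fun z : ℂ => z⁻¹) α (-1) t = 1 := by
  have hα : |α| = α := abs_of_pos h0
  have hα' : |-α| = α := by rw [abs_neg, hα]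
  have hRs : IsSectorBdd (α / 2) (-1) (fun z : ℂ => z⁻¹) := by
    simpa using (IsSectorBdd.const (α / 2) (1 : ℂ)).inv_smul
  have hR : ∀ β, |β| = α → IsRayBdd (-1) β (fun z : ℂ => z⁻¹) := fun β hβ =>
    hRs.isRayBdd (half_pos h0) (half_lt_self h0) h2 (by norm_num) hβ
  have hR2 : ∀ β, |β| = α → IsRayBdd (-1) β (fun z : ℂ => -(z + 2)⁻¹) := fun β hβ => by
    have := isRayBdd_inv_add_two h2 hβ
    exact ⟨this.1.neg, by simpa using this.2⟩
  set h : ℝ → ℂ := contourInt (fun z : ℂ => z⁻¹) α (-1) with hh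
  have hcst : ∀ s : ℝ, 0 < s → HasDerivAt h 0 s := by
    intro s hs
    refine (hasDerivAt_contourInt hR (by norm_num) h0 h2 hs).congr_deriv ?_
    rw [contourInt_congr h0 (Q := fun _ => (1 : ℂ)) (fun β hβ r hr => ?_), contourInt_const h0 h2 hs,
      neg_zero]
    exact mul_inv_cancel₀ (ne_zero_of_mem_sectorExt (rayPt_mem_sectorExt (half_pos h0)
      (half_lt_self h0) h2 hβ (by norm_num) hr))
  have heq : ∀ s : ℝ, 0 < s → h s = h t := fun s hs =>
    (convex_Ioi (0 : ℝ)).is_const_of_fderivWithin_eq_zero (𝕜 := ℝ)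
      (fun x hx => (hcst x hx).differentiableAt.differentiableWithinAt)
      (fun x hx => by
        rw [fderivWithin_of_isOpen isOpen_Ioi hx]
        ext
        simp [(hcst x hx).deriv]) hs ht
  let Q : ℂ → ℂ := fun z => z⁻¹ - (z + 2)⁻¹
  have hQ : ∀ s : ℝ, 0 < s → contourInt Q α (-1) s = h t := by
    intro s hs
    have e := contourInt_add hR hR2 h0 h2 hs
    have e' : contourInt (fun z : ℂ => -(z + 2)⁻¹) α (-1) s = 0 := by
      have := contourInt_clm_comp (-(ContinuousLinearMap.id ℂ ℂ))
        (fun β hβ => isRayBdd_inv_add_two h2 hβ) h0 h2 hs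
      rw [contourInt_inv_add_two h0 h2 hs, map_zero] at this
      simpa using this
    rw [e', add_zero] at e
    rw [← heq s hs, hh, ← e]
    simp only [Q, sub_eq_add_neg]
  obtain ⟨K, hK, hKb⟩ := exists_norm_inv_sub_inv_le h0 h2
  have hKi : IntegrableOn (fun r : ℝ => Real.exp 1 * (K * (1 + r ^ 2)⁻¹)) (Ioi 0) :=
    ((integrable_inv_one_add_sq.const_mul K).const_mul (Real.exp 1)).integrableOn
  have hQR : ∀ β, |β| = α → IsRayBdd (-1) β Q := fun β hβ => by
    refine ⟨(hR β hβ).1.sub (isRayBdd_inv_add_two h2 hβ).1, fun b hb => ⟨K, hK, fun r hr => ?_⟩⟩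
    refine (hKb β r hβ hr).trans ?_
    gcongr
    refine (inv_le_one_of_one_le₀ ?_).trans (Real.one_le_exp (by positivity))
    nlinarith
  have hray : ∀ β, |β| = α → Tendsto (rayInt Q (-1) β) (𝓝[>] 0)
      (𝓝 (∫ r in Ioi (0 : ℝ), Complex.exp (β * Complex.I) * Q (rayPt (-1) β r))) := by
    intro β hβ
    have hc := cos_pos_of_abs_eq h2 hβ
    refine tendsto_integral_filter_of_dominated_convergence _ ?_ ?_ hKi ?_
    · exact Eventually.of_forall fun s => ((continuousOn_rayIntegrand (hQR β hβ) s).mono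
        Ioi_subset_Ici_self).aestronglyMeasurable measurableSet_Ioi
    · filter_upwards [Ioo_mem_nhdsGT one_pos] with s hs
      refine (ae_restrict_mem measurableSet_Ioi).mono fun r hr => ?_
      have hr0 : (0 : ℝ) < r := hr
      have hs0 := hs.1
      rw [rayIntegrand, norm_smul, norm_exp_rayPt, ← Real.exp_add]
      refine mul_le_mul (Real.exp_le_exp.2 ?_) (hKb β r hβ hr0.le) (norm_nonneg _)
        (Real.exp_pos _).le
      have : 0 < s * Real.cos β * r := by positivity
      linarith [hs.2]
    · refine Eventually.of_forall fun r => ?_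
      have : Continuous (fun s : ℝ => rayIntegrand Q (-1) β s r) := by
        unfold rayIntegrand
        fun_prop
      refine (this.tendsto' 0 _ ?_).mono_left nhdsWithin_le_nhds
      simp [rayIntegrand]
  have hint : ∀ β, |β| = α → IntegrableOn (fun r : ℝ => Complex.exp (β * Complex.I) *
      Q (rayPt (-1) β r)) (Ioi 0) := by
    intro β hβ
    refine Integrable.mono' hKi (ContinuousOn.aestronglyMeasurable
      ((continuousOn_const.mul (hQR β hβ).1).mono Ioi_subset_Ici_self) measurableSet_Ioi)
      ((ae_restrict_mem measurableSet_Ioi).mono fun r hr => ?_)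
    have hr0 : (0 : ℝ) < r := hr
    rw [norm_mul, Complex.norm_exp_ofReal_mul_I]
    refine mul_le_mul (Real.one_le_exp zero_le_one) (hKb β r hβ hr0.le) (norm_nonneg _)
        (Real.exp_pos _).le
  have hup := integral_upper_ray h0 h2 (hint α hα)
  have hlow : ∫ r in Ioi (0 : ℝ), Complex.exp ((-α : ℝ) * Complex.I) * Q (rayPt (-1) (-α) r) =
      Real.pi * Complex.I := by
    have hconj : ∀ r : ℝ, Complex.exp ((-α : ℝ) * Complex.I) * Q (rayPt (-1) (-α) r) =
        (starRingEnd ℂ) (Complex.exp (α * Complex.I) * Q (rayPt (-1) α r)) := by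
      intro r
      have e1 : (starRingEnd ℂ) (Complex.exp (α * Complex.I)) =
          Complex.exp ((-α : ℝ) * Complex.I) := by
        rw [← Complex.exp_conj]
        simp
      have e2 : (starRingEnd ℂ) (rayPt (-1) α r) = rayPt (-1) (-α) r := by
        simp only [rayPt, map_add, map_mul, Complex.conj_ofReal, e1]
      simp only [Q, map_mul, map_sub, map_inv₀, map_add, e1, e2, Complex.conj_ofNat]
    simp_rw [hconj]
    rw [integral_conj, hup]
    simp
  have hlim := ((hray (-α) hα').sub (hray α hα)).const_smul (2 * (Real.pi : ℂ) * Complex.I)⁻¹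
  rw [hlow, show (∫ r in Ioi (0 : ℝ), Complex.exp (α * Complex.I) * Q (rayPt (-1) α r)) =
    -(Real.pi * Complex.I) from hup] at hlim
  have hval : (2 * (Real.pi : ℂ) * Complex.I)⁻¹ • ((Real.pi : ℂ) * Complex.I -
      -(Real.pi * Complex.I)) = 1 := by
    rw [smul_eq_mul, sub_neg_eq_add, ← two_mul, ← mul_assoc (2 : ℂ),
      inv_mul_cancel₀ Complex.two_pi_I_ne_zero]
  rw [hval] at hlim
  have hlim' : Tendsto (fun s => contourInt Q α (-1) s) (𝓝[>] 0) (𝓝 (h t)) :=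
    tendsto_const_nhds.congr' (by
      filter_upwards [self_mem_nhdsWithin] with s hs
      exact (hQ s hs).symm)
  exact tendsto_nhds_unique hlim' hlim

end Scalar

/-! ### The resolvent of a sectorial operator -/

section Resolvent

variable {X : Type*} [NormedAddCommGroup X] [NormedSpace ℂ X]
  {T : X →ₗ.[ℂ] X} {ω θ α : ℝ}

lemma isResolventAt_resolventOp {z : ℂ} (hz : z ∈ resolventSet T) :
    IsResolventAt T z (resolventOp T z) := by
  have h : ∃ R : X →L[ℂ] X, IsResolventAt T z R := hz
  rw [resolventOp, dif_pos h]
  exact h.choose_spec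

lemma IsSectorial.mem_resolventSet (hT : IsSectorial T ω) (h1 : ω < θ) (h2 : θ < Real.pi / 2)
    {z : ℂ} (hz : z ∈ sectorExt θ) : z ∈ resolventSet T := by
  by_contra h
  have h3 : |z.arg| ≤ ω := hT.spectrum_subset h
  linarith [le_abs_arg_of_mem_sectorExt h2 hz]

lemma IsResolventAt.sub_eq {z w : ℂ} {P Q : X →L[ℂ] X} (hP : IsResolventAt T z P)
    (hQ : IsResolventAt T w Q) : P - Q = (w - z) • (P * Q) := by
  ext x
  obtain ⟨hd, hx⟩ := hQ.1 x
  have h := hP.2 ⟨Q x, hd⟩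
  have e : z • Q x - T ⟨Q x, hd⟩ = (z - w) • Q x + x := by
    have hTQ : T ⟨Q x, hd⟩ = w • Q x - x := by
      rw [sub_eq_iff_eq_add.1 hx]
      abel
    rw [hTQ, sub_smul]
    abel
  rw [e, map_add, map_smul] at h
  simp only [sub_apply, smul_apply,
    mul_apply_eq_comp]
  rw [← sub_eq_zero, ← sub_eq_zero.2 h, sub_smul, sub_smul]
  abel

lemma IsResolventAt.commute {z w : ℂ} {P Q : X →L[ℂ] X} (hP : IsResolventAt T z P)
    (hQ : IsResolventAt T w Q) : P * Q = Q * P := by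
  rcases eq_or_ne z w with rfl | h
  · have h1 := hP.sub_eq hQ
    rw [sub_self, zero_smul, sub_eq_zero] at h1
    rw [h1]
  · have h1 := hP.sub_eq hQ
    have h2 := hQ.sub_eq hP
    have h3 : (w - z) • (P * Q - Q * P) = 0 := by
      rw [smul_sub, ← h1, ← neg_sub z w, neg_smul, ← h2]
      abel
    exact sub_eq_zero.1 ((smul_eq_zero.1 h3).resolve_left (sub_ne_zero.2 h.symm))

/-- The graph of `T` in terms of the resolvent at `-1`. -/
lemma IsResolventAt.mem_domain_of_eq {R : X →L[ℂ] X} (hR : IsResolventAt T (-1) R) {u v : X}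
    (h : R (-u - v) = u) : u ∈ T.domain ∧ app T u = v := by
  obtain ⟨hd, hx⟩ := hR.1 (-u - v)
  have hu : u ∈ T.domain := h ▸ hd
  refine ⟨hu, ?_⟩
  have e : (⟨R (-u - v), hd⟩ : T.domain) = ⟨u, hu⟩ := Subtype.ext h
  rw [e, h] at hx
  rw [app, dif_pos hu]
  have h3 : -u - T ⟨u, hu⟩ = -u - v := by simpa using hx
  exact sub_right_injective h3

lemma IsResolventAt.eq_of_mem_domain {R : X →L[ℂ] X} (hR : IsResolventAt T (-1) R) {u : X}
    (hu : u ∈ T.domain) : R (-u - app T u) = u := by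
  have := hR.2 ⟨u, hu⟩
  rw [app, dif_pos hu]
  simpa using this

lemma IsSectorial.isSectorBdd_resolventOp (hT : IsSectorial T ω) (h1 : ω < θ)
    (h2 : θ < Real.pi / 2) : IsSectorBdd θ (-1) (resolventOp T) := by
  obtain ⟨c, hc, hbd⟩ := hT.resolvent_bound θ h1 (by linarith [Real.pi_pos])
  have hn : ∀ z ∈ sectorExt θ, ‖resolventOp T z‖ ≤ c / ‖z‖ := fun z hz =>
    hbd z (ne_zero_of_mem_sectorExt hz) (le_abs_arg_of_mem_sectorExt h2 hz)
  have hres : ∀ z ∈ sectorExt θ, IsResolventAt T z (resolventOp T z) := fun z hz =>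
    isResolventAt_resolventOp (hT.mem_resolventSet h1 h2 hz)
  have hsub : ∀ z ∈ sectorExt θ, ∀ w ∈ sectorExt θ, resolventOp T w - resolventOp T z =
      (z - w) • (resolventOp T w * resolventOp T z) := fun z hz w hw =>
    (hres w hw).sub_eq (hres z hz)
  have hcont : ∀ z ∈ sectorExt θ, Tendsto (resolventOp T) (𝓝 z) (𝓝 (resolventOp T z)) := by
    intro z hz
    have hz0 := norm_pos_iff.2 (ne_zero_of_mem_sectorExt hz)
    rw [tendsto_iff_norm_sub_tendsto_zero]
    have hlim : Tendsto (fun w => ‖z - w‖ * (c / ‖w‖ * (c / ‖z‖))) (𝓝 z) (𝓝 0) := by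
      have : ContinuousAt (fun w : ℂ => ‖z - w‖ * (c / ‖w‖ * (c / ‖z‖))) z := by
        refine ContinuousAt.mul (by fun_prop) (ContinuousAt.mul ?_ continuousAt_const)
        exact continuousAt_const.div continuous_norm.continuousAt hz0.ne'
      simpa [ContinuousAt] using this
    refine squeeze_zero' (Eventually.of_forall fun _ => norm_nonneg _) ?_ hlim
    filter_upwards [(isOpen_sectorExt θ).mem_nhds hz] with w hw
    rw [hsub z hz w hw, norm_smul]
    gcongr
    refine (norm_mul_le _ _).trans ?_
    have := hn w hw
    have := hn z hz
    gcongr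
  have hder : ∀ z ∈ sectorExt θ,
      HasDerivAt (resolventOp T) (-(resolventOp T z * resolventOp T z)) z := by
    intro z hz
    rw [hasDerivAt_iff_tendsto_slope]
    have h3 : Tendsto (fun w => -(resolventOp T w * resolventOp T z)) (𝓝[≠] z)
        (𝓝 (-(resolventOp T z * resolventOp T z))) :=
      (((hcont z hz).mul_const _).neg).mono_left nhdsWithin_le_nhds
    refine h3.congr' ?_
    filter_upwards [self_mem_nhdsWithin,
      nhdsWithin_le_nhds ((isOpen_sectorExt θ).mem_nhds hz)] with w hw hw'
    have hne : w - z ≠ 0 := sub_ne_zero.2 hw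
    rw [slope_def_module, hsub z hz w hw', smul_smul, ← neg_sub w z, mul_neg,
      inv_mul_cancel₀ hne, neg_one_smul]
  refine ⟨c + c ^ 2, by positivity, fun z hz => ⟨(hder z hz).differentiableAt, ?_, ?_⟩⟩
  · rw [zpow_neg_one, ← div_eq_mul_inv]
    refine (hn z hz).trans ?_
    gcongr
    nlinarith
  · rw [(hder z hz).deriv, norm_neg]
    refine (norm_mul_le _ _).trans ?_
    have h3 := hn z hz
    have e : ‖z‖ ^ (-1 - 1 : ℤ) = (‖z‖ ^ 2)⁻¹ := by
      norm_num [zpow_neg]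
    rw [e]
    calc _ ≤ c / ‖z‖ * (c / ‖z‖) := by gcongr
      _ = c ^ 2 * (‖z‖ ^ 2)⁻¹ := by ring
      _ ≤ _ := by gcongr; linarith

end Resolvent

/-! ### The semigroup generated by a sectorial operator -/

section Semigroup

variable {X : Type*} [NormedAddCommGroup X] [NormedSpace ℂ X]

/-- A bounded `C₀`-semigroup `S` that is differentiable in operator norm on `(0, ∞)`, with
`S'(t) = -A(t)`, where `A` is continuous and `‖A(t)‖ = O(1/t)`: a bounded analytic semigroup seen
from the real half-line. If `-T` is the generator, then `A(t) = T S(t)`. -/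
structure IsAnalyticSemigroup (S A : ℝ → X →L[ℂ] X) (M : ℝ) : Prop where
  norm_le : ∀ t : ℝ, 0 < t → ‖S t‖ ≤ M
  norm_deriv_le : ∀ t : ℝ, 0 < t → ‖A t‖ ≤ M / t
  hasDerivAt : ∀ t : ℝ, 0 < t → HasDerivAt S (-A t) t
  continuousOn_deriv : ContinuousOn A (Ioi 0)
  add : ∀ s t : ℝ, 0 < s → 0 < t → S (s + t) = S s * S t
  tendsto_zero : ∀ x : X, Tendsto (fun t => S t x) (𝓝[>] 0) (𝓝 x)

lemma isClosed_setOf_tendsto {Y : Type*} [NormedAddCommGroup Y] [NormedSpace ℂ Y]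
    {S : ℝ → X →L[ℂ] Y} {l : Filter ℝ} {M : ℝ} (L : X →L[ℂ] Y)
    (hS : ∀ᶠ t in l, ‖S t‖ ≤ M) : IsClosed {x : X | Tendsto (fun t => S t x) l (𝓝 (L x))} := by
  refine isClosed_of_closure_subset fun x hx => ?_
  rw [mem_ofPred_eq, Metric.tendsto_nhds]
  intro ε hε
  have hM : 0 < |M| + ‖L‖ + 1 := by positivity
  obtain ⟨u, hu, hxu⟩ := Metric.mem_closure_iff.1 hx (ε / (2 * (|M| + ‖L‖ + 1))) (by positivity)
  have hu' : Tendsto (fun t => S t u) l (𝓝 (L u)) := hu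
  filter_upwards [hS, (Metric.tendsto_nhds.1 hu') _ (half_pos hε)] with t ht ht'
  rw [dist_eq_norm] at ht' hxu ⊢
  rw [lt_div_iff₀ (by positivity)] at hxu
  have e : S t x - L x = S t (x - u) + (S t u - L u) - L (x - u) := by
    rw [map_sub, map_sub]
    abel
  have j1 : ‖S t (x - u)‖ ≤ |M| * ‖x - u‖ :=
    ((S t).le_opNorm _).trans (by gcongr; exact ht.trans (le_abs_self M))
  have j2 := L.le_opNorm (x - u)
  have j4 := norm_sub_le (S t (x - u) + (S t u - L u)) (L (x - u))
  have j5 := norm_add_le (S t (x - u)) (S t u - L u)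
  rw [e]
  nlinarith [norm_nonneg (x - u)]

/-- The semigroup law for a solution `S` of `S' = -A` that commutes with its derivative and starts at
the identity: `r ↦ S (s + t - r) S r` is constant. -/
lemma semigroup_law {S A : ℝ → X →L[ℂ] X} (hd : ∀ t : ℝ, 0 < t → HasDerivAt S (-A t) t)
    (hAS : ∀ p q : ℝ, 0 < p → 0 < q → A p * S q = S p * A q)
    (hlim0 : ∀ x : X, Tendsto (fun t => S t x) (𝓝[>] 0) (𝓝 x)) {s t : ℝ} (hs : 0 < s)
    (ht : 0 < t) : S (s + t) = S s * S t := by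
  let φ : ℝ → X →L[ℂ] X := fun r => S (s + t - r) * S r
  have hφ : ∀ r ∈ Ioo 0 (s + t), HasDerivAt φ 0 r := by
    intro r hr
    have d1 : HasDerivAt (fun r => S (s + t - r)) ((-1 : ℝ) • -A (s + t - r)) r :=
      (hd (s + t - r) (by linarith [hr.2])).scomp r ((hasDerivAt_id r).const_sub (s + t))
    refine (d1.mul (hd r hr.1)).congr_deriv ?_
    rw [neg_one_smul, neg_neg, mul_neg, hAS _ _ (by linarith [hr.2]) hr.1, add_neg_cancel]
  have hcst : ∀ r ∈ Ioo 0 (s + t), φ r = φ t := fun r hr =>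
    (convex_Ioo (0 : ℝ) (s + t)).is_const_of_fderivWithin_eq_zero (𝕜 := ℝ)
      (fun x hx => (hφ x hx).differentiableAt.differentiableWithinAt)
      (fun x hx => by
        rw [fderivWithin_of_isOpen isOpen_Ioo hx]
        ext
        simp [(hφ x hx).deriv]) hr ⟨ht, by linarith⟩
  ext x
  have l1 : Tendsto (fun r => φ r x) (𝓝[>] 0) (𝓝 (S (s + t) x)) := by
    have hc : ContinuousAt S (s + t) := (hd _ (by linarith)).continuousAt
    have l2 : Tendsto (fun r : ℝ => S (s + t - r)) (𝓝[>] 0) (𝓝 (S (s + t))) := by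
      refine hc.tendsto.comp (Tendsto.mono_left ?_ nhdsWithin_le_nhds)
      exact (continuous_const.sub continuous_id).tendsto' 0 _ (by simp)
    exact (isBoundedBilinearMap_apply.continuous.tendsto (S (s + t), x)).comp
      (l2.prodMk_nhds (hlim0 x))
  have l3 : Tendsto (fun r => φ r x) (𝓝[>] 0) (𝓝 (φ t x)) := by
    refine tendsto_const_nhds.congr' ?_
    filter_upwards [Ioo_mem_nhdsGT (show 0 < s + t by linarith)] with r hr
    rw [hcst r hr]
  have := tendsto_nhds_unique l1 l3
  simpa [φ] using this

/-- `T S(p) S(q) = S(p) T S(q)`, written with `A = T S` and `R = (-1 - T)⁻¹` only. -/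
lemma mul_eq_mul_of_resolvent {B : Type*} [Ring B] {R Sp Ap Sq Aq : B}
    (hp : R * (Sp + Ap) = -Sp) (hq : R * (Sq + Aq) = -Sq) (hS : R * Sp = Sp * R)
    (hA : R * Ap = Ap * R) : Ap * Sq = Sp * Aq := by
  have i3 : Sq = -(R * (Sq + Aq)) := by rw [hq, neg_neg]
  have i4 : Ap * R = -Sp - Sp * R := by
    rw [← hA, ← hS, ← hp]
    noncomm_ring
  calc Ap * Sq = -((Ap * R) * (Sq + Aq)) := by rw [mul_assoc, ← mul_neg, ← i3]
    _ = Sp * Sq + Sp * Aq + Sp * (R * (Sq + Aq)) := by rw [i4]; noncomm_ring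
    _ = Sp * Aq := by rw [hq]; noncomm_ring

variable {T : X →ₗ.[ℂ] X} {ω θ α : ℝ}

lemma expNeg_eq (T : X →ₗ.[ℂ] X) (α t : ℝ) :
    expNeg T α t = contourInt (resolventOp T) α (-1) t := by
  simp only [expNeg, contourInt, rayIntegral, rayInt, rayIntegrand, contourPt_eq]

lemma commute_contourInt [CompleteSpace X] (h0 : 0 < θ) (h1 : θ < α) (h2 : α < Real.pi / 2) {Q : ℂ → X →L[ℂ] X}
    (hQ : ∀ β, |β| = α → IsRayBdd (-1) β Q) {R : X →L[ℂ] X}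
    (hR : ∀ z ∈ sectorExt θ, R * Q z = Q z * R) {t : ℝ} (ht : 0 < t) :
    R * contourInt Q α (-1) t = contourInt Q α (-1) t * R := by
  have hα0 := h0.trans h1
  have e1 := contourInt_clm_comp (ContinuousLinearMap.mul ℂ (X →L[ℂ] X) R) hQ hα0 h2 ht
  have e2 := contourInt_clm_comp ((ContinuousLinearMap.mul ℂ (X →L[ℂ] X)).flip R) hQ hα0 h2 ht
  simp only [ContinuousLinearMap.mul_apply', ContinuousLinearMap.flip_apply] at e1 e2
  rw [← e1, ← e2]
  refine contourInt_congr hα0 (fun β hβ r hr => ?_) t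
  exact hR _ (rayPt_mem_sectorExt h0 h1 h2 hβ (by norm_num) hr)

section

variable (h0 : 0 ≤ ω) (hT : IsSectorial T ω) (h1 : ω < α) (h2 : α < Real.pi / 2)
include h0 hT h1 h2

lemma IsSectorial.isResolventAt_neg_one : IsResolventAt T (-1) (resolventOp T (-1)) := by
  refine isResolventAt_resolventOp (hT.mem_resolventSet h1 h2 ?_)
  simpa using neg_mem_sectorExt (h0.trans_lt h1) h2 (a := -1) (by norm_num)

/-- `e^{-tT}` and `T e^{-tT}` (as the contour integral of `ζ (ζ - T)⁻¹`) in terms of the resolvent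
at `-1`. -/
lemma IsSectorial.resolventOp_mul_add [CompleteSpace X] {t : ℝ} (ht : 0 < t) :
    resolventOp T (-1) * (expNeg T α t +
      contourInt (fun z => z • resolventOp T z) α (-1) t) = -expNeg T α t := by
  have hθ1 : ω < (ω + α) / 2 := by linarith
  have hθ2 : (ω + α) / 2 < α := by linarith
  have hQ := hT.isSectorBdd_resolventOp hθ1 (hθ2.trans h2)
  have hR : ∀ β, |β| = α → IsRayBdd (-1) β (resolventOp T) := fun β hβ =>
    hQ.isRayBdd (by linarith) hθ2 h2 (by norm_num) hβ
  have hR' : ∀ β, |β| = α → IsRayBdd (-1) β (fun z => z • resolventOp T z) := fun β hβ =>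
    (hR β hβ).id_smul (by norm_num)
  have hα0 := h0.trans_lt h1
  have hm := hT.isResolventAt_neg_one h0 h1 h2
  set R := resolventOp T (-1) with hRdef
  have hRR : ∀ β, |β| = α → IsRayBdd (-1) β (fun z => R * (resolventOp T z + z • resolventOp T z)) :=
    fun β hβ => ((hR β hβ).add (hR' β hβ)).clm_comp (ContinuousLinearMap.mul ℂ (X →L[ℂ] X) R)
  have e1 := contourInt_add hR hR' hα0 h2 ht
  have hs : ∀ β, |β| = α → IsRayBdd (-1) β (fun z => resolventOp T z + z • resolventOp T z) :=
    fun β hβ => (hR β hβ).add (hR' β hβ)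
  have e2 := contourInt_clm_comp (ContinuousLinearMap.mul ℂ (X →L[ℂ] X) R) hs hα0 h2 ht
  have e3 := contourInt_add hR hRR hα0 h2 ht
  have e4 : contourInt (fun z => resolventOp T z + R * (resolventOp T z + z • resolventOp T z))
      α (-1) t = 0 := by
    rw [← contourInt_const hα0 h2 ht R]
    refine contourInt_congr hα0 (fun β hβ r hr => ?_) t
    have hz := hT.mem_resolventSet hθ1 (hθ2.trans h2) (rayPt_mem_sectorExt (a := -1) (by linarith)
      hθ2 h2 hβ (by norm_num) hr)
    have h3 := hm.sub_eq (isResolventAt_resolventOp hz)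
    generalize rayPt (-1) β r = z at h3 ⊢
    rw [sub_neg_eq_add, add_smul, one_smul] at h3
    rw [mul_add, mul_smul_comm, add_comm (R * _), ← h3]
    abel
  rw [expNeg_eq, ← e1]
  have e5 : contourInt (fun z => R * (resolventOp T z + z • resolventOp T z)) α (-1) t =
      R * contourInt (fun z => resolventOp T z + z • resolventOp T z) α (-1) t := by
    simpa using! e2
  rw [← e5, eq_neg_iff_add_eq_zero, add_comm, ← e3, e4]

/-- For `u ∈ D(T)` one has `e^{-tT} u - u = (2πi)⁻¹ ∫ e^{-tζ} ζ⁻¹ (ζ - T)⁻¹ T u dζ`. -/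
lemma IsSectorial.expNeg_sub_self [CompleteSpace X] {t : ℝ} (ht : 0 < t) {u : X} (hu : u ∈ T.domain) :
    expNeg T α t u - u =
      contourInt (fun z => z⁻¹ • resolventOp T z) α (-1) t (app T u) := by
  have hθ1 : ω < (ω + α) / 2 := by linarith
  have hθ2 : (ω + α) / 2 < α := by linarith
  have hQ := hT.isSectorBdd_resolventOp hθ1 (hθ2.trans h2)
  have hα0 := h0.trans_lt h1
  have hR : ∀ β, |β| = α → IsRayBdd (-1) β (resolventOp T) := fun β hβ =>
    hQ.isRayBdd (by linarith) hθ2 h2 (by norm_num) hβ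
  have hR' : ∀ β, |β| = α → IsRayBdd (-1) β (fun z => z⁻¹ • resolventOp T z) := fun β hβ =>
    hQ.inv_smul.isRayBdd (by linarith) hθ2 h2 (by norm_num) hβ
  have hI : IsSectorBdd (α / 2) (-1) (fun z : ℂ => z⁻¹) := by
    simpa using (IsSectorBdd.const (α / 2) (1 : ℂ)).inv_smul
  have hI' : ∀ β, |β| = α → IsRayBdd (-1) β (fun z : ℂ => z⁻¹) := fun β hβ =>
    hI.isRayBdd (half_pos hα0) (half_lt_self hα0) h2 (by norm_num) hβ
  let L1 := ContinuousLinearMap.apply ℂ X u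
  let L2 := ContinuousLinearMap.apply ℂ X (app T u)
  let L3 := ContinuousLinearMap.toSpanSingleton ℂ u
  have e1 := contourInt_clm_comp L1 hR hα0 h2 ht
  have e2 := contourInt_clm_comp L2 hR' hα0 h2 ht
  have e3 := contourInt_clm_comp L3 hI' hα0 h2 ht
  have e4 := contourInt_add (fun β hβ => (hI' β hβ).clm_comp L3)
    (fun β hβ => (hR' β hβ).clm_comp L2) hα0 h2 ht
  rw [contourInt_inv hα0 h2 ht] at e3
  rw [e3, e2] at e4
  have e5 : contourInt (fun z => L3 z⁻¹ + L2 (z⁻¹ • resolventOp T z)) α (-1) t =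
      contourInt (fun z => L1 (resolventOp T z)) α (-1) t := by
    refine contourInt_congr hα0 (fun β hβ r hr => ?_) t
    have hz' := rayPt_mem_sectorExt (a := -1) (θ := (ω + α) / 2) (by linarith)
      hθ2 h2 hβ (by norm_num) hr
    have hz := hT.mem_resolventSet hθ1 (hθ2.trans h2) hz'
    have h3 := (isResolventAt_resolventOp hz).2 ⟨u, hu⟩
    have hz0 := ne_zero_of_mem_sectorExt hz'
    generalize rayPt (-1) β r = z at h3 hz0 ⊢
    rw [map_sub, map_smul, sub_eq_iff_eq_add] at h3
    simp only [L1, L2, L3, ContinuousLinearMap.apply_apply, smul_apply,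
      ContinuousLinearMap.toSpanSingleton_apply, app, dif_pos hu]
    rw [← smul_add, ← h3, inv_smul_smul₀ hz0]
  rw [e5, e1] at e4
  rw [expNeg_eq]
  simp only [L1, L2, L3, ContinuousLinearMap.apply_apply,
    ContinuousLinearMap.toSpanSingleton_apply, one_smul] at e4
  rw [e4]
  abel

/-- A sectorial operator of angle less than `π / 2` generates a bounded analytic semigroup. -/
theorem IsSectorial.exists_isAnalyticSemigroup [CompleteSpace X] :
    ∃ (A : ℝ → X →L[ℂ] X) (M : ℝ), IsAnalyticSemigroup (expNeg T α) A M ∧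
      (∀ t : ℝ, 0 < t → resolventOp T (-1) * (expNeg T α t + A t) = -expNeg T α t) ∧
      (∀ t : ℝ, 0 < t → resolventOp T (-1) * expNeg T α t = expNeg T α t * resolventOp T (-1)) ∧
      ∀ x ∈ closure (Set.range fun u : T.domain => T u),
        Tendsto (fun t => expNeg T α t x) atTop (𝓝 0) := by
  have hθ1 : ω < (ω + α) / 2 := by linarith
  have hθ2 : (ω + α) / 2 < α := by linarith
  have hθ0 : 0 < (ω + α) / 2 := by linarith
  have hQ := hT.isSectorBdd_resolventOp hθ1 (hθ2.trans h2)
  have hα0 := h0.trans_lt h1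
  have hR : ∀ β, |β| = α → IsRayBdd (-1) β (resolventOp T) := fun β hβ =>
    hQ.isRayBdd hθ0 hθ2 h2 (by norm_num) hβ
  have hR' : ∀ β, |β| = α → IsRayBdd (-1) β (fun z => z • resolventOp T z) := fun β hβ =>
    (hR β hβ).id_smul (by norm_num)
  have hm := hT.isResolventAt_neg_one h0 h1 h2
  set R := resolventOp T (-1) with hRdef
  set S : ℝ → X →L[ℂ] X := expNeg T α with hS
  have hSe : S = contourInt (resolventOp T) α (-1) := funext fun t => expNeg_eq T α t
  let A : ℝ → X →L[ℂ] X := contourInt (fun z => z • resolventOp T z) α (-1)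
  obtain ⟨M₁, hM₁, hb₁⟩ := hQ.exists_norm_contourInt_le hθ0 hθ2 h2
  obtain ⟨M₂, hM₂, hb₂⟩ := hQ.id_smul.exists_norm_contourInt_le hθ0 hθ2 h2
  obtain ⟨M₃, hM₃, hb₃⟩ := hQ.inv_smul.exists_norm_contourInt_le hθ0 hθ2 h2
  have hRA : ∀ t : ℝ, 0 < t → R * (S t + A t) = -S t := fun t ht =>
    hT.resolventOp_mul_add h0 h1 h2 ht
  have hcomm : ∀ z ∈ sectorExt ((ω + α) / 2), R * resolventOp T z = resolventOp T z * R :=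
    fun z hz => hm.commute (isResolventAt_resolventOp (hT.mem_resolventSet hθ1 (hθ2.trans h2) hz))
  have hRS : ∀ t : ℝ, 0 < t → R * S t = S t * R := fun t ht => by
    rw [hSe]
    exact commute_contourInt hθ0 hθ2 h2 hR hcomm ht
  have hRA' : ∀ t : ℝ, 0 < t → R * A t = A t * R := fun t ht =>
    commute_contourInt hθ0 hθ2 h2 hR' (fun z hz => by
      rw [mul_smul_comm, smul_mul_assoc, hcomm z hz]) ht
  have hSn : ∀ t : ℝ, 0 < t → ‖S t‖ ≤ M₁ := fun t ht => by
    simpa [hSe] using hb₁ (-1) t (by norm_num) ht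
  have hAn : ∀ t : ℝ, 0 < t → ‖A t‖ ≤ M₂ / t := fun t ht => by
    simpa [zpow_neg_one, div_eq_mul_inv] using hb₂ (-1) t (by norm_num) ht
  have hd : ∀ t : ℝ, 0 < t → HasDerivAt S (-A t) t := fun t ht => by
    rw [hSe]
    exact hasDerivAt_contourInt hR (by norm_num) hα0 h2 ht
  have hAc : ContinuousOn A (Ioi 0) := fun t ht =>
    (hasDerivAt_contourInt hR' (by norm_num) hα0 h2
      (show (0 : ℝ) < t from ht)).continuousAt.continuousWithinAt
  have hAS : ∀ p q : ℝ, 0 < p → 0 < q → A p * S q = S p * A q := fun p q hp hq =>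
    mul_eq_mul_of_resolvent (hRA p hp) (hRA q hq) (hRS p hp) (hRA' p hp)
  have hlim0 : ∀ x : X, Tendsto (fun t => S t x) (𝓝[>] 0) (𝓝 x) := by
    have hcl := isClosed_setOf_tendsto (l := 𝓝[>] 0) (M := M₁) (ContinuousLinearMap.id ℂ X)
      (by filter_upwards [self_mem_nhdsWithin] with t ht using hSn t ht)
    suffices hsub : (T.domain : Set X) ⊆ {x : X | Tendsto (fun t => S t x) (𝓝[>] 0) (𝓝 x)} from
      fun x => hcl.closure_subset_iff.2 hsub (hT.dense_domain x)
    intro u hu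
    rw [mem_ofPred_eq]
    have hlin : Tendsto (fun t : ℝ => M₃ * t * ‖app T u‖) (𝓝[>] 0) (𝓝 0) := by
      have : Continuous (fun t : ℝ => M₃ * t * ‖app T u‖) := by fun_prop
      simpa using (this.tendsto 0).mono_left nhdsWithin_le_nhds
    rw [tendsto_iff_norm_sub_tendsto_zero]
    refine squeeze_zero' (Eventually.of_forall fun _ => norm_nonneg _) ?_ hlin
    filter_upwards [self_mem_nhdsWithin] with t ht
    have ht0 : (0 : ℝ) < t := ht
    rw [hS, hT.expNeg_sub_self h0 h1 h2 ht0 hu]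
    refine (ContinuousLinearMap.le_opNorm _ _).trans ?_
    have := hb₃ (-1) t (by norm_num) ht0
    norm_num at this
    gcongr
  refine ⟨A, max M₁ M₂, ⟨fun t ht => (hSn t ht).trans (le_max_left _ _), fun t ht =>
    (hAn t ht).trans (by gcongr; exact le_max_right _ _), hd, hAc,
    fun s t => semigroup_law hd hAS hlim0, hlim0⟩, hRA, hRS, ?_⟩
  intro x hx
  have hSv : ∀ (v : T.domain) (t : ℝ), 0 < t → S t (T v) = A t v := by
    intro v t ht
    have k1 := hm.2 v
    have k2 : A t * R = -S t - S t * R := by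
      rw [← hRA' t ht, ← hRS t ht, ← hRA t ht]
      noncomm_ring
    conv_rhs => rw [← k1]
    have k3 := congrArg (fun B : X →L[ℂ] X => B ((-1 : ℂ) • (v : X) - T v)) k2
    simp only [mul_apply_eq_comp, sub_apply, neg_apply] at k3
    rw [k3, k1]
    simp
  have hcl := isClosed_setOf_tendsto (l := atTop) (M := M₁) (0 : X →L[ℂ] X)
    (by filter_upwards [eventually_gt_atTop 0] with t ht using hSn t ht)
  refine hcl.closure_subset_iff.2 ?_ hx
  rintro _ ⟨v, rfl⟩
  have hlin : Tendsto (fun t : ℝ => M₂ / t * ‖(v : X)‖) atTop (𝓝 0) := by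
    simpa using (tendsto_const_nhds.div_atTop tendsto_id).mul_const ‖(v : X)‖
  refine squeeze_zero_norm' ?_ hlin
  filter_upwards [eventually_gt_atTop 0] with t ht
  rw [hSv v t ht]
  exact ((A t).le_opNorm _).trans (by gcongr; exact hAn t ht)

end

end Semigroup

/-! ### Integrals of powers and of exponentials -/

section Scalar

lemma setIntegral_Ioi_comp_add {E : Type*} [NormedAddCommGroup E] [NormedSpace ℝ E] (g : ℝ → E)
    (s a : ℝ) : ∫ r in Ioi a, g (s + r) = ∫ u in Ioi (s + a), g u := by
  have := (measurePreserving_add_left volume s).setIntegral_preimage_emb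
    (measurableEmbedding_addLeft s) g (Ioi (s + a))
  simpa using this

lemma integrableOn_Ioi_comp_add {E : Type*} [NormedAddCommGroup E] (g : ℝ → E)
    (s a : ℝ) : IntegrableOn (fun r => g (s + r)) (Ioi a) ↔ IntegrableOn g (Ioi (s + a)) := by
  have := (measurePreserving_add_left volume s).integrableOn_comp_preimage
    (measurableEmbedding_addLeft s) (f := g) (s := Ioi (s + a))
  simpa [Function.comp_def] using! this

lemma integrableOn_Ioc_rpow {a : ℝ} (ha : -1 < a) (N : ℝ) :
    IntegrableOn (fun r : ℝ => r ^ a) (Ioc 0 N) := by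
  rcases le_total 0 N with h | h
  · exact (intervalIntegrable_iff_integrableOn_Ioc_of_le h).1
      (intervalIntegral.intervalIntegrable_rpow' ha)
  · rw [Ioc_eq_empty (not_lt.2 h)]
    exact integrableOn_empty

lemma integral_Ioc_rpow {a N : ℝ} (ha : -1 < a) (hN : 0 ≤ N) :
    ∫ r in Ioc 0 N, r ^ a = N ^ (a + 1) / (a + 1) := by
  rw [← intervalIntegral.integral_of_le hN, integral_rpow (Or.inl ha),
    Real.zero_rpow (by linarith), sub_zero]

/-- Integrability on `(0, ∞)` from power bounds at `0` and at `∞`. -/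
lemma integrableOn_Ioi_of_rpow_bounds {E : Type*} [NormedAddCommGroup E] {f : ℝ → E} {a b K : ℝ}
    (hf : ContinuousOn f (Ioi 0)) (ha : -1 < a) (hb : b < -1)
    (h0 : ∀ r ∈ Ioc (0 : ℝ) 1, ‖f r‖ ≤ K * r ^ a) (h1 : ∀ r ∈ Ioi (1 : ℝ), ‖f r‖ ≤ K * r ^ b) :
    IntegrableOn f (Ioi 0) := by
  rw [← Ioc_union_Ioi_eq_Ioi zero_le_one]
  refine IntegrableOn.union ?_ ?_
  · exact Integrable.mono' ((integrableOn_Ioc_rpow ha 1).const_mul K)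
      ((hf.mono Ioc_subset_Ioi_self).aestronglyMeasurable measurableSet_Ioc)
      ((ae_restrict_mem measurableSet_Ioc).mono h0)
  · exact Integrable.mono' ((integrableOn_Ioi_rpow_of_lt hb one_pos).const_mul K)
      ((hf.mono (Ioi_subset_Ioi zero_le_one)).aestronglyMeasurable measurableSet_Ioi)
      ((ae_restrict_mem measurableSet_Ioi).mono h1)

lemma continuousOn_rpow_Ioi (a : ℝ) : ContinuousOn (fun r : ℝ => r ^ a) (Ioi 0) := fun r hr =>
  (Real.continuousAt_rpow_const r a (Or.inl (ne_of_gt hr))).continuousWithinAt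

lemma integrableOn_rpow_mul_inv_add {σ s : ℝ} (hσ₀ : 0 < σ) (hσ₁ : σ < 1) (hs : 0 < s) :
    IntegrableOn (fun r : ℝ => r ^ (-σ) * (s + r)⁻¹) (Ioi 0) := by
  refine integrableOn_Ioi_of_rpow_bounds (a := -σ) (b := -σ - 1) (K := max 1 s⁻¹) ?_ (by linarith)
    (by linarith) ?_ ?_
  · refine (continuousOn_rpow_Ioi _).mul (ContinuousOn.inv₀ (by fun_prop) fun r hr => ?_)
    have : (0 : ℝ) < r := hr
    positivity
  · intro r hr
    have hr0 : 0 < r := hr.1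
    rw [Real.norm_of_nonneg (by positivity), mul_comm]
    gcongr
    refine (inv_anti₀ hs (by linarith)).trans (le_max_right _ _)
  · intro r hr
    have hr0 : 0 < r := zero_lt_one.trans hr
    rw [Real.norm_of_nonneg (by positivity), Real.rpow_sub_one hr0.ne', div_eq_mul_inv]
    calc r ^ (-σ) * (s + r)⁻¹ ≤ 1 * (r ^ (-σ) * r⁻¹) := by
          rw [one_mul]
          gcongr
          linarith
      _ ≤ _ := by
          gcongr
          exact le_max_left _ _

lemma integral_rpow_mul_inv_add {σ N : ℝ} (hN : 0 < N) :
    ∫ r in Ioi (0 : ℝ), r ^ (-σ) * (N + r)⁻¹ =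
      N ^ (-σ) * ∫ r in Ioi (0 : ℝ), r ^ (-σ) * (1 + r)⁻¹ := by
  have h := integral_comp_mul_left_Ioi' (fun r : ℝ => r ^ (-σ) * (N + r)⁻¹) 0 hN
  rw [mul_zero, smul_eq_mul] at h
  rw [← h, ← integral_const_mul, ← integral_const_mul]
  refine setIntegral_congr_fun measurableSet_Ioi fun r hr => ?_
  have hr0 : (0 : ℝ) < r := hr
  rw [Real.mul_rpow hN.le hr0.le]
  field_simp

lemma integral_beta_eq {σ u : ℝ} (hσ₀ : 0 < σ) (hσ₁ : σ < 1) (hu : 0 < u) :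
    ∫ s in Ioc 0 u, s ^ (σ - 1) * (u - s) ^ (-σ) = Real.Gamma σ * Real.Gamma (1 - σ) := by
  have h := Complex.betaIntegral_scaled (σ : ℂ) ((1 - σ : ℝ) : ℂ) hu
  have h' := Complex.Gamma_mul_Gamma_eq_betaIntegral (s := (σ : ℂ)) (t := ((1 - σ : ℝ) : ℂ))
    (by simpa using hσ₀) (by simp only [Complex.ofReal_re]; linarith)
  have e : (σ : ℂ) + ((1 - σ : ℝ) : ℂ) = 1 := by push_cast; ring
  rw [e, sub_self, Complex.cpow_zero, one_mul] at h
  rw [e, Complex.Gamma_one, one_mul, ← h, Complex.Gamma_ofReal, Complex.Gamma_ofReal,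
    intervalIntegral.integral_of_le hu.le] at h'
  have h3 : ∫ x in Ioc 0 u, (x : ℂ) ^ ((σ : ℂ) - 1) * ((u : ℂ) - x) ^ (((1 - σ : ℝ) : ℂ) - 1) =
      ((∫ s in Ioc 0 u, s ^ (σ - 1) * (u - s) ^ (-σ) : ℝ) : ℂ) := by
    rw [← integral_complex_ofReal]
    refine setIntegral_congr_fun measurableSet_Ioc fun s hs => ?_
    rw [← Complex.ofReal_sub, show (σ : ℂ) - 1 = ((σ - 1 : ℝ) : ℂ) by push_cast; rfl,
      show ((1 - σ : ℝ) : ℂ) - 1 = ((-σ : ℝ) : ℂ) by push_cast; ring,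
      ← Complex.ofReal_cpow hs.1.le, ← Complex.ofReal_cpow (sub_nonneg.2 hs.2)]
    push_cast
    rfl
  rw [h3] at h'
  exact_mod_cast h'.symm

lemma integrableOn_beta {σ u : ℝ} (hσ₀ : 0 < σ) (hσ₁ : σ < 1) (hu : 0 < u) :
    IntegrableOn (fun s : ℝ => s ^ (σ - 1) * (u - s) ^ (-σ)) (Ioc 0 u) := by
  by_contra h
  have h1 := integral_undef h
  rw [integral_beta_eq hσ₀ hσ₁ hu] at h1
  have h2 := Real.Gamma_pos_of_pos hσ₀
  have h3 := Real.Gamma_pos_of_pos (sub_pos.2 hσ₁)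
  exact (mul_pos h2 h3).ne' h1

lemma gamma_one_sub {σ : ℝ} (hσ₀ : 0 < σ) : Real.Gamma (1 - σ) = -σ * Real.Gamma (-σ) := by
  rw [← Real.Gamma_add_one (neg_ne_zero.2 hσ₀.ne')]
  ring_nf

/-- Fubini for a nonnegative scalar kernel against a bounded vector function. -/
lemma integral_kernel_swap {E : Type*} [NormedAddCommGroup E] [NormedSpace ℝ E] [CompleteSpace E]
    {μ ν : Measure ℝ} [SFinite μ] [SFinite ν]
    {k : ℝ → ℝ → ℝ} (hk : Measurable (Function.uncurry k)) (h0 : ∀ s u, 0 ≤ k s u)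
    (h1 : ∀ᵐ u ∂ν, Integrable (fun s => k s u) μ)
    (h2 : Integrable (fun u => ∫ s, k s u ∂μ) ν) {q : ℝ → E} {C : ℝ}
    (hq : AEStronglyMeasurable q ν) (hC : ∀ᵐ u ∂ν, ‖q u‖ ≤ C) :
    Integrable (fun s => ∫ u, k s u • q u ∂ν) μ ∧
      ∫ s, ∫ u, k s u • q u ∂ν ∂μ = ∫ u, (∫ s, k s u ∂μ) • q u ∂ν := by
  have hi : Integrable (Function.uncurry k) (μ.prod ν) := by
    rw [integrable_prod_iff' hk.aestronglyMeasurable]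
    refine ⟨h1, ?_⟩
    simpa [Function.uncurry, abs_of_nonneg (h0 _ _)] using h2
  have hi' : Integrable (Function.uncurry k • fun p : ℝ × ℝ => q p.2) (μ.prod ν) :=
    hi.smul_bdd C hq.comp_snd (Measure.quasiMeasurePreserving_snd.ae hC)
  refine ⟨hi'.integral_prod_left, ?_⟩
  have := integral_integral_swap (f := fun s u => k s u • q u) hi'
  rw [this]
  congr 1
  funext u
  rw [integral_smul_const]

/-- Integration by parts for the singular integral defining a fractional derivative of order `σ`. -/
lemma integral_rpow_smul_sub {E : Type*} [NormedAddCommGroup E] [NormedSpace ℝ E] [CompleteSpace E]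
    {f f' : ℝ → E} {σ s B C : ℝ} (hσ₀ : 0 < σ) (hσ₁ : σ < 1) (hs : 0 < s)
    (hf : ∀ r, 0 ≤ r → HasDerivAt f (f' r) r) (hf' : ContinuousOn f' (Ioi 0))
    (hB : ∀ r, 0 ≤ r → ‖f r‖ ≤ B) (hC : ∀ r, 0 ≤ r → ‖f' r‖ ≤ C * (s + r)⁻¹) :
    IntegrableOn (fun r => (r ^ (1 + σ))⁻¹ • (f r - f 0)) (Ioi 0) ∧
      IntegrableOn (fun r => r ^ (-σ) • f' r) (Ioi 0) ∧
      σ • ∫ r in Ioi (0 : ℝ), (r ^ (1 + σ))⁻¹ • (f r - f 0) =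
        ∫ r in Ioi (0 : ℝ), r ^ (-σ) • f' r := by
  have hB0 : 0 ≤ B := (norm_nonneg _).trans (hB 0 le_rfl)
  have hC0 : 0 ≤ C := by
    have := (norm_nonneg _).trans (hC 0 le_rfl)
    rw [add_zero] at this
    exact nonneg_of_mul_nonneg_left this (inv_pos.2 hs)
  have hfc : ContinuousOn f (Ici 0) := fun r hr => (hf r hr).continuousAt.continuousWithinAt
  have hlip : ∀ r, 0 ≤ r → ‖f r - f 0‖ ≤ C * s⁻¹ * r := by
    intro r hr
    have := (convex_Ici (0 : ℝ)).norm_image_sub_le_of_norm_hasDerivWithin_le (f := f) (f' := f')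
      (C := C * s⁻¹) (x := 0) (y := r) (fun x hx => (hf x hx).hasDerivWithinAt)
      (fun x hx => (hC x hx).trans (by
        have hx0 : (0 : ℝ) ≤ x := hx
        gcongr
        linarith)) self_mem_Ici hr
    simpa [abs_of_nonneg hr] using this
  have i1 : IntegrableOn (fun r => (r ^ (1 + σ))⁻¹ • (f r - f 0)) (Ioi 0) := by
    refine integrableOn_Ioi_of_rpow_bounds (a := -σ) (b := -σ - 1) (K := C * s⁻¹ + 2 * B) ?_
      (by linarith) (by linarith) ?_ ?_
    · refine ((continuousOn_rpow_Ioi _).inv₀ fun r hr => ?_).smul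
        ((hfc.mono Ioi_subset_Ici_self).sub continuousOn_const)
      exact (Real.rpow_pos_of_pos hr _).ne'
    · intro r hr
      have hr0 : 0 < r := hr.1
      rw [norm_smul, norm_inv, Real.norm_of_nonneg (by positivity)]
      calc _ ≤ (r ^ (1 + σ))⁻¹ * (C * s⁻¹ * r) := by gcongr; exact hlip r hr0.le
        _ = C * s⁻¹ * r ^ (-σ) := by
            rw [Real.rpow_add hr0, Real.rpow_one, Real.rpow_neg hr0.le]
            field_simp
        _ ≤ _ := by gcongr; linarith
    · intro r hr
      have hr0 : 0 < r := zero_lt_one.trans hr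
      rw [norm_smul, norm_inv, Real.norm_of_nonneg (by positivity), ← Real.rpow_neg hr0.le,
        show -(1 + σ) = -σ - 1 by ring, mul_comm]
      gcongr
      have := norm_sub_le (f r) (f 0)
      have := hB r hr0.le
      have := hB 0 le_rfl
      have : 0 ≤ C * s⁻¹ := by positivity
      linarith
  have i2 : IntegrableOn (fun r => r ^ (-σ) • f' r) (Ioi 0) := by
    refine Integrable.mono' ((integrableOn_rpow_mul_inv_add hσ₀ hσ₁ hs).const_mul C)
      (((continuousOn_rpow_Ioi _).smul hf').aestronglyMeasurable measurableSet_Ioi)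
      ((ae_restrict_mem measurableSet_Ioi).mono fun r hr => ?_)
    have hr0 : (0 : ℝ) < r := hr
    rw [norm_smul, Real.norm_of_nonneg (by positivity)]
    calc _ ≤ r ^ (-σ) * (C * (s + r)⁻¹) := by gcongr; exact hC r hr0.le
      _ = _ := by ring
  refine ⟨i1, i2, ?_⟩
  let G : ℝ → E := fun r => r ^ (-σ) • (f r - f 0)
  have hG0 : G 0 = 0 := by simp [G]
  have key := integral_Ioi_of_hasDerivAt_of_tendsto (a := (0 : ℝ)) (f := G) (m := 0)
    (f' := fun r => r ^ (-σ) • f' r - σ • (r ^ (1 + σ))⁻¹ • (f r - f 0)) ?_ ?_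
    (i2.sub (i1.smul σ)) ?_
  · have i1' : IntegrableOn (fun r => σ • (r ^ (1 + σ))⁻¹ • (f r - f 0)) (Ioi 0) := i1.smul σ
    rw [integral_sub i2 i1', integral_smul, hG0, sub_zero] at key
    exact (sub_eq_zero.1 key).symm
  · have hb : Tendsto (fun r : ℝ => C * s⁻¹ * r ^ (1 - σ)) (𝓝[≥] 0) (𝓝 0) := by
      have : ContinuousAt (fun r : ℝ => C * s⁻¹ * r ^ (1 - σ)) 0 :=
        continuousAt_const.mul (Real.continuousAt_rpow_const 0 _ (Or.inr (by linarith)))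
      have h0 := this.tendsto
      rw [Real.zero_rpow (by linarith), mul_zero] at h0
      exact h0.mono_left nhdsWithin_le_nhds
    rw [ContinuousWithinAt, hG0]
    refine squeeze_zero_norm' ?_ hb
    filter_upwards [self_mem_nhdsWithin] with r hr
    rcases (show (0 : ℝ) ≤ r from hr).eq_or_lt with rfl | hr0
    · rw [hG0, norm_zero, Real.zero_rpow (by linarith), mul_zero]
    · rw [norm_smul, Real.norm_of_nonneg (by positivity)]
      calc _ ≤ r ^ (-σ) * (C * s⁻¹ * r) := by gcongr; exact hlip r hr0.le
        _ = C * s⁻¹ * r ^ (1 - σ) := by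
          rw [sub_eq_neg_add, Real.rpow_add hr0, Real.rpow_one]
          ring
  · intro r hr
    have hr0 : (0 : ℝ) < r := hr
    have d1 := Real.hasDerivAt_rpow_const (p := -σ) (Or.inl hr0.ne')
    refine (d1.smul ((hf r hr0.le).sub_const (f 0))).congr_deriv ?_
    rw [smul_smul, ← Real.rpow_neg hr0.le, show -(1 + σ) = -σ - 1 by ring, neg_mul, neg_smul,
      ← sub_eq_add_neg]
  · have hb : Tendsto (fun r : ℝ => r ^ (-σ) * (2 * B)) atTop (𝓝 0) := by
      simpa using (tendsto_rpow_neg_atTop hσ₀).mul_const (2 * B)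
    refine squeeze_zero_norm' ?_ hb
    filter_upwards [eventually_gt_atTop 0] with r hr0
    rw [norm_smul, Real.norm_of_nonneg (by positivity)]
    gcongr
    have := norm_sub_le (f r) (f 0)
    have := hB r hr0.le
    have := hB 0 le_rfl
    linarith

lemma integral_rpow_mul_exp_neg_sub_one {σ : ℝ} (hσ₀ : 0 < σ) (hσ₁ : σ < 1) :
    IntegrableOn (fun r : ℝ => (r ^ (1 + σ))⁻¹ * (Real.exp (-r) - 1)) (Ioi 0) ∧
    ∫ r in Ioi (0 : ℝ), (r ^ (1 + σ))⁻¹ * (Real.exp (-r) - 1) = Real.Gamma (-σ) := by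
  obtain ⟨h1, -, h3⟩ := integral_rpow_smul_sub (f := fun r => Real.exp (-r))
    (f' := fun r => -Real.exp (-r)) (s := 1) (B := 1) (C := 1) hσ₀ hσ₁ one_pos
    (fun r _ => by simpa using (hasDerivAt_neg r).exp) (by fun_prop)
    (fun r hr => by simpa using hr) (fun r hr => by
      rw [norm_neg, Real.norm_of_nonneg (Real.exp_pos _).le, one_mul, Real.exp_neg]
      have := Real.add_one_le_exp r
      gcongr
      linarith)
  simp only [neg_zero, Real.exp_zero, smul_eq_mul] at h1 h3
  refine ⟨h1, mul_left_cancel₀ hσ₀.ne' ?_⟩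
  rw [h3]
  have h4 := Real.Gamma_eq_integral (s := 1 - σ) (by linarith)
  rw [gamma_one_sub hσ₀] at h4
  have : σ * Real.Gamma (-σ) = -∫ r in Ioi (0 : ℝ), Real.exp (-r) * r ^ (1 - σ - 1) := by
    rw [← h4]
    ring
  rw [this, ← integral_neg]
  congr 1
  funext r
  rw [show 1 - σ - 1 = -σ by ring]
  ring

lemma integral_exp_mul_rpow_sub {σ z s : ℝ} (hσ₀ : 0 < σ) (hs : 0 < s) :
    IntegrableOn (fun r : ℝ => Real.exp (-r) * (s * r - z) ^ (σ - 1)) (Ioi (z / s)) ∧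
    ∫ r in Ioi (z / s), Real.exp (-r) * (s * r - z) ^ (σ - 1) =
      Real.Gamma σ * (s ^ (σ - 1) * Real.exp (-(z / s))) := by
  let g : ℝ → ℝ := fun r => Real.exp (-r) * (s * r - z) ^ (σ - 1)
  have e : ∀ v ∈ Ioi (0 : ℝ), g (z / s + v) =
      s ^ (σ - 1) * Real.exp (-(z / s)) * (Real.exp (-v) * v ^ (σ - 1)) := by
    intro v hv
    have hv0 : (0 : ℝ) < v := hv
    have : s * (z / s + v) - z = s * v := by
      field_simp
      ring
    simp only [g]
    rw [this, Real.mul_rpow hs.le hv0.le, neg_add, Real.exp_add]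
    ring
  have hi := integrableOn_Ioi_comp_add g (z / s) 0
  have hv := setIntegral_Ioi_comp_add g (z / s) 0
  rw [add_zero] at hi hv
  constructor
  · exact hi.1 ((integrableOn_congr_fun e measurableSet_Ioi).2
      ((Real.GammaIntegral_convergent hσ₀).const_mul _))
  · change ∫ r in Ioi (z / s), g r = _
    rw [← hv, setIntegral_congr_fun measurableSet_Ioi e, integral_const_mul,
      ← Real.Gamma_eq_integral hσ₀]
    ring

end Scalar

/-! ### Fractional integrals and derivatives along a semigroup -/

section Fractional

variable {X : Type*} [NormedAddCommGroup X] [NormedSpace ℂ X] {S A : ℝ → X →L[ℂ] X} {M σ : ℝ}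

namespace IsAnalyticSemigroup

variable (hS : IsAnalyticSemigroup S A M)
include hS

lemma bound_nonneg : 0 ≤ M := (norm_nonneg _).trans (hS.norm_le 1 one_pos)

lemma continuousOn : ContinuousOn S (Ioi 0) := fun t ht =>
  (hS.hasDerivAt t ht).continuousAt.continuousWithinAt

lemma continuousOn_apply (x : X) : ContinuousOn (fun t => S t x) (Ioi 0) :=
  hS.continuousOn.clm_apply continuousOn_const

lemma continuousOn_deriv_apply (x : X) : ContinuousOn (fun t => A t x) (Ioi 0) :=
  hS.continuousOn_deriv.clm_apply continuousOn_const

lemma hasDerivAt_apply {t : ℝ} (ht : 0 < t) (x : X) :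
    HasDerivAt (fun t => S t x) (-A t x) t := by
  have := ((ContinuousLinearMap.apply ℂ X x).restrictScalars ℝ).hasFDerivAt.comp_hasDerivAt t
    (hS.hasDerivAt t ht)
  simpa [Function.comp_def] using this

lemma norm_apply_le {t : ℝ} (ht : 0 < t) (x : X) : ‖S t x‖ ≤ M * ‖x‖ :=
  ((S t).le_opNorm x).trans (by gcongr; exact hS.norm_le t ht)

lemma norm_deriv_apply_le {t : ℝ} (ht : 0 < t) (x : X) : ‖A t x‖ ≤ M * ‖x‖ * t⁻¹ := by
  refine ((A t).le_opNorm x).trans ?_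
  calc ‖A t‖ * ‖x‖ ≤ M / t * ‖x‖ := by gcongr; exact hS.norm_deriv_le t ht
    _ = _ := by ring

lemma apply_add {s t : ℝ} (hs : 0 < s) (ht : 0 < t) (x : X) : S (s + t) x = S s (S t x) := by
  rw [hS.add s t hs ht, mul_apply_eq_comp]

lemma apply_comm {s t : ℝ} (hs : 0 < s) (ht : 0 < t) (x : X) : S s (S t x) = S t (S s x) := by
  rw [← hS.apply_add hs ht, ← hS.apply_add ht hs, add_comm]

lemma deriv_add {s t : ℝ} (hs : 0 < s) (ht : 0 < t) (x : X) : A (s + t) x = A s (S t x) := by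
  have h1 : HasDerivAt (fun s => S (s + t) x) (-A (s + t) x) s := by
    have h := (hS.hasDerivAt_apply (add_pos hs ht) x).scomp s ((hasDerivAt_id s).add_const t)
    simpa [Function.comp_def] using h
  have h3 : (fun s => S (s + t) x) =ᶠ[𝓝 s] fun s => S s (S t x) := by
    filter_upwards [Ioi_mem_nhds hs] with r hr
    exact hS.apply_add hr ht x
  have := ((hS.hasDerivAt_apply hs (S t x)).congr_of_eventuallyEq h3).unique h1
  rw [neg_inj] at this
  exact this.symm

end IsAnalyticSemigroup

/-- `w = Γ(-σ)⁻¹ ∫_0^∞ (S(t) x - x) t^{-1-σ} dt`, the integral being improper at `0`. -/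
def HasFracPow (S : ℝ → X →L[ℂ] X) (σ : ℝ) (x w : X) : Prop :=
  Tendsto (fun ε => (Real.Gamma (-σ))⁻¹ • ∫ t in Ioi ε, (t ^ (1 + σ))⁻¹ • (S t x - x)) (𝓝[>] 0)
    (𝓝 w)

/-- The truncated fractional integral `Γ(σ)⁻¹ ∫_0^N s^{σ-1} S(s) w ds`. -/
def fracInt (S : ℝ → X →L[ℂ] X) (σ : ℝ) (w : X) (N : ℝ) : X :=
  (Real.Gamma σ)⁻¹ • ∫ s in Ioc 0 N, s ^ (σ - 1) • S s w

variable (hS : IsAnalyticSemigroup S A M)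
include hS

lemma integrableOn_fracPow_integrand (hσ₀ : 0 < σ) {ε : ℝ} (hε : 0 < ε) (x : X) :
    IntegrableOn (fun t => (t ^ (1 + σ))⁻¹ • (S t x - x)) (Ioi ε) := by
  have hsub : Ioi ε ⊆ Ioi 0 := Ioi_subset_Ioi hε.le
  refine Integrable.mono' ((integrableOn_Ioi_rpow_of_lt (a := -(1 + σ)) (by linarith) hε).const_mul
    (M * ‖x‖ + ‖x‖)) (ContinuousOn.aestronglyMeasurable ?_ measurableSet_Ioi)
    ((ae_restrict_mem measurableSet_Ioi).mono fun t ht => ?_)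
  · refine (((continuousOn_rpow_Ioi _).inv₀ fun r hr => ?_).smul
        ((hS.continuousOn_apply x).sub continuousOn_const)).mono hsub
    exact (Real.rpow_pos_of_pos hr _).ne'
  · have ht0 : 0 < t := hsub ht
    rw [norm_smul, norm_inv, Real.norm_of_nonneg (by positivity), Real.rpow_neg ht0.le, mul_comm]
    gcongr
    exact (norm_sub_le _ _).trans (add_le_add_left (hS.norm_apply_le ht0 x) _)

lemma HasFracPow.clm_apply [CompleteSpace X] (hσ₀ : 0 < σ) {x w : X} (h : HasFracPow S σ x w)
    {B : X →L[ℂ] X} (hB : ∀ t : ℝ, 0 < t → ∀ v, B (S t v) = S t (B v)) :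
    HasFracPow S σ (B x) (B w) := by
  refine ((B.continuous.tendsto w).comp h).congr' ?_
  filter_upwards [self_mem_nhdsWithin] with ε hε
  have hε0 : (0 : ℝ) < ε := hε
  rw [Function.comp_apply, ContinuousLinearMap.map_smul_of_tower]
  congr 1
  have e := (B.restrictScalars ℝ).integral_comp_comm (integrableOn_fracPow_integrand hS hσ₀ hε0 x)
  refine e.symm.trans (setIntegral_congr_fun measurableSet_Ioi fun t ht => ?_)
  simp [hB t (hε0.trans ht)]

/-- `S(s) T^σ x = Γ(1-σ)⁻¹ ∫_0^∞ r^{-σ} T S(s+r) x dr`, that is `T^σ = T^{-(1-σ)} T`. -/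
lemma HasFracPow.apply_eq [CompleteSpace X] (hσ₀ : 0 < σ) (hσ₁ : σ < 1) {x w : X}
    (h : HasFracPow S σ x w) {s : ℝ} (hs : 0 < s) :
    IntegrableOn (fun r => r ^ (-σ) • A (s + r) x) (Ioi 0) ∧
    S s w = (Real.Gamma (1 - σ))⁻¹ • ∫ r in Ioi (0 : ℝ), r ^ (-σ) • A (s + r) x := by
  obtain ⟨i1, i2, e⟩ := integral_rpow_smul_sub (f := fun r => S (s + r) x)
    (f' := fun r => -A (s + r) x) (s := s) (B := M * ‖x‖) (C := M * ‖x‖) hσ₀ hσ₁ hs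
    (fun r hr => by
      have h := (hS.hasDerivAt_apply (t := s + r) (by linarith) x).scomp r
        ((hasDerivAt_id r).const_add s)
      simpa [Function.comp_def] using h)
    (((hS.continuousOn_deriv_apply x).comp (by fun_prop) fun r hr => by
      have : (0 : ℝ) < r := hr
      exact add_pos hs this).neg)
    (fun r hr => hS.norm_apply_le (by linarith) x)
    (fun r hr => by
      rw [norm_neg]
      exact hS.norm_deriv_apply_le (by linarith) x)
  simp only [smul_neg, add_zero] at i1 i2 e
  rw [integral_neg] at e
  refine ⟨by simpa using i2.neg, ?_⟩
  -- `S(s) w` is the fractional derivative of `S(s) x`, whose defining integral converges absolutely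
  have h1 := h.clm_apply hS hσ₀ (B := S s) fun t ht v => hS.apply_comm hs ht v
  have h2 : HasFracPow S σ (S s x)
      ((Real.Gamma (-σ))⁻¹ • ∫ r in Ioi (0 : ℝ), (r ^ (1 + σ))⁻¹ • (S (s + r) x - S s x)) := by
    refine Tendsto.const_smul ?_ _
    have hc := (aecover_Ioi_of_Ioi (μ := volume) (A := (0 : ℝ)) (a := fun ε : ℝ => ε)
      (l := 𝓝[>] 0) (tendsto_id.mono_left nhdsWithin_le_nhds)).integral_tendsto_of_countably_generated i1
    refine hc.congr' ?_
    filter_upwards [self_mem_nhdsWithin] with ε hε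
    have hε0 : (0 : ℝ) < ε := hε
    rw [Measure.restrict_restrict measurableSet_Ioi,
      inter_eq_left.2 (Ioi_subset_Ioi hε0.le)]
    refine setIntegral_congr_fun measurableSet_Ioi fun t ht => ?_
    have ht0 : 0 < t := hε0.trans ht
    rw [hS.apply_add hs ht0, hS.apply_comm hs ht0]
  rw [tendsto_nhds_unique h1 h2, gamma_one_sub hσ₀]
  have hσ : σ ≠ 0 := hσ₀.ne'
  have e' : ∫ r in Ioi (0 : ℝ), r ^ (-σ) • A (s + r) x =
      -(σ • ∫ r in Ioi (0 : ℝ), (r ^ (1 + σ))⁻¹ • (S (s + r) x - S s x)) := by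
    rw [e, neg_neg]
  rw [e', ← neg_smul, smul_smul]
  congr 1
  field_simp

lemma integrableOn_fracInt_integrand (hσ₀ : 0 < σ) (w : X) (N : ℝ) :
    IntegrableOn (fun s => s ^ (σ - 1) • S s w) (Ioc 0 N) := by
  refine Integrable.mono' ((integrableOn_Ioc_rpow (a := σ - 1) (by linarith) N).const_mul
    (M * ‖w‖)) ((((continuousOn_rpow_Ioi _).smul (hS.continuousOn_apply w)).mono
      Ioc_subset_Ioi_self).aestronglyMeasurable measurableSet_Ioc)
    ((ae_restrict_mem measurableSet_Ioc).mono fun s hs => ?_)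
  have hs0 : 0 < s := hs.1
  rw [norm_smul, Real.norm_of_nonneg (by positivity), mul_comm]
  gcongr
  exact hS.norm_apply_le hs0 w

/-- The fractional integral of order `σ` inverts the fractional derivative, up to the boundary term
`S(N) x` and an error controlled by `t T S(t) x` for `t ≥ N`. -/
lemma exists_norm_fracInt_sub_le [CompleteSpace X] (hσ₀ : 0 < σ) (hσ₁ : σ < 1) :
    ∃ K : ℝ, 0 ≤ K ∧ ∀ (x w : X), HasFracPow S σ x w → ∀ N η : ℝ, 0 < N →
      (∀ u, N ≤ u → ‖A u x‖ ≤ η * u⁻¹) → ‖fracInt S σ w N - x + S N x‖ ≤ K * η := by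
  have hg1 := Real.Gamma_pos_of_pos hσ₀
  have hg2 := Real.Gamma_pos_of_pos (sub_pos.2 hσ₁)
  set c : ℝ := (Real.Gamma σ)⁻¹ * (Real.Gamma (1 - σ))⁻¹ with hc
  have hc0 : 0 < c := by positivity
  let I : ℝ := ∫ r in Ioi (0 : ℝ), r ^ (-σ) * (1 + r)⁻¹
  have hI : 0 ≤ I := setIntegral_nonneg measurableSet_Ioi fun r hr => by
    have : (0 : ℝ) < r := hr
    positivity
  refine ⟨c * (I * σ⁻¹), by positivity, fun x w hw N η hN hη => ?_⟩
  have hη0 : 0 ≤ η := by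
    have := (norm_nonneg _).trans (hη N le_rfl)
    exact nonneg_of_mul_nonneg_left this (inv_pos.2 hN)
  -- the estimate after smoothing by `S(δ)`
  have key : ∀ δ : ℝ, 0 < δ →
      ‖S δ (fracInt S σ w N) - S δ x + S δ (S N x)‖ ≤ c * (I * σ⁻¹) * η := by
    intro δ hδ
    -- `S(δ + s) w` is a constant times `∫ (u - s)^{-σ} q(u) du` over `u > s`; the part `u ≤ N` is
    -- treated by Fubini's theorem and the beta integral, the part `u > N` is the remainder
    let q : ℝ → X := fun u => A (δ + u) x
    have hqc : ContinuousOn q (Ici 0) := (hS.continuousOn_deriv_apply x).comp (by fun_prop)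
      fun u hu => by
        have : (0 : ℝ) ≤ u := hu
        exact add_pos_of_pos_of_nonneg hδ this
    have hqm : ∀ s : Set ℝ, s ⊆ Ici 0 → MeasurableSet s →
        AEStronglyMeasurable q (volume.restrict s) := fun s hs hm =>
      (hqc.mono hs).aestronglyMeasurable hm
    have hqb : ∀ u, 0 < u → ‖q u‖ ≤ M * ‖x‖ * δ⁻¹ := fun u hu => by
      have := hS.bound_nonneg
      refine (hS.norm_deriv_apply_le (by linarith) x).trans ?_
      gcongr
      linarith
    let k : ℝ → ℝ → ℝ := fun s u => if 0 < s ∧ s < u then s ^ (σ - 1) * (u - s) ^ (-σ) else 0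
    have hk : Measurable (Function.uncurry k) := by
      refine Measurable.ite ?_ (by fun_prop) measurable_const
      exact (measurableSet_lt measurable_const measurable_fst).inter
        (measurableSet_lt measurable_fst measurable_snd)
    have hk0 : ∀ s u, 0 ≤ k s u := by
      intro s u
      simp only [k]
      split_ifs with h
      · have := h.1
        have := sub_pos.2 h.2
        positivity
      · exact le_rfl
    -- for `0 < u ≤ N` the kernel lives on `0 < s < u`
    have hks : ∀ u ∈ Ioc 0 N, ∀ f : ℝ → ℝ, (∀ s ∈ Ioo 0 u, f s = s ^ (σ - 1) * (u - s) ^ (-σ)) →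
        (∀ s ∉ Ioo 0 u, f s = 0) →
        IntegrableOn f (Ioc 0 N) ∧ ∫ s in Ioc 0 N, f s = Real.Gamma σ * Real.Gamma (1 - σ) := by
      intro u hu f hf1 hf2
      have h1 : IntegrableOn (fun s : ℝ => s ^ (σ - 1) * (u - s) ^ (-σ)) (Ioo 0 u) :=
        (integrableOn_beta hσ₀ hσ₁ hu.1).mono_set Ioo_subset_Ioc_self
      have h2 := (integrableOn_congr_fun hf1 measurableSet_Ioo).2 h1
      have h3 : Ioo 0 u ⊆ Ioc 0 N := fun s hs => ⟨hs.1, hs.2.le.trans hu.2⟩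
      refine ⟨h2.of_forall_sdiff_eq_zero measurableSet_Ioc fun s hs => hf2 s hs.2, ?_⟩
      rw [setIntegral_eq_of_subset_of_forall_sdiff_eq_zero measurableSet_Ioc h3
        fun s hs => hf2 s hs.2, setIntegral_congr_fun measurableSet_Ioo hf1,
        ← integral_Ioc_eq_integral_Ioo, integral_beta_eq hσ₀ hσ₁ hu.1]
    have hku : ∀ u ∈ Ioc 0 N, IntegrableOn (fun s => k s u) (Ioc 0 N) ∧
        ∫ s in Ioc 0 N, k s u = Real.Gamma σ * Real.Gamma (1 - σ) := fun u hu =>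
      hks u hu _ (fun s hs => if_pos hs) (fun s hs => if_neg hs)
    have hsw := integral_kernel_swap (μ := volume.restrict (Ioc 0 N))
      (ν := volume.restrict (Ioc 0 N)) hk hk0
      ((ae_restrict_mem measurableSet_Ioc).mono fun u hu => (hku u hu).1)
      ((integrableOn_congr_fun (fun u hu => (hku u hu).2) measurableSet_Ioc).2
        (integrableOn_const (by simp) (by finiteness)))
      (hqm _ (fun u hu => hu.1.le) measurableSet_Ioc)
      ((ae_restrict_mem measurableSet_Ioc).mono fun u hu => hqb u hu.1)
    have hq_int : ∫ u in Ioc 0 N, q u = S δ x - S δ (S N x) := by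
      have hd : ∀ u ∈ uIcc 0 N, HasDerivAt (fun u => -S (δ + u) x) (q u) u := by
        intro u hu
        rw [uIcc_of_le hN.le] at hu
        have h := ((hS.hasDerivAt_apply (t := δ + u) (by linarith [hu.1]) x).scomp u
          ((hasDerivAt_id u).const_add δ)).neg
        simpa [Function.comp_def] using! h
      rw [← intervalIntegral.integral_of_le hN.le,
        intervalIntegral.integral_eq_sub_of_hasDerivAt hd
          ((hqc.mono Icc_subset_Ici_self).intervalIntegrable_of_Icc hN.le),
        ← hS.apply_add hδ hN]
      simp only [add_zero]
      abel
    have hmain : ∫ s in Ioc 0 N, ∫ u in Ioc 0 N, k s u • q u =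
        (Real.Gamma σ * Real.Gamma (1 - σ)) • (S δ x - S δ (S N x)) := by
      rw [hsw.2, ← hq_int, ← integral_smul]
      refine setIntegral_congr_fun measurableSet_Ioc fun u hu => ?_
      rw [(hku u hu).2]
    -- the smoothed fractional integral as a double integral
    have hdbl : ∀ s ∈ Ioc 0 N, s ^ (σ - 1) • S (δ + s) w - (Real.Gamma (1 - σ))⁻¹ •
        ∫ u in Ioc 0 N, k s u • q u = (Real.Gamma (1 - σ))⁻¹ • s ^ (σ - 1) •
          ∫ u in Ioi N, (u - s) ^ (-σ) • q u := by
      intro s hs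
      obtain ⟨j1, j2⟩ := hw.apply_eq hS hσ₀ hσ₁ (s := δ + s) (by linarith [hs.1])
      have e1 : ∀ r : ℝ, r ^ (-σ) • A (δ + s + r) x = (fun u => (u - s) ^ (-σ) • q u) (s + r) := by
        intro r
        simp only [q]
        rw [add_sub_cancel_left, add_assoc]
      simp_rw [e1] at j1 j2
      rw [integrableOn_Ioi_comp_add (fun u => (u - s) ^ (-σ) • q u), add_zero] at j1
      rw [setIntegral_Ioi_comp_add (fun u => (u - s) ^ (-σ) • q u), add_zero,
        ← Ioc_union_Ioi_eq_Ioi hs.2, setIntegral_union (Ioc_disjoint_Ioi le_rfl) measurableSet_Ioi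
        (j1.mono_set Ioc_subset_Ioi_self) (j1.mono_set (Ioi_subset_Ioi hs.2))] at j2
      have e2 : ∫ u in Ioc 0 N, k s u • q u = s ^ (σ - 1) • ∫ u in Ioc s N, (u - s) ^ (-σ) • q u := by
        rw [← integral_smul]
        have h3 : Ioc s N ⊆ Ioc 0 N := Ioc_subset_Ioc_left hs.1.le
        rw [setIntegral_eq_of_subset_of_forall_sdiff_eq_zero measurableSet_Ioc h3 fun u hu => ?_]
        · refine setIntegral_congr_fun measurableSet_Ioc fun u hu => ?_
          simp only [k]
          rw [if_pos ⟨hs.1, hu.1⟩, smul_smul]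
        · have : ¬ (0 < s ∧ s < u) := fun h => hu.2 ⟨h.2, hu.1.2⟩
          simp only [k]
          rw [if_neg this, zero_smul]
      rw [e2, j2]
      module
    have hrem : ∀ s ∈ Ioc 0 N, ‖(Real.Gamma (1 - σ))⁻¹ • s ^ (σ - 1) •
        ∫ u in Ioi N, (u - s) ^ (-σ) • q u‖ ≤
        (Real.Gamma (1 - σ))⁻¹ * (η * (N ^ (-σ) * I)) * s ^ (σ - 1) := by
      intro s hs
      have hs0 : 0 < s := hs.1
      have e3 := setIntegral_Ioi_comp_add (fun u => (u - s) ^ (-σ) • q u) N 0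
      rw [add_zero] at e3
      have hint : ‖∫ u in Ioi N, (u - s) ^ (-σ) • q u‖ ≤ η * (N ^ (-σ) * I) := by
        rw [← e3, ← integral_rpow_mul_inv_add hN, ← integral_const_mul]
        refine norm_integral_le_of_norm_le
          ((integrableOn_rpow_mul_inv_add hσ₀ hσ₁ hN).const_mul η)
          ((ae_restrict_mem measurableSet_Ioi).mono fun r hr => ?_)
        have hr0 : (0 : ℝ) < r := hr
        have hNs := hs.2
        have hb : ‖q (N + r)‖ ≤ η * (N + r)⁻¹ := by
          exact (hη _ (by linarith)).trans
            (mul_le_mul_of_nonneg_left (inv_anti₀ (by linarith) (by linarith)) hη0)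
        have hp : (N + r - s) ^ (-σ) ≤ r ^ (-σ) :=
          Real.rpow_le_rpow_of_nonpos hr0 (by linarith) (by linarith)
        rw [norm_smul, Real.norm_of_nonneg (Real.rpow_nonneg (by linarith) _)]
        calc _ ≤ r ^ (-σ) * (η * (N + r)⁻¹) := by gcongr
          _ = _ := by ring
      rw [norm_smul, norm_smul, Real.norm_of_nonneg (by positivity),
        Real.norm_of_nonneg (by positivity)]
      calc _ ≤ (Real.Gamma (1 - σ))⁻¹ * (s ^ (σ - 1) * (η * (N ^ (-σ) * I))) := by gcongr
        _ = _ := by ring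
    have hSδ : S δ (fracInt S σ w N) =
        (Real.Gamma σ)⁻¹ • ∫ s in Ioc 0 N, s ^ (σ - 1) • S (δ + s) w := by
      rw [fracInt, ContinuousLinearMap.map_smul_of_tower]
      congr 1
      have e := ((S δ).restrictScalars ℝ).integral_comp_comm
        (integrableOn_fracInt_integrand hS hσ₀ w N)
      refine e.symm.trans (setIntegral_congr_fun measurableSet_Ioc fun t ht => ?_)
      simp [hS.apply_add hδ ht.1]
    have hi1 : IntegrableOn (fun s => s ^ (σ - 1) • S (δ + s) w) (Ioc 0 N) := by
      refine (integrableOn_congr_fun (fun s hs => ?_) measurableSet_Ioc).1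
        (((S δ).restrictScalars ℝ).integrable_comp (integrableOn_fracInt_integrand hS hσ₀ w N))
      simp [hS.apply_add hδ hs.1]
    have hfin : S δ (fracInt S σ w N) - S δ x + S δ (S N x) = (Real.Gamma σ)⁻¹ •
        ∫ s in Ioc 0 N, (Real.Gamma (1 - σ))⁻¹ • s ^ (σ - 1) •
          ∫ u in Ioi N, (u - s) ^ (-σ) • q u := by
      have hi2 : IntegrableOn (fun s => (Real.Gamma (1 - σ))⁻¹ • ∫ u in Ioc 0 N, k s u • q u)
        (Ioc 0 N) := hsw.1.smul _
      rw [← setIntegral_congr_fun measurableSet_Ioc hdbl, integral_sub hi1 hi2, integral_smul, hmain, hSδ, smul_sub,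
        smul_smul, smul_smul]
      have : (Real.Gamma σ)⁻¹ * (Real.Gamma (1 - σ))⁻¹ * (Real.Gamma σ * Real.Gamma (1 - σ)) = 1 := by
        field_simp
      rw [this, one_smul]
      abel
    rw [hfin, norm_smul, Real.norm_of_nonneg (by positivity)]
    calc _ ≤ (Real.Gamma σ)⁻¹ * ((Real.Gamma (1 - σ))⁻¹ * (η * (N ^ (-σ) * I)) *
          (N ^ (σ - 1 + 1) / (σ - 1 + 1))) := by
          gcongr
          rw [← integral_Ioc_rpow (by linarith) hN.le, ← integral_const_mul]
          exact norm_integral_le_of_norm_le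
            ((integrableOn_Ioc_rpow (by linarith) N).const_mul _)
            ((ae_restrict_mem measurableSet_Ioc).mono hrem)
      _ = _ := by
          rw [sub_add_cancel, Real.rpow_neg hN.le, hc]
          have := (Real.rpow_pos_of_pos hN σ).ne'
          field_simp
  have hlim : Tendsto (fun δ => ‖S δ (fracInt S σ w N) - S δ x + S δ (S N x)‖) (𝓝[>] 0)
      (𝓝 ‖fracInt S σ w N - x + S N x‖) :=
    (((hS.tendsto_zero _).sub (hS.tendsto_zero _)).add (hS.tendsto_zero _)).norm
  exact le_of_tendsto hlim (by filter_upwards [self_mem_nhdsWithin] with δ hδ using key δ hδ)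

end Fractional

/-! ### The Poisson operators -/

lemma setIntegral_Ioc_comp_add {E : Type*} [NormedAddCommGroup E] [NormedSpace ℝ E] (g : ℝ → E)
    (s a b : ℝ) : ∫ r in Ioc a b, g (s + r) = ∫ u in Ioc (s + a) (s + b), g u := by
  have := (measurePreserving_add_left volume s).setIntegral_preimage_emb
    (measurableEmbedding_addLeft s) g (Ioc (s + a) (s + b))
  simpa using this

lemma tendsto_atTop_of_norm_sub_le {E : Type*} [SeminormedAddCommGroup E] {f : ℝ → E} {x : E}
    (h : ∀ ε > 0, ∃ N₀, ∀ N ≥ N₀, ‖f N - x‖ ≤ ε) : Tendsto f atTop (𝓝 x) := by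
  rw [Metric.tendsto_atTop']
  intro ε hε
  obtain ⟨N₀, hN⟩ := h (ε / 2) (by positivity)
  exact ⟨N₀, fun n hn => by rw [dist_eq_norm]; linarith [hN n hn.le]⟩

section Poisson

variable {X : Type*} [NormedAddCommGroup X] [NormedSpace ℂ X] {S A : ℝ → X →L[ℂ] X} {M σ : ℝ}

/-- The operator `Γ(σ)⁻¹ ∫_0^∞ e^{-r} r^{σ-1} S(z/r) dr`. With `z = y² / 4` it maps the boundary
value `x₀` to the value `x(y)` of the extension. -/
def poissonOp (S : ℝ → X →L[ℂ] X) (σ z : ℝ) : X →L[ℂ] X :=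
  (Real.Gamma σ)⁻¹ • ∫ r in Ioi (0 : ℝ), (Real.exp (-r) * r ^ (σ - 1)) • S (z / r)

variable (hS : IsAnalyticSemigroup S A M)
include hS

lemma integrableOn_poissonOp (hσ₀ : 0 < σ) {z : ℝ} (hz : 0 < z) :
    IntegrableOn (fun r => (Real.exp (-r) * r ^ (σ - 1)) • S (z / r)) (Ioi 0) := by
  have hpos : MapsTo (fun r : ℝ => z / r) (Ioi 0) (Ioi 0) := fun r hr => by
    have : (0 : ℝ) < r := hr
    exact div_pos hz this
  refine Integrable.mono' ((Real.GammaIntegral_convergent hσ₀).mul_const M)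
    (ContinuousOn.aestronglyMeasurable ?_ measurableSet_Ioi)
    ((ae_restrict_mem measurableSet_Ioi).mono fun r hr => ?_)
  · refine (ContinuousOn.mul (by fun_prop) (continuousOn_rpow_Ioi _)).smul
      (hS.continuousOn.comp (continuousOn_const.div continuousOn_id fun r hr => ne_of_gt hr) hpos)
  · have hr0 : (0 : ℝ) < r := hr
    rw [norm_smul, Real.norm_of_nonneg (by positivity)]
    gcongr
    exact hS.norm_le _ (hpos hr)

lemma integrableOn_poissonOp_apply (hσ₀ : 0 < σ) {z : ℝ} (hz : 0 < z) (x : X) :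
    IntegrableOn (fun r => (Real.exp (-r) * r ^ (σ - 1)) • S (z / r) x) (Ioi 0) :=
  ((ContinuousLinearMap.apply ℂ X x).restrictScalars ℝ).integrable_comp
    (integrableOn_poissonOp hS hσ₀ hz)

lemma poissonOp_apply [CompleteSpace X] (hσ₀ : 0 < σ) {z : ℝ} (hz : 0 < z) (x : X) :
    poissonOp S σ z x =
      (Real.Gamma σ)⁻¹ • ∫ r in Ioi (0 : ℝ), (Real.exp (-r) * r ^ (σ - 1)) • S (z / r) x := by
  rw [poissonOp, smul_apply, ContinuousLinearMap.integral_apply (integrableOn_poissonOp hS hσ₀ hz)]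
  rfl

lemma norm_poissonOp_apply_le [CompleteSpace X] (hσ₀ : 0 < σ) {z : ℝ} (hz : 0 < z) (x : X) :
    ‖poissonOp S σ z x‖ ≤ M * ‖x‖ := by
  have hg := Real.Gamma_pos_of_pos hσ₀
  rw [poissonOp_apply hS hσ₀ hz, norm_smul, Real.norm_of_nonneg (by positivity)]
  calc _ ≤ (Real.Gamma σ)⁻¹ * (Real.Gamma σ * (M * ‖x‖)) := by
        gcongr
        rw [Real.Gamma_eq_integral hσ₀, ← integral_mul_const]
        refine norm_integral_le_of_norm_le ((Real.GammaIntegral_convergent hσ₀).mul_const _)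
          ((ae_restrict_mem measurableSet_Ioi).mono fun r hr => ?_)
        have hr0 : (0 : ℝ) < r := hr
        rw [norm_smul, Real.norm_of_nonneg (by positivity)]
        gcongr
        exact hS.norm_apply_le (div_pos hz hr0) x
    _ = _ := by field_simp

lemma poissonOp_comm [CompleteSpace X] (hσ₀ : 0 < σ) {z : ℝ} (hz : 0 < z) {B : X →L[ℂ] X}
    (hB : ∀ t : ℝ, 0 < t → ∀ v, B (S t v) = S t (B v)) (x : X) :
    B (poissonOp S σ z x) = poissonOp S σ z (B x) := by
  rw [poissonOp_apply hS hσ₀ hz, poissonOp_apply hS hσ₀ hz, ContinuousLinearMap.map_smul_of_tower]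
  congr 1
  refine ((B.restrictScalars ℝ).integral_comp_comm
    (integrableOn_poissonOp_apply hS hσ₀ hz x)).symm.trans
    (setIntegral_congr_fun measurableSet_Ioi fun r hr => ?_)
  simp [hB _ (div_pos hz hr)]

lemma tendsto_poissonOp_zero [CompleteSpace X] (hσ₀ : 0 < σ) (x : X) :
    Tendsto (fun z => poissonOp S σ z x) (𝓝[>] 0) (𝓝 x) := by
  have hg := Real.Gamma_pos_of_pos hσ₀
  have h : Tendsto (fun z => ∫ r in Ioi (0 : ℝ), (Real.exp (-r) * r ^ (σ - 1)) • S (z / r) x)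
      (𝓝[>] 0) (𝓝 (∫ r in Ioi (0 : ℝ), (Real.exp (-r) * r ^ (σ - 1)) • x)) := by
    refine tendsto_integral_filter_of_dominated_convergence
      (fun r => Real.exp (-r) * r ^ (σ - 1) * (M * ‖x‖)) ?_ ?_
      ((Real.GammaIntegral_convergent hσ₀).mul_const _) ?_
    · filter_upwards [self_mem_nhdsWithin] with z hz
      exact (integrableOn_poissonOp_apply hS hσ₀ hz x).aestronglyMeasurable
    · filter_upwards [self_mem_nhdsWithin] with z hz
      refine (ae_restrict_mem measurableSet_Ioi).mono fun r hr => ?_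
      have hr0 : (0 : ℝ) < r := hr
      rw [norm_smul, Real.norm_of_nonneg (by positivity)]
      gcongr
      exact hS.norm_apply_le (div_pos hz hr0) x
    · refine (ae_restrict_mem measurableSet_Ioi).mono fun r hr => ?_
      have hr0 : (0 : ℝ) < r := hr
      refine Tendsto.const_smul ((hS.tendsto_zero x).comp ?_) _
      refine tendsto_nhdsWithin_iff.2 ⟨?_, ?_⟩
      · have : Tendsto (fun z : ℝ => z / r) (𝓝 0) (𝓝 (0 / r)) := tendsto_id.div_const r
        rw [zero_div] at this
        exact this.mono_left nhdsWithin_le_nhds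
      · filter_upwards [self_mem_nhdsWithin] with z hz using div_pos hz hr0
  rw [integral_smul_const, ← Real.Gamma_eq_integral hσ₀] at h
  have h' := h.const_smul (Real.Gamma σ)⁻¹
  rw [smul_smul, inv_mul_cancel₀ hg.ne', one_smul] at h'
  refine h'.congr' ?_
  filter_upwards [self_mem_nhdsWithin] with z hz
  rw [poissonOp_apply hS hσ₀ hz]

lemma exists_norm_fracInt_le [CompleteSpace X] (hσ₀ : 0 < σ) (hσ₁ : σ < 1) {x w : X}
    (h : HasFracPow S σ x w) : ∃ C, ∀ N, ‖fracInt S σ w N‖ ≤ C := by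
  obtain ⟨K, hK0, hK⟩ := exists_norm_fracInt_sub_le hS hσ₀ hσ₁
  have hM := hS.bound_nonneg
  refine ⟨K * (M * ‖x‖) + ‖x‖ + M * ‖x‖, fun N => ?_⟩
  rcases le_or_gt N 0 with hN | hN
  · rw [fracInt, Ioc_eq_empty (not_lt.2 hN)]
    simp only [Measure.restrict_empty, integral_zero_measure, smul_zero, norm_zero]
    positivity
  · have h1 := hK x w h N (M * ‖x‖) hN fun u hu => hS.norm_deriv_apply_le (hN.trans_le hu) x
    have h2 := hS.norm_apply_le hN x
    have e : fracInt S σ w N = (fracInt S σ w N - x + S N x) + x - S N x := by abel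
    rw [e]
    calc _ ≤ ‖(fracInt S σ w N - x + S N x) + x‖ + ‖S N x‖ := norm_sub_le _ _
      _ ≤ ‖fracInt S σ w N - x + S N x‖ + ‖x‖ + ‖S N x‖ := by
        gcongr
        exact norm_add_le _ _
      _ ≤ _ := by gcongr

/-- On vectors with `S(t) x → 0` the operator `T^{-σ} = Γ(σ)⁻¹ ∫_0^∞ s^{σ-1} S(s) ds`, improper at
infinity, inverts `T^σ`. The decay enters through `t T S(t) x = 2 (t/2) T S(t/2) S(t/2) x → 0`. -/
lemma tendsto_fracInt [CompleteSpace X] (hσ₀ : 0 < σ) (hσ₁ : σ < 1) {x w : X}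
    (h : HasFracPow S σ x w) (h0 : Tendsto (fun t => S t x) atTop (𝓝 0)) :
    Tendsto (fracInt S σ w) atTop (𝓝 x) := by
  obtain ⟨K, hK0, hK⟩ := exists_norm_fracInt_sub_le hS hσ₀ hσ₁
  have hM := hS.bound_nonneg
  have hlim : Tendsto (fun N => fracInt S σ w N - x + S N x) atTop (𝓝 0) := by
    refine tendsto_atTop_of_norm_sub_le fun ε hε => ?_
    have h1 : Tendsto (fun t => K * (2 * M * ‖S t x‖)) atTop (𝓝 0) := by
      simpa using (h0.norm.const_mul (2 * M)).const_mul K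
    obtain ⟨a, ha⟩ := eventually_atTop.1 (h1.eventually (gt_mem_nhds hε))
    rcases hK0.eq_or_lt with hK1 | hK1
    · refine ⟨1, fun N hN => ?_⟩
      have h2 := hK x w h N (M * ‖x‖) (by linarith) fun u hu =>
        hS.norm_deriv_apply_le (by linarith) x
      rw [← hK1, zero_mul] at h2
      rw [sub_zero]
      exact h2.trans hε.le
    · refine ⟨max 1 (2 * a), fun N hN => ?_⟩
      have hN1 : 1 ≤ N := (le_max_left _ _).trans hN
      have hN2 : 2 * a ≤ N := (le_max_right _ _).trans hN
      have h2 := hK x w h N (ε / K) (by linarith) fun u hu => by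
        have hu2 : 0 < u / 2 := by linarith
        have e : A u x = A (u / 2) (S (u / 2) x) := by
          rw [← hS.deriv_add hu2 hu2, add_halves]
        rw [e]
        refine (hS.norm_deriv_apply_le hu2 _).trans ?_
        have h3 := (ha (u / 2) (by linarith)).le
        rw [← le_div_iff₀' hK1] at h3
        have hu0 : 0 < u := by linarith
        calc _ = 2 * M * ‖S (u / 2) x‖ * u⁻¹ := by field_simp
          _ ≤ _ := by gcongr
      rw [sub_zero]
      exact h2.trans (by rw [mul_div_cancel₀ _ hK1.ne'])
  have := (hlim.add_const x).sub h0
  rw [zero_add, sub_zero] at this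
  refine this.congr fun N => ?_
  abel

omit hS in
lemma integrableOn_rpow_mul_exp_Ioc (hσ₀ : 0 < σ) {z : ℝ} (hz : 0 < z) (N : ℝ) :
    IntegrableOn (fun t : ℝ => t ^ (σ - 1) * Real.exp (-(z / t))) (Ioc 0 N) := by
  refine Integrable.mono' (integrableOn_Ioc_rpow (a := σ - 1) (by linarith) N)
    (by fun_prop) ((ae_restrict_mem measurableSet_Ioc).mono fun t ht => ?_)
  have ht0 : 0 < t := ht.1
  have : 0 < z / t := div_pos hz ht0
  rw [Real.norm_of_nonneg (by positivity)]
  exact mul_le_of_le_one_right (by positivity) (Real.exp_le_one_iff.2 (by linarith))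

lemma integrableOn_ext_integrand (hσ₀ : 0 < σ) {z : ℝ} (hz : 0 < z) (w : X) (N : ℝ) :
    IntegrableOn (fun t => (t ^ (σ - 1) * Real.exp (-(z / t))) • S t w) (Ioc 0 N) := by
  refine Integrable.mono' ((integrableOn_rpow_mul_exp_Ioc hσ₀ hz N).mul_const (M * ‖w‖))
    ((integrableOn_rpow_mul_exp_Ioc hσ₀ hz N).aestronglyMeasurable.smul (((hS.continuousOn_apply w).mono
      Ioc_subset_Ioi_self).aestronglyMeasurable measurableSet_Ioc))
    ((ae_restrict_mem measurableSet_Ioc).mono fun t ht => ?_)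
  have ht0 : 0 < t := ht.1
  rw [norm_smul, Real.norm_of_nonneg (by positivity)]
  gcongr
  exact hS.norm_apply_le ht0 w

/-- The truncated extension as an average of truncated fractional integrals. It rests on
`Γ(σ) s^{σ-1} e^{-z/s} = ∫_{z/s}^∞ e^{-r} (s r - z)^{σ-1} dr` and Fubini's theorem. -/
lemma integral_ext_eq [CompleteSpace X] (hσ₀ : 0 < σ) {z : ℝ} (hz : 0 < z) (w : X) (N : ℝ) :
    IntegrableOn (fun r => (Real.exp (-r) * r ^ (σ - 1)) • S (z / r) (fracInt S σ w (N - z / r)))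
      (Ioi 0) ∧
    ∫ t in Ioc 0 N, (t ^ (σ - 1) * Real.exp (-(z / t))) • S t w =
      ∫ r in Ioi (0 : ℝ), (Real.exp (-r) * r ^ (σ - 1)) • S (z / r) (fracInt S σ w (N - z / r)) := by
  have hg := Real.Gamma_pos_of_pos hσ₀
  -- for fixed `r` the kernel is `e^{-r} r^{σ-1} (s - z/r)^{σ-1}`, so that integrating it against
  -- `S(s) w` gives `S(z/r)` applied to a fractional integral up to `N - z/r`
  let k : ℝ → ℝ → ℝ := fun r s => if z < s * r then Real.exp (-r) * (s * r - z) ^ (σ - 1) else 0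
  have hk : Measurable (Function.uncurry k) := by
    refine Measurable.ite ?_ (by fun_prop) measurable_const
    exact measurableSet_lt measurable_const (by fun_prop)
  have hk0 : ∀ r s, 0 ≤ k r s := by
    intro r s
    simp only [k]
    split_ifs with h
    · have := sub_pos.2 h
      positivity
    · exact le_rfl
  have hks : ∀ s ∈ Ioc 0 N, IntegrableOn (fun r => k r s) (Ioi 0) ∧
      ∫ r in Ioi (0 : ℝ), k r s = Real.Gamma σ * (s ^ (σ - 1) * Real.exp (-(z / s))) := by
    intro s hs
    have hs0 : 0 < s := hs.1
    obtain ⟨h1, h2⟩ := integral_exp_mul_rpow_sub (z := z) hσ₀ hs0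
    have e1 : ∀ r ∈ Ioi (z / s), k r s = Real.exp (-r) * (s * r - z) ^ (σ - 1) := fun r hr =>
      if_pos ((div_lt_iff₀' hs0).1 hr)
    have e2 : ∀ r ∉ Ioi (z / s), k r s = 0 := fun r hr =>
      if_neg fun h => hr ((div_lt_iff₀' hs0).2 h)
    have h3 : Ioi (z / s) ⊆ Ioi 0 := Ioi_subset_Ioi (div_pos hz hs0).le
    refine ⟨((integrableOn_congr_fun e1 measurableSet_Ioi).2 h1).of_forall_sdiff_eq_zero
      measurableSet_Ioi fun r hr => e2 r hr.2, ?_⟩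
    rw [setIntegral_eq_of_subset_of_forall_sdiff_eq_zero measurableSet_Ioi h3
      fun r hr => e2 r hr.2, setIntegral_congr_fun measurableSet_Ioi e1, h2]
  have hsw := integral_kernel_swap (μ := volume.restrict (Ioi 0))
    (ν := volume.restrict (Ioc 0 N)) hk hk0
    ((ae_restrict_mem measurableSet_Ioc).mono fun s hs => (hks s hs).1)
    ((integrableOn_congr_fun (fun s hs => (hks s hs).2) measurableSet_Ioc).2
      ((integrableOn_rpow_mul_exp_Ioc hσ₀ hz N).const_mul _))
    (((hS.continuousOn_apply w).mono Ioc_subset_Ioi_self).aestronglyMeasurable measurableSet_Ioc)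
    ((ae_restrict_mem measurableSet_Ioc).mono fun s hs => hS.norm_apply_le hs.1 w)
  have hin : ∀ r ∈ Ioi (0 : ℝ), ∫ s in Ioc 0 N, k r s • S s w = Real.Gamma σ •
      (Real.exp (-r) * r ^ (σ - 1)) • S (z / r) (fracInt S σ w (N - z / r)) := by
    intro r hr
    have hr0 : 0 < r := hr
    have hzr : 0 < z / r := div_pos hz hr0
    have h3 : Ioc (z / r) N ⊆ Ioc 0 N := Ioc_subset_Ioc_left hzr.le
    rw [setIntegral_eq_of_subset_of_forall_sdiff_eq_zero measurableSet_Ioc h3 fun s hs => by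
      have : ¬ z < s * r := fun h => hs.2 ⟨(div_lt_iff₀ hr0).2 h, hs.1.2⟩
      simp only [k]
      rw [if_neg this, zero_smul]]
    have e1 : ∀ s ∈ Ioc (z / r) N, k r s • S s w =
        (Real.exp (-r) * r ^ (σ - 1)) • (s - z / r) ^ (σ - 1) • S s w := by
      intro s hs
      have h4 : 0 ≤ s - z / r := (sub_pos.2 hs.1).le
      have h5 : s * r - z = r * (s - z / r) := by field_simp
      simp only [k]
      rw [if_pos ((div_lt_iff₀ hr0).1 hs.1), h5, Real.mul_rpow hr0.le h4, smul_smul, mul_assoc]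
    have e2 := setIntegral_Ioc_comp_add (fun s => (s - z / r) ^ (σ - 1) • S s w) (z / r) 0
      (N - z / r)
    rw [add_zero, add_sub_cancel] at e2
    rw [setIntegral_congr_fun measurableSet_Ioc e1, integral_smul, ← e2, fracInt,
      ContinuousLinearMap.map_smul_of_tower, smul_comm (Real.Gamma σ), smul_smul (Real.Gamma σ),
      mul_inv_cancel₀ hg.ne', one_smul]
    congr 1
    refine Eq.trans (setIntegral_congr_fun measurableSet_Ioc fun v hv => ?_)
      (((S (z / r)).restrictScalars ℝ).integral_comp_comm
        (integrableOn_fracInt_integrand hS hσ₀ w (N - z / r)))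
    have hv0 : 0 < v := hv.1
    simp [hS.apply_add hzr hv0]
  have hint : IntegrableOn (fun r => Real.Gamma σ •
      (Real.exp (-r) * r ^ (σ - 1)) • S (z / r) (fracInt S σ w (N - z / r))) (Ioi 0) :=
    (integrableOn_congr_fun hin measurableSet_Ioi).1 hsw.1
  have hint' : IntegrableOn (fun r =>
      (Real.exp (-r) * r ^ (σ - 1)) • S (z / r) (fracInt S σ w (N - z / r))) (Ioi 0) := by
    refine (integrableOn_congr_fun (fun r _ => ?_) measurableSet_Ioi).1
      (hint.smul (Real.Gamma σ)⁻¹)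
    rw [Pi.smul_apply, smul_smul, inv_mul_cancel₀ hg.ne', one_smul]
  refine ⟨hint', smul_right_injective X hg.ne' ?_⟩
  show Real.Gamma σ • _ = Real.Gamma σ • _
  rw [← integral_smul, ← integral_smul]
  have h6 := hsw.2
  rw [setIntegral_congr_fun measurableSet_Ioi hin] at h6
  rw [h6]
  refine setIntegral_congr_fun measurableSet_Ioc fun s hs => ?_
  rw [(hks s hs).2, smul_smul]

/-- The integral defining the extension converges to the Poisson integral of the boundary value. -/
lemma HasFracPow.tendsto_poissonOp [CompleteSpace X] (hσ₀ : 0 < σ) (hσ₁ : σ < 1) {x w : X}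
    (h : HasFracPow S σ x w) (h0 : Tendsto (fun t => S t x) atTop (𝓝 0)) {z : ℝ} (hz : 0 < z) :
    Tendsto (fun N => (Real.Gamma σ)⁻¹ •
      ∫ t in Ioc 0 N, (t ^ (σ - 1) * Real.exp (-(z / t))) • S t w) atTop
      (𝓝 (poissonOp S σ z x)) := by
  rw [poissonOp_apply hS hσ₀ hz]
  refine Tendsto.const_smul ?_ _
  obtain ⟨C, hC⟩ := exists_norm_fracInt_le hS hσ₀ hσ₁ h
  have hM := hS.bound_nonneg
  simp_rw [(integral_ext_eq hS hσ₀ hz w _).2]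
  refine tendsto_integral_filter_of_dominated_convergence
    (fun r => Real.exp (-r) * r ^ (σ - 1) * (M * C))
    (Eventually.of_forall fun N => (integral_ext_eq hS hσ₀ hz w N).1.aestronglyMeasurable)
    (Eventually.of_forall fun N => (ae_restrict_mem measurableSet_Ioi).mono fun r hr => ?_)
    ((Real.GammaIntegral_convergent hσ₀).mul_const _)
    ((ae_restrict_mem measurableSet_Ioi).mono fun r hr => ?_)
  · have hr0 : (0 : ℝ) < r := hr
    rw [norm_smul, Real.norm_of_nonneg (by positivity)]
    gcongr
    refine (hS.norm_apply_le (div_pos hz hr0) _).trans ?_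
    gcongr
    exact hC _
  · refine Tendsto.const_smul (((S (z / r)).continuous.tendsto x).comp
      ((tendsto_fracInt hS hσ₀ hσ₁ h h0).comp ?_)) _
    exact tendsto_atTop_add_const_right _ _ tendsto_id

end Poisson

/-! ### Laplace transforms of bounded functions -/

section Laplace

variable {X : Type*} [NormedAddCommGroup X] [NormedSpace ℂ X] {g : ℝ → X} {B β : ℝ}

/-- The integral `∫_0^∞ ρ^{β-1} e^{-zρ} g(ρ) dρ`, for `Re z > 0`. -/
def laplace (β : ℝ) (g : ℝ → X) (z : ℂ) : X :=
  ∫ ρ in Ioi (0 : ℝ), (((ρ ^ (β - 1) : ℝ) : ℂ) * Complex.exp (-(z * ρ))) • g ρ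

lemma integrableOn_rpow_mul_exp_neg_mul (hβ : 0 < β) {b : ℝ} (hb : 0 < b) :
    IntegrableOn (fun ρ : ℝ => ρ ^ (β - 1) * Real.exp (-(b * ρ))) (Ioi 0) := by
  simpa using integrableOn_rpow_mul_exp_neg_mul_rpow (p := 1) (s := β - 1) (b := b) (by linarith)
    one_pos hb

lemma norm_laplace_integrand {z : ℂ} {ρ : ℝ} (hρ : 0 < ρ) (v : X) :
    ‖(((ρ ^ (β - 1) : ℝ) : ℂ) * Complex.exp (-(z * ρ))) • v‖ =
      ρ ^ (β - 1) * Real.exp (-(z.re * ρ)) * ‖v‖ := by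
  rw [norm_smul, norm_mul, Complex.norm_real, Real.norm_of_nonneg (by positivity),
    Complex.norm_exp]
  simp

lemma aestronglyMeasurable_laplace_integrand (hg : ContinuousOn g (Ioi 0)) (β : ℝ) (z : ℂ) :
    AEStronglyMeasurable (fun ρ : ℝ => (((ρ ^ (β - 1) : ℝ) : ℂ) * Complex.exp (-(z * ρ))) • g ρ)
      (volume.restrict (Ioi 0)) :=
  ((ContinuousOn.mul (Complex.continuous_ofReal.comp_continuousOn (continuousOn_rpow_Ioi _))
    (by fun_prop)).smul hg).aestronglyMeasurable measurableSet_Ioi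

lemma integrableOn_laplace (hβ : 0 < β) (hg : ContinuousOn g (Ioi 0))
    (hB : ∀ ρ, 0 < ρ → ‖g ρ‖ ≤ B) {z : ℂ} (hz : 0 < z.re) :
    IntegrableOn (fun ρ : ℝ => (((ρ ^ (β - 1) : ℝ) : ℂ) * Complex.exp (-(z * ρ))) • g ρ)
      (Ioi 0) := by
  refine Integrable.mono' ((integrableOn_rpow_mul_exp_neg_mul hβ hz).mul_const B)
    (aestronglyMeasurable_laplace_integrand hg β z)
    ((ae_restrict_mem measurableSet_Ioi).mono fun ρ hρ => ?_)
  have hρ0 : (0 : ℝ) < ρ := hρ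
  rw [norm_laplace_integrand hρ0]
  gcongr
  exact hB ρ hρ0

lemma norm_laplace_le (hβ : 0 < β) (hB : ∀ ρ, 0 < ρ → ‖g ρ‖ ≤ B) {z : ℂ} (hz : 0 < z.re) :
    ‖laplace β g z‖ ≤ (1 / z.re) ^ β * Real.Gamma β * B := by
  rw [laplace, ← Real.integral_rpow_mul_exp_neg_mul_Ioi hβ hz, ← integral_mul_const]
  refine norm_integral_le_of_norm_le ((integrableOn_rpow_mul_exp_neg_mul hβ hz).mul_const B)
    ((ae_restrict_mem measurableSet_Ioi).mono fun ρ hρ => ?_)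
  have hρ0 : (0 : ℝ) < ρ := hρ
  rw [norm_laplace_integrand hρ0]
  gcongr
  exact hB ρ hρ0

lemma hasDerivAt_laplace (hβ : 0 < β) (hg : ContinuousOn g (Ioi 0))
    (hB : ∀ ρ, 0 < ρ → ‖g ρ‖ ≤ B) {z : ℂ} (hz : 0 < z.re) :
    HasDerivAt (laplace β g) (-laplace (β + 1) g z) z := by
  have hs : Metric.ball z (z.re / 2) ∈ 𝓝 z := Metric.ball_mem_nhds z (by positivity)
  have hre : ∀ v ∈ Metric.ball z (z.re / 2), z.re / 2 < v.re := by
    intro v hv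
    have h1 := (Complex.abs_re_le_norm (v - z)).trans_lt (mem_ball_iff_norm.1 hv)
    rw [Complex.sub_re] at h1
    linarith [(abs_lt.1 h1).1]
  have hz2 : 0 < z.re / 2 := by positivity
  have h := (hasDerivAt_integral_of_dominated_loc_of_deriv_le (μ := volume.restrict (Ioi 0))
    (F := fun (v : ℂ) (ρ : ℝ) => (((ρ ^ (β - 1) : ℝ) : ℂ) * Complex.exp (-(v * ρ))) • g ρ)
    (F' := fun (v : ℂ) (ρ : ℝ) =>
      -((((ρ ^ (β + 1 - 1) : ℝ) : ℂ) * Complex.exp (-(v * ρ))) • g ρ))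
    (bound := fun ρ => ρ ^ (β + 1 - 1) * Real.exp (-(z.re / 2 * ρ)) * B) hs
    (Eventually.of_forall fun v => aestronglyMeasurable_laplace_integrand hg β v)
    (integrableOn_laplace hβ hg hB hz)
    (aestronglyMeasurable_laplace_integrand hg (β + 1) z).neg
    ((ae_restrict_mem measurableSet_Ioi).mono fun ρ hρ v hv => ?_)
    ((integrableOn_rpow_mul_exp_neg_mul (by linarith) hz2).mul_const B)
    ((ae_restrict_mem measurableSet_Ioi).mono fun ρ hρ v hv => ?_)).2
  · rw [integral_neg] at h
    exact h
  · have hρ0 : (0 : ℝ) < ρ := hρ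
    rw [norm_neg, norm_laplace_integrand hρ0]
    have := hre v hv
    gcongr
    exact hB ρ hρ0
  · have hρ0 : (0 : ℝ) < ρ := hρ
    have h1 : HasDerivAt (fun v : ℂ => Complex.exp (-(v * ρ)))
        (Complex.exp (-(v * ρ)) * -(1 * (ρ : ℂ))) v :=
      ((hasDerivAt_id v).mul_const (ρ : ℂ)).neg.cexp
    have h2 := (h1.const_mul ((ρ ^ (β - 1) : ℝ) : ℂ)).smul_const (g ρ)
    convert h2 using 1
    rw [← neg_smul]
    congr 1
    have h3 : ρ ^ (β + 1 - 1) = ρ ^ (β - 1) * ρ := by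
      rw [← Real.rpow_add_one hρ0.ne']
      ring_nf
    rw [h3]
    push_cast
    ring

lemma laplace_ofReal (z : ℝ) :
    laplace β g z = ∫ ρ in Ioi (0 : ℝ), (ρ ^ (β - 1) * Real.exp (-(z * ρ))) • g ρ := by
  refine setIntegral_congr_fun measurableSet_Ioi fun ρ hρ => ?_
  rw [RCLike.real_smul_eq_coe_smul (K := ℂ)]
  congr 1
  simp

lemma integrableOn_laplace_ofReal (hβ : 0 < β) (hg : ContinuousOn g (Ioi 0))
    (hB : ∀ ρ, 0 < ρ → ‖g ρ‖ ≤ B) {z : ℝ} (hz : 0 < z) :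
    IntegrableOn (fun ρ => (ρ ^ (β - 1) * Real.exp (-(z * ρ))) • g ρ) (Ioi 0) := by
  refine (integrableOn_congr_fun (fun ρ hρ => ?_) measurableSet_Ioi).1
    (integrableOn_laplace hβ hg hB (z := (z : ℂ)) (by simpa using hz))
  rw [RCLike.real_smul_eq_coe_smul (K := ℂ)]
  congr 1
  simp

lemma rpow_smul_laplace {z : ℝ} (hz : 0 < z) :
    z ^ β • laplace β g z = ∫ r in Ioi (0 : ℝ), (Real.exp (-r) * r ^ (β - 1)) • g (r / z) := by
  have h := integral_comp_mul_left_Ioi' (fun r : ℝ => (Real.exp (-r) * r ^ (β - 1)) • g (r / z)) 0 hz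
  rw [mul_zero] at h
  rw [laplace_ofReal, ← h, ← integral_smul, ← integral_smul]
  refine setIntegral_congr_fun measurableSet_Ioi fun ρ hρ => ?_
  have hρ0 : (0 : ℝ) < ρ := hρ
  simp only [smul_smul]
  rw [mul_div_cancel_left₀ _ hz.ne', Real.mul_rpow hz.le hρ0.le]
  congr 1
  rw [Real.rpow_sub_one hz.ne']
  field_simp

/-- Abelian asymptotics of the Laplace transform at the origin. -/
lemma tendsto_rpow_smul_laplace [CompleteSpace X] (hβ : 0 < β) (hg : ContinuousOn g (Ioi 0))
    (hB : ∀ ρ, 0 < ρ → ‖g ρ‖ ≤ B) {ℓ : X} (hℓ : Tendsto g atTop (𝓝 ℓ)) :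
    Tendsto (fun z : ℝ => z ^ β • laplace β g z) (𝓝[>] 0) (𝓝 (Real.Gamma β • ℓ)) := by
  have h : Tendsto (fun z : ℝ => ∫ r in Ioi (0 : ℝ), (Real.exp (-r) * r ^ (β - 1)) • g (r / z))
      (𝓝[>] 0) (𝓝 (∫ r in Ioi (0 : ℝ), (Real.exp (-r) * r ^ (β - 1)) • ℓ)) := by
    refine tendsto_integral_filter_of_dominated_convergence
      (fun r => Real.exp (-r) * r ^ (β - 1) * B) ?_ ?_
      ((Real.GammaIntegral_convergent hβ).mul_const _) ?_
    · filter_upwards [self_mem_nhdsWithin] with z hz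
      have hz0 : (0 : ℝ) < z := hz
      have hc : ContinuousOn (fun r : ℝ => Real.exp (-r) * r ^ (β - 1)) (Ioi 0) :=
        continuous_neg.rexp.continuousOn.mul (continuousOn_rpow_Ioi _)
      refine ContinuousOn.aestronglyMeasurable (hc.smul (hg.comp (continuousOn_id.div_const z)
        fun r hr => ?_)) measurableSet_Ioi
      exact div_pos hr hz0
    · filter_upwards [self_mem_nhdsWithin] with z hz
      refine (ae_restrict_mem measurableSet_Ioi).mono fun r hr => ?_
      have hr0 : (0 : ℝ) < r := hr
      rw [norm_smul, Real.norm_of_nonneg (by positivity)]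
      gcongr
      exact hB _ (div_pos hr0 hz)
    · refine (ae_restrict_mem measurableSet_Ioi).mono fun r hr => ?_
      have hr0 : (0 : ℝ) < r := hr
      exact Tendsto.const_smul (hℓ.comp (tendsto_inv_nhdsGT_zero.const_mul_atTop hr0)) _
  rw [integral_smul_const, ← Real.Gamma_eq_integral hβ] at h
  refine h.congr' ?_
  filter_upwards [self_mem_nhdsWithin] with z hz
  rw [rpow_smul_laplace hz]

lemma hasDerivAt_laplace_ofReal (hβ : 0 < β) (hg : ContinuousOn g (Ioi 0))
    (hB : ∀ ρ, 0 < ρ → ‖g ρ‖ ≤ B) {z : ℝ} (hz : 0 < z) :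
    HasDerivAt (fun z : ℝ => laplace β g z) (-laplace (β + 1) g z) z := by
  have h := (hasDerivAt_laplace hβ hg hB (z := (z : ℂ)) (by simpa using hz)).scomp z
    Complex.ofRealCLM.hasDerivAt
  simpa [Function.comp_def] using h

end Laplace

/-! ### Smoothness of the Poisson extension -/

section Smooth

variable {X : Type*} [NormedAddCommGroup X] [NormedSpace ℂ X] [CompleteSpace X]

lemma iteratedDeriv_ofReal {F : ℂ → X} {U : Set ℂ} (hU : IsOpen U) (hF : DifferentiableOn ℂ F U)
    (n : ℕ) : ∀ y : ℝ, (y : ℂ) ∈ U →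
      iteratedDeriv n (fun y : ℝ => F y) y = iteratedDeriv n F (y : ℂ) := by
  induction n with
  | zero => simp
  | succ n ih =>
    intro y hy
    rw [iteratedDeriv_succ, iteratedDeriv_succ]
    have hev : iteratedDeriv n (fun y : ℝ => F y) =ᶠ[𝓝 y] fun y : ℝ => iteratedDeriv n F (y : ℂ) := by
      filter_upwards [(hU.preimage Complex.continuous_ofReal).mem_nhds hy] with r hr using ih r hr
    rw [hev.deriv_eq]
    have hd : DifferentiableAt ℂ (iteratedDeriv n F) (y : ℂ) := by
      rw [iteratedDeriv_eq_iterate]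
      exact ((hF.analyticAt (hU.mem_nhds hy)).iterated_deriv n).differentiableAt
    have h := hd.hasDerivAt.scomp y Complex.ofRealCLM.hasDerivAt
    simpa [Function.comp_def] using h.deriv

/-- The open set of `u` with `Re (u²) > 0`. -/
def squareRegion : Set ℂ := {u | 0 < (u ^ 2 / 4).re}

lemma isOpen_squareRegion : IsOpen squareRegion :=
  isOpen_lt continuous_const (Complex.continuous_re.comp (by fun_prop))

lemma ofReal_mem_squareRegion {y : ℝ} (hy : 0 < y) : (y : ℂ) ∈ squareRegion := by
  have : ((y : ℂ) ^ 2 / 4) = ((y ^ 2 / 4 : ℝ) : ℂ) := by push_cast; rfl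
  rw [squareRegion, mem_ofPred_eq, this, Complex.ofReal_re]
  positivity

/-- The holomorphic continuation `(u²/4)^σ ∫_0^∞ ρ^{σ-1} e^{-u²ρ/4} g(ρ) dρ` of the Poisson
extension in the variable `y`. -/
def complexExt (σ : ℝ) (g : ℝ → X) (u : ℂ) : X :=
  ((u ^ 2 / 4) ^ (σ : ℂ)) • laplace σ g (u ^ 2 / 4)

variable {g : ℝ → X} {B σ : ℝ}

omit [CompleteSpace X] in
lemma complexExt_ofReal {y : ℝ} (hy : 0 < y) :
    complexExt σ g y = (y ^ 2 / 4) ^ σ • laplace σ g ((y ^ 2 / 4 : ℝ) : ℂ) := by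
  have e : ((y : ℂ) ^ 2 / 4) = ((y ^ 2 / 4 : ℝ) : ℂ) := by push_cast; rfl
  rw [complexExt, e, ← Complex.ofReal_cpow (by positivity), Complex.coe_smul]

omit [CompleteSpace X] in
lemma differentiableOn_complexExt (hσ₀ : 0 < σ) (hg : ContinuousOn g (Ioi 0))
    (hB : ∀ ρ, 0 < ρ → ‖g ρ‖ ≤ B) : DifferentiableOn ℂ (complexExt σ g) squareRegion := by
  intro u hu
  have hu' : 0 < (u ^ 2 / 4).re := hu
  have h1 : DifferentiableAt ℂ (fun u : ℂ => u ^ 2 / 4) u := by fun_prop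
  refine DifferentiableAt.differentiableWithinAt (DifferentiableAt.smul ?_ ?_)
  · exact h1.cpow_const (Or.inl hu')
  · exact DifferentiableAt.comp (g := laplace σ g) u
      (hasDerivAt_laplace hσ₀ hg hB hu').differentiableAt h1

omit [CompleteSpace X] in
/-- On the disc of radius `y / 4` around `y > 0` the argument `u² / 4` stays in a sector where
`|u² / 4| ≤ 4 Re (u² / 4)`. -/
lemma norm_complexExt_le (hσ₀ : 0 < σ) (hB : ∀ ρ, 0 < ρ → ‖g ρ‖ ≤ B) {y : ℝ} (hy : 0 < y) {u : ℂ}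
    (hu : ‖u - y‖ ≤ y / 4) :
    u ∈ squareRegion ∧ ‖complexExt σ g u‖ ≤ 4 ^ σ * Real.Gamma σ * B := by
  have hg := Real.Gamma_pos_of_pos hσ₀
  have hB0 : 0 ≤ B := (norm_nonneg _).trans (hB 1 one_pos)
  have h1 := (Complex.abs_re_le_norm (u - y)).trans hu
  have h2 := (Complex.abs_im_le_norm (u - y)).trans hu
  rw [Complex.sub_re, Complex.ofReal_re, abs_le] at h1
  rw [Complex.sub_im, Complex.ofReal_im, sub_zero, abs_le] at h2
  have h3 : (u ^ 2 / 4).re = (u.re ^ 2 - u.im ^ 2) / 4 := by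
    rw [show (4 : ℂ) = ((4 : ℝ) : ℂ) by norm_num, Complex.div_ofReal_re]
    simp [pow_two]
  have h4 : ‖u ^ 2 / 4‖ = (u.re ^ 2 + u.im ^ 2) / 4 := by
    rw [norm_div, norm_pow, Complex.sq_norm, Complex.normSq_apply]
    norm_num
    ring
  have h5 : u.im ^ 2 ≤ (y / 4) ^ 2 := sq_le_sq' (by linarith) h2.2
  have h6 : (3 * y / 4) ^ 2 ≤ u.re ^ 2 := pow_le_pow_left₀ (by positivity) (by linarith) 2
  have hre : 0 < (u ^ 2 / 4).re := by
    rw [h3]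
    nlinarith
  refine ⟨hre, ?_⟩
  have h7 : ‖u ^ 2 / 4‖ * (1 / (u ^ 2 / 4).re) ≤ 4 := by
    rw [mul_one_div, div_le_iff₀ hre, h3, h4]
    nlinarith
  rw [complexExt, norm_smul, Complex.norm_cpow_real]
  calc _ ≤ ‖u ^ 2 / 4‖ ^ σ * ((1 / (u ^ 2 / 4).re) ^ σ * Real.Gamma σ * B) := by
        gcongr
        exact norm_laplace_le hσ₀ hB hre
    _ = (‖u ^ 2 / 4‖ * (1 / (u ^ 2 / 4).re)) ^ σ * (Real.Gamma σ * B) := by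
        rw [Real.mul_rpow (norm_nonneg _) (by positivity)]
        ring
    _ ≤ 4 ^ σ * (Real.Gamma σ * B) := by gcongr
    _ = _ := by ring

/-- Cauchy's estimate on the disc of radius `y / 4`, which lies in the region `Re (u²) > 0`. -/
lemma norm_iteratedDeriv_complexExt_le (hσ₀ : 0 < σ) (hg : ContinuousOn g (Ioi 0))
    (hB : ∀ ρ, 0 < ρ → ‖g ρ‖ ≤ B) (n : ℕ) {y : ℝ} (hy : 0 < y) :
    ‖iteratedDeriv n (fun y : ℝ => complexExt σ g y) y‖ ≤
      n.factorial * (4 ^ σ * Real.Gamma σ * B) / (y / 4) ^ n := by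
  have hd := differentiableOn_complexExt hσ₀ hg hB
  rw [iteratedDeriv_ofReal isOpen_squareRegion hd n y (ofReal_mem_squareRegion hy)]
  have hcl : Metric.closedBall (y : ℂ) (y / 4) ⊆ squareRegion := fun u hu =>
    (norm_complexExt_le hσ₀ hB hy (mem_closedBall_iff_norm.1 hu)).1
  refine Complex.norm_iteratedDeriv_le_of_forall_mem_sphere_norm_le n (by positivity)
    (hd.diffContOnCl_ball hcl) fun u hu => ?_
  exact (norm_complexExt_le hσ₀ hB hy (mem_sphere_iff_norm.1 hu).le).2

lemma contDiffOn_complexExt (hσ₀ : 0 < σ) (hg : ContinuousOn g (Ioi 0))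
    (hB : ∀ ρ, 0 < ρ → ‖g ρ‖ ≤ B) (n : WithTop ℕ∞) :
    ContDiffOn ℝ n (fun y : ℝ => complexExt σ g y) (Ioi 0) :=
  (((differentiableOn_complexExt hσ₀ hg hB).contDiffOn isOpen_squareRegion).restrict_scalars ℝ).comp
    Complex.ofRealCLM.contDiff.contDiffOn fun _ hy => ofReal_mem_squareRegion hy

end Smooth

/-! ### Derivatives of the Poisson integral -/

lemma integral_Ioi_comp_inv {E : Type*} [NormedAddCommGroup E] [NormedSpace ℝ E] (G : ℝ → E) :
    ∫ ρ in Ioi (0 : ℝ), (ρ ^ 2)⁻¹ • G ρ⁻¹ = ∫ t in Ioi (0 : ℝ), G t := by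
  rw [← integral_comp_rpow_Ioi G (neg_ne_zero.2 one_ne_zero)]
  refine setIntegral_congr_fun measurableSet_Ioi fun ρ hρ => ?_
  have hρ0 : (0 : ℝ) < ρ := hρ
  rw [Real.rpow_neg_one, show (-1 - 1 : ℝ) = -((2 : ℕ) : ℝ) by norm_num, Real.rpow_neg hρ0.le,
    Real.rpow_natCast]
  simp

lemma integrableOn_Ioi_comp_inv {E : Type*} [NormedAddCommGroup E] [NormedSpace ℝ E] {G : ℝ → E} :
    IntegrableOn (fun ρ => (ρ ^ 2)⁻¹ • G ρ⁻¹) (Ioi 0) ↔ IntegrableOn G (Ioi 0) := by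
  rw [← integrableOn_Ioi_comp_rpow_iff G (neg_ne_zero.2 one_ne_zero)]
  refine integrableOn_congr_fun (fun ρ hρ => ?_) measurableSet_Ioi
  have hρ0 : (0 : ℝ) < ρ := hρ
  rw [Real.rpow_neg_one, show (-1 - 1 : ℝ) = -((2 : ℕ) : ℝ) by norm_num, Real.rpow_neg hρ0.le,
    Real.rpow_natCast]
  simp

section PoissonDeriv

variable {X : Type*} [NormedAddCommGroup X] [NormedSpace ℂ X] [CompleteSpace X]
  {S A : ℝ → X →L[ℂ] X} {M σ : ℝ}

omit [CompleteSpace X] in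
lemma hasDerivAt_rpow_smul_laplace {g : ℝ → X} {B β : ℝ} (a : ℝ) (hβ : 0 < β)
    (hg : ContinuousOn g (Ioi 0)) (hB : ∀ ρ, 0 < ρ → ‖g ρ‖ ≤ B) {z : ℝ} (hz : 0 < z) :
    HasDerivAt (fun z : ℝ => z ^ a • laplace β g z)
      ((a * z ^ (a - 1)) • laplace β g z - z ^ a • laplace (β + 1) g z) z := by
  have h : HasDerivAt (fun z : ℝ => z ^ a • laplace β g z)
      (z ^ a • -laplace (β + 1) g z + (a * z ^ (a - 1)) • laplace β g z) z :=
    (Real.hasDerivAt_rpow_const (x := z) (p := a) (Or.inl hz.ne')).smul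
      (hasDerivAt_laplace_ofReal hβ hg hB hz)
  convert h using 1
  rw [smul_neg]
  abel

/-- The derivative of `z ↦ poissonOp S σ z x`, in terms of the boundary value `x`. -/
def poissonDeriv (S : ℝ → X →L[ℂ] X) (σ : ℝ) (x : X) (z : ℝ) : X :=
  (Real.Gamma σ)⁻¹ • ((σ * z ^ (σ - 1)) • laplace σ (fun ρ => S ρ⁻¹ x) z -
    z ^ σ • laplace (σ + 1) (fun ρ => S ρ⁻¹ x) z)

/-- The second derivative of `z ↦ poissonOp S σ z x`, in terms of the boundary value `x`. -/
def poissonDeriv₂ (S : ℝ → X →L[ℂ] X) (σ : ℝ) (x : X) (z : ℝ) : X :=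
  (Real.Gamma σ)⁻¹ • (σ • (((σ - 1) * z ^ (σ - 1 - 1)) • laplace σ (fun ρ => S ρ⁻¹ x) z -
      z ^ (σ - 1) • laplace (σ + 1) (fun ρ => S ρ⁻¹ x) z) -
    ((σ * z ^ (σ - 1)) • laplace (σ + 1) (fun ρ => S ρ⁻¹ x) z -
      z ^ σ • laplace (σ + 1 + 1) (fun ρ => S ρ⁻¹ x) z))

variable (hS : IsAnalyticSemigroup S A M)
include hS

omit [CompleteSpace X] in
lemma continuousOn_apply_inv (x : X) : ContinuousOn (fun ρ : ℝ => S ρ⁻¹ x) (Ioi 0) :=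
  (hS.continuousOn_apply x).comp (continuousOn_id.inv₀ fun _ hr => ne_of_gt hr)
    fun _ hr => inv_pos.2 (mem_Ioi.1 hr)

omit [CompleteSpace X] in
lemma norm_apply_inv_le (x : X) : ∀ ρ : ℝ, 0 < ρ → ‖S ρ⁻¹ x‖ ≤ M * ‖x‖ := fun _ hρ =>
  hS.norm_apply_le (inv_pos.2 hρ) x

omit [CompleteSpace X] in
lemma tendsto_apply_inv (x : X) : Tendsto (fun ρ : ℝ => S ρ⁻¹ x) atTop (𝓝 x) :=
  (hS.tendsto_zero x).comp tendsto_inv_atTop_nhdsGT_zero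

lemma poissonOp_eq_laplace (hσ₀ : 0 < σ) {z : ℝ} (hz : 0 < z) (x : X) :
    poissonOp S σ z x = (Real.Gamma σ)⁻¹ • z ^ σ • laplace σ (fun ρ => S ρ⁻¹ x) z := by
  rw [poissonOp_apply hS hσ₀ hz, rpow_smul_laplace hz]
  simp only [inv_div]

lemma hasDerivAt_poissonOp (hσ₀ : 0 < σ) {z : ℝ} (hz : 0 < z) (x : X) :
    HasDerivAt (fun z => poissonOp S σ z x) (poissonDeriv S σ x z) z := by
  have h := (hasDerivAt_rpow_smul_laplace σ hσ₀ (continuousOn_apply_inv hS x)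
    (norm_apply_inv_le hS x) hz).const_smul (Real.Gamma σ)⁻¹
  refine h.congr_of_eventuallyEq ?_
  filter_upwards [Ioi_mem_nhds hz] with r hr
  exact poissonOp_eq_laplace hS hσ₀ hr x

omit [CompleteSpace X] in
lemma hasDerivAt_poissonDeriv (hσ₀ : 0 < σ) {z : ℝ} (hz : 0 < z) (x : X) :
    HasDerivAt (poissonDeriv S σ x) (poissonDeriv₂ S σ x z) z := by
  have hc := continuousOn_apply_inv hS x
  have hb := norm_apply_inv_le hS x
  have h := (((hasDerivAt_rpow_smul_laplace (σ - 1) hσ₀ hc hb hz).const_smul σ).sub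
    (hasDerivAt_rpow_smul_laplace σ (by linarith : 0 < σ + 1) hc hb hz)).const_smul
      (Real.Gamma σ)⁻¹
  refine h.congr_of_eventuallyEq (Eventually.of_forall fun r => ?_)
  simp [poissonDeriv, smul_smul]

omit [CompleteSpace X] hS in
/-- The terms with `laplace σ` cancel in `(1 - σ) φ' + z φ''`. -/
lemma poissonDeriv_combination {z : ℝ} (hz : 0 < z) (x : X) :
    (1 - σ) • poissonDeriv S σ x z + z • poissonDeriv₂ S σ x z = (Real.Gamma σ)⁻¹ • z ^ σ •
      (z • laplace (σ + 1 + 1) (fun ρ => S ρ⁻¹ x) z -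
        (σ + 1) • laplace (σ + 1) (fun ρ => S ρ⁻¹ x) z) := by
  simp only [poissonDeriv, poissonDeriv₂, Real.rpow_sub_one hz.ne']
  have hz' := hz.ne'
  match_scalars <;> field_simp <;> ring

/-- Integration by parts for the Laplace integral of `A(1/ρ) x`, that is for `T` applied to the Laplace
integral of `S(1/ρ) x`. -/
lemma laplace_deriv_eq (hσ₀ : 0 < σ) {z : ℝ} (hz : 0 < z) (x : X) :
    IntegrableOn (fun ρ => (ρ ^ (σ - 1) * Real.exp (-(z * ρ))) • A ρ⁻¹ x) (Ioi 0) ∧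
    ∫ ρ in Ioi (0 : ℝ), (ρ ^ (σ - 1) * Real.exp (-(z * ρ))) • A ρ⁻¹ x =
      z • laplace (σ + 1 + 1) (fun ρ => S ρ⁻¹ x) z -
        (σ + 1) • laplace (σ + 1) (fun ρ => S ρ⁻¹ x) z := by
  have hc := continuousOn_apply_inv hS x
  have hb := norm_apply_inv_le hS x
  have hM := hS.bound_nonneg
  have hint : ∀ β : ℝ, 0 < β →
      IntegrableOn (fun ρ => (ρ ^ (β - 1) * Real.exp (-(z * ρ))) • S ρ⁻¹ x) (Ioi 0) := fun β hβ =>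
    integrableOn_laplace_ofReal hβ hc hb hz
  have hA : IntegrableOn (fun ρ => (ρ ^ (σ - 1) * Real.exp (-(z * ρ))) • A ρ⁻¹ x) (Ioi 0) := by
    refine Integrable.mono' ((integrableOn_rpow_mul_exp_neg_mul (β := σ + 1) (by linarith)
      hz).mul_const (M * ‖x‖)) (ContinuousOn.aestronglyMeasurable ?_ measurableSet_Ioi)
      ((ae_restrict_mem measurableSet_Ioi).mono fun ρ hρ => ?_)
    · refine ((continuousOn_rpow_Ioi _).mul (by fun_prop)).smul
        ((hS.continuousOn_deriv_apply x).comp (continuousOn_id.inv₀ fun _ hr => ne_of_gt hr)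
          fun _ hr => inv_pos.2 (mem_Ioi.1 hr))
    · have hρ0 : (0 : ℝ) < ρ := hρ
      rw [norm_smul, Real.norm_of_nonneg (by positivity)]
      have h1 := hS.norm_deriv_apply_le (inv_pos.2 hρ0) x
      rw [inv_inv] at h1
      have h2 : ρ ^ (σ + 1 - 1) = ρ ^ (σ - 1) * ρ := by
        rw [← Real.rpow_add_one hρ0.ne']
        ring_nf
      calc _ ≤ ρ ^ (σ - 1) * Real.exp (-(z * ρ)) * (M * ‖x‖ * ρ) := by gcongr
        _ = _ := by rw [h2]; ring
  refine ⟨hA, ?_⟩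
  -- `f` vanishes at `0` and at infinity, and `(d/dρ) S(1/ρ) x = ρ⁻² A(1/ρ) x`
  let f : ℝ → X := fun ρ => (ρ ^ (σ + 1) * Real.exp (-(z * ρ))) • S ρ⁻¹ x
  let f' : ℝ → X := fun ρ => (σ + 1) • ((ρ ^ (σ + 1 - 1) * Real.exp (-(z * ρ))) • S ρ⁻¹ x) -
    z • ((ρ ^ (σ + 1 + 1 - 1) * Real.exp (-(z * ρ))) • S ρ⁻¹ x) +
    (ρ ^ (σ - 1) * Real.exp (-(z * ρ))) • A ρ⁻¹ x
  have hf' : ∀ ρ ∈ Ioi (0 : ℝ), HasDerivAt f (f' ρ) ρ := by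
    intro ρ hρ
    have hρ0 : (0 : ℝ) < ρ := hρ
    have h1 : HasDerivAt (fun ρ : ℝ => Real.exp (-(z * ρ))) (Real.exp (-(z * ρ)) * -(z * 1)) ρ :=
      ((hasDerivAt_id ρ).const_mul z).neg.exp
    have h2 : HasDerivAt (fun ρ : ℝ => S ρ⁻¹ x) (-(ρ ^ 2)⁻¹ • -A ρ⁻¹ x) ρ :=
      (hS.hasDerivAt_apply (inv_pos.2 hρ0) x).scomp ρ (hasDerivAt_inv hρ0.ne')
    have h3 : HasDerivAt f ((ρ ^ (σ + 1) * Real.exp (-(z * ρ))) • -(ρ ^ 2)⁻¹ • -A ρ⁻¹ x +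
        ((σ + 1) * ρ ^ (σ + 1 - 1) * Real.exp (-(z * ρ)) +
          ρ ^ (σ + 1) * (Real.exp (-(z * ρ)) * -(z * 1))) • S ρ⁻¹ x) ρ :=
      ((Real.hasDerivAt_rpow_const (x := ρ) (p := σ + 1) (Or.inl hρ0.ne')).mul h1).smul h2
    convert h3 using 1
    simp only [f']
    have e1 : ρ ^ (σ + 1 - 1) = ρ ^ (σ - 1) * ρ := by
      rw [← Real.rpow_add_one hρ0.ne']
      ring_nf
    have e2 : ρ ^ (σ + 1 + 1 - 1) = ρ ^ (σ - 1) * ρ * ρ := by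
      rw [← Real.rpow_add_one hρ0.ne', ← Real.rpow_add_one hρ0.ne']
      ring_nf
    have e3 : ρ ^ (σ + 1) = ρ ^ (σ - 1) * ρ * ρ := by
      rw [← Real.rpow_add_one hρ0.ne', ← Real.rpow_add_one hρ0.ne']
      ring_nf
    rw [e1, e2, e3]
    match_scalars <;> field_simp
    ring
  have hint1 := (hint (σ + 1) (by linarith)).smul (σ + 1)
  have hint2 := (hint (σ + 1 + 1) (by linarith)).smul z
  have hfint : IntegrableOn f' (Ioi 0) := (hint1.sub hint2).add hA
  have hfn : ∀ ρ : ℝ, 0 < ρ → ‖f ρ‖ ≤ ρ ^ (σ + 1) * Real.exp (-z * ρ) * (M * ‖x‖) := by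
    intro ρ hρ
    simp only [f]
    rw [norm_smul, Real.norm_of_nonneg (by positivity), neg_mul]
    gcongr
    exact hb ρ hρ
  have hf0 : f 0 = 0 := by
    simp only [f]
    rw [Real.zero_rpow (by linarith), zero_mul, zero_smul]
  have hcont : ContinuousWithinAt f (Ici 0) 0 := by
    rw [ContinuousWithinAt, hf0]
    have h1 : Tendsto (fun ρ : ℝ => ρ ^ (σ + 1) * Real.exp (-z * ρ) * (M * ‖x‖)) (𝓝 0) (𝓝 0) := by
      have h2 : Continuous fun ρ : ℝ => ρ ^ (σ + 1) * Real.exp (-z * ρ) * (M * ‖x‖) :=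
        ((Real.continuous_rpow_const (by linarith)).mul (by fun_prop)).mul continuous_const
      have h3 := h2.tendsto 0
      rwa [Real.zero_rpow (by linarith), zero_mul, zero_mul] at h3
    refine squeeze_zero_norm' ?_ (h1.mono_left nhdsWithin_le_nhds)
    filter_upwards [self_mem_nhdsWithin] with ρ hρ
    rcases (mem_Ici.1 hρ).eq_or_lt with h | h
    · rw [← h, hf0, Real.zero_rpow (by linarith)]
      simp
    · exact hfn ρ h
  have hlim : Tendsto f atTop (𝓝 0) := by
    have h1 := (tendsto_rpow_mul_exp_neg_mul_atTop_nhds_zero (σ + 1) z hz).mul_const (M * ‖x‖)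
    rw [zero_mul] at h1
    refine squeeze_zero_norm' ?_ h1
    filter_upwards [eventually_gt_atTop 0] with ρ hρ using hfn ρ hρ
  have h := integral_Ioi_of_hasDerivAt_of_tendsto hcont hf' hfint hlim
  rw [hf0, sub_zero] at h
  have h' : ∫ ρ in Ioi (0 : ℝ), f' ρ = (σ + 1) • laplace (σ + 1) (fun ρ => S ρ⁻¹ x) z -
      z • laplace (σ + 1 + 1) (fun ρ => S ρ⁻¹ x) z +
      ∫ ρ in Ioi (0 : ℝ), (ρ ^ (σ - 1) * Real.exp (-(z * ρ))) • A ρ⁻¹ x := by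
    rw [laplace_ofReal, laplace_ofReal, ← integral_smul, ← integral_smul, ← integral_sub,
      ← integral_add]
    exacts [hint1.sub hint2, hA, hint1, hint2]
  rw [h] at h'
  rw [eq_comm, add_eq_zero_iff_eq_neg'] at h'
  rw [h']
  abel

/-- `T φ(z) = (1 - σ) φ'(z) + z φ''(z)` for `φ(z) = poissonOp S σ z x`, expressed through an operator
`R` that plays the role of `(-1 - T)⁻¹`. -/
lemma resolvent_poissonOp (hσ₀ : 0 < σ) {z : ℝ} (hz : 0 < z) (x : X) {R : X →L[ℂ] X}
    (hR : ∀ t : ℝ, 0 < t → ∀ v, R (S t v + A t v) = -S t v) :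
    R (-poissonOp S σ z x - ((1 - σ) • poissonDeriv S σ x z + z • poissonDeriv₂ S σ x z)) =
      poissonOp S σ z x := by
  obtain ⟨h1, h2⟩ := laplace_deriv_eq hS hσ₀ hz x
  have hc := continuousOn_apply_inv hS x
  have hb := norm_apply_inv_le hS x
  have h3 := integrableOn_laplace_ofReal hσ₀ hc hb hz
  have h4 : R (∫ ρ in Ioi (0 : ℝ), ((ρ ^ (σ - 1) * Real.exp (-(z * ρ))) • S ρ⁻¹ x +
      (ρ ^ (σ - 1) * Real.exp (-(z * ρ))) • A ρ⁻¹ x)) =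
      -∫ ρ in Ioi (0 : ℝ), (ρ ^ (σ - 1) * Real.exp (-(z * ρ))) • S ρ⁻¹ x := by
    rw [← integral_neg]
    refine ((R.restrictScalars ℝ).integral_comp_comm (h3.add h1)).symm.trans
      (setIntegral_congr_fun measurableSet_Ioi fun ρ hρ => ?_)
    have h5 := hR ρ⁻¹ (inv_pos.2 (mem_Ioi.1 hρ)) x
    simp only [Pi.add_apply, ContinuousLinearMap.coe_restrictScalars']
    rw [← smul_add, ContinuousLinearMap.map_smul_of_tower, h5, smul_neg]
  rw [poissonDeriv_combination hz, ← h2, poissonOp_eq_laplace hS hσ₀ hz, laplace_ofReal,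
    ← neg_add', ← smul_add, ← smul_add, ← integral_add h3 h1, map_neg,
    ContinuousLinearMap.map_smul_of_tower, ContinuousLinearMap.map_smul_of_tower, h4, smul_neg,
    smul_neg, neg_neg]

end PoissonDeriv

/-! ### The Poisson integral in terms of the fractional derivative -/

section PoissonLimits

variable {X : Type*} [NormedAddCommGroup X] [NormedSpace ℂ X] [CompleteSpace X]
  {S A : ℝ → X →L[ℂ] X} {M σ : ℝ}

lemma integrableOn_rpow_mul_exp_sub_one (hσ₀ : 0 < σ) (hσ₁ : σ < 1) {z : ℝ} (hz : 0 < z) :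
    IntegrableOn (fun ρ : ℝ => (ρ ^ (1 + σ))⁻¹ * (Real.exp (-(z * ρ)) - 1)) (Ioi 0) := by
  have h := (integral_rpow_mul_exp_neg_sub_one hσ₀ hσ₁).1
  rw [← mul_zero z, ← integrableOn_Ioi_comp_mul_left_iff _ _ hz] at h
  refine (integrableOn_congr_fun (fun ρ hρ => ?_) measurableSet_Ioi).1 (h.const_mul (z ^ (1 + σ)))
  have hρ0 : (0 : ℝ) < ρ := hρ
  rw [Real.mul_rpow hz.le hρ0.le]
  field_simp

section

variable {g : ℝ → X} {B : ℝ}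

omit [CompleteSpace X] in
lemma integrableOn_exp_sub_one_smul (hσ₀ : 0 < σ) (hσ₁ : σ < 1) (hg : ContinuousOn g (Ioi 0))
    (hB : ∀ ρ, 0 < ρ → ‖g ρ‖ ≤ B) {z : ℝ} (hz : 0 < z) :
    IntegrableOn (fun ρ : ℝ => ((ρ ^ (1 + σ))⁻¹ * (Real.exp (-(z * ρ)) - 1)) • g ρ) (Ioi 0) := by
  have h := integrableOn_rpow_mul_exp_sub_one hσ₀ hσ₁ hz
  refine Integrable.mono' (h.norm.mul_const B)
    (h.aestronglyMeasurable.smul (hg.aestronglyMeasurable measurableSet_Ioi))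
    ((ae_restrict_mem measurableSet_Ioi).mono fun ρ hρ => ?_)
  rw [norm_smul]
  gcongr
  exact hB ρ hρ

omit [CompleteSpace X] in
lemma hasDerivAt_exp_sub_one_smul (hσ₀ : 0 < σ) (hσ₁ : σ < 1) (hg : ContinuousOn g (Ioi 0))
    (hB : ∀ ρ, 0 < ρ → ‖g ρ‖ ≤ B) {z : ℝ} (hz : 0 < z) :
    HasDerivAt (fun z : ℝ => ∫ ρ in Ioi (0 : ℝ),
      ((ρ ^ (1 + σ))⁻¹ * (Real.exp (-(z * ρ)) - 1)) • g ρ) (-laplace (1 - σ) g z) z := by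
  have hs : Ioi (z / 2) ∈ 𝓝 z := Ioi_mem_nhds (by linarith)
  have hz2 : 0 < z / 2 := by positivity
  have hm : ∀ᶠ v : ℝ in 𝓝 z, AEStronglyMeasurable
      (fun ρ : ℝ => ((ρ ^ (1 + σ))⁻¹ * (Real.exp (-(v * ρ)) - 1)) • g ρ)
      (volume.restrict (Ioi 0)) := by
    filter_upwards [Ioi_mem_nhds hz] with v hv
    exact (integrableOn_exp_sub_one_smul hσ₀ hσ₁ hg hB hv).aestronglyMeasurable
  have h := (hasDerivAt_integral_of_dominated_loc_of_deriv_le (μ := volume.restrict (Ioi 0))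
    (F := fun (v : ℝ) (ρ : ℝ) => ((ρ ^ (1 + σ))⁻¹ * (Real.exp (-(v * ρ)) - 1)) • g ρ)
    (F' := fun (v : ℝ) (ρ : ℝ) => -((ρ ^ (1 - σ - 1) * Real.exp (-(v * ρ))) • g ρ))
    (bound := fun ρ => ρ ^ (1 - σ - 1) * Real.exp (-(z / 2 * ρ)) * B) hs hm
    (integrableOn_exp_sub_one_smul hσ₀ hσ₁ hg hB hz)
    (integrableOn_laplace_ofReal (β := 1 - σ) (by linarith) hg hB hz).aestronglyMeasurable.neg
    ((ae_restrict_mem measurableSet_Ioi).mono fun ρ hρ v hv => ?_)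
    ((integrableOn_rpow_mul_exp_neg_mul (by linarith) hz2).mul_const B)
    ((ae_restrict_mem measurableSet_Ioi).mono fun ρ hρ v hv => ?_)).2
  · rw [integral_neg, ← laplace_ofReal] at h
    exact h
  · have hρ0 : (0 : ℝ) < ρ := hρ
    rw [norm_neg, norm_smul, Real.norm_of_nonneg (by positivity)]
    have hv' : z / 2 < v := hv
    gcongr
    exact hB ρ hρ0
  · have hρ0 : (0 : ℝ) < ρ := hρ
    have h1 : HasDerivAt (fun v : ℝ => Real.exp (-(v * ρ)))
        (Real.exp (-(v * ρ)) * -(1 * ρ)) v := ((hasDerivAt_id v).mul_const ρ).neg.exp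
    have h2 := ((h1.sub_const 1).const_mul (ρ ^ (1 + σ))⁻¹).smul_const (g ρ)
    convert h2 using 1
    rw [← neg_smul]
    congr 1
    have h3 : ρ ^ (1 - σ - 1) = (ρ ^ (1 + σ))⁻¹ * ρ := by
      rw [← Real.rpow_neg hρ0.le, ← Real.rpow_add_one hρ0.ne']
      ring_nf
    rw [h3]
    ring

lemma tendsto_exp_sub_one_smul (hσ₀ : 0 < σ) (hσ₁ : σ < 1) (hg : ContinuousOn g (Ioi 0))
    (hB : ∀ ρ, 0 < ρ → ‖g ρ‖ ≤ B) {ℓ : X} (hℓ : Tendsto g atTop (𝓝 ℓ)) :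
    Tendsto (fun z : ℝ => (z ^ σ)⁻¹ • ∫ ρ in Ioi (0 : ℝ),
      ((ρ ^ (1 + σ))⁻¹ * (Real.exp (-(z * ρ)) - 1)) • g ρ) (𝓝[>] 0)
      (𝓝 (Real.Gamma (-σ) • ℓ)) := by
  obtain ⟨hi, he⟩ := integral_rpow_mul_exp_neg_sub_one hσ₀ hσ₁
  have h : Tendsto (fun z : ℝ => ∫ r in Ioi (0 : ℝ),
      ((r ^ (1 + σ))⁻¹ * (Real.exp (-r) - 1)) • g (r / z)) (𝓝[>] 0)
      (𝓝 (∫ r in Ioi (0 : ℝ), ((r ^ (1 + σ))⁻¹ * (Real.exp (-r) - 1)) • ℓ)) := by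
    refine tendsto_integral_filter_of_dominated_convergence
      (fun r => ‖(r ^ (1 + σ))⁻¹ * (Real.exp (-r) - 1)‖ * B) ?_ ?_ (hi.norm.mul_const _) ?_
    · filter_upwards [self_mem_nhdsWithin] with z hz
      have hz0 : (0 : ℝ) < z := hz
      have hgz : ContinuousOn (fun r => g (r / z)) (Ioi 0) :=
        hg.comp (continuousOn_id.div_const z) fun r hr => div_pos (mem_Ioi.1 hr) hz0
      exact hi.aestronglyMeasurable.smul (hgz.aestronglyMeasurable measurableSet_Ioi)
    · filter_upwards [self_mem_nhdsWithin] with z hz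
      refine (ae_restrict_mem measurableSet_Ioi).mono fun r hr => ?_
      rw [norm_smul]
      gcongr
      exact hB _ (div_pos hr hz)
    · refine (ae_restrict_mem measurableSet_Ioi).mono fun r hr => ?_
      have hr0 : (0 : ℝ) < r := hr
      exact Tendsto.const_smul (hℓ.comp (tendsto_inv_nhdsGT_zero.const_mul_atTop hr0)) _
  rw [integral_smul_const, he] at h
  refine h.congr' ?_
  filter_upwards [self_mem_nhdsWithin] with z hz
  have hz0 : (0 : ℝ) < z := hz
  have h' := integral_comp_mul_left_Ioi'
    (fun r : ℝ => ((r ^ (1 + σ))⁻¹ * (Real.exp (-r) - 1)) • g (r / z)) 0 hz0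
  rw [mul_zero] at h'
  rw [← h', ← integral_smul, ← integral_smul]
  refine setIntegral_congr_fun measurableSet_Ioi fun ρ hρ => ?_
  have hρ0 : (0 : ℝ) < ρ := hρ
  simp only [smul_smul]
  rw [mul_div_cancel_left₀ _ hz0.ne', Real.mul_rpow hz0.le hρ0.le, Real.rpow_add hz0, Real.rpow_one]
  congr 1
  field_simp

end

variable (hS : IsAnalyticSemigroup S A M)
include hS

/-- The increment of the extension in terms of `w = T^σ x`. -/
lemma HasFracPow.poissonOp_sub_self (hσ₀ : 0 < σ) (hσ₁ : σ < 1) {x w : X}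
    (h : HasFracPow S σ x w) (h0 : Tendsto (fun t => S t x) atTop (𝓝 0)) {z : ℝ} (hz : 0 < z) :
    poissonOp S σ z x - x = (Real.Gamma σ)⁻¹ • ∫ ρ in Ioi (0 : ℝ),
      ((ρ ^ (1 + σ))⁻¹ * (Real.exp (-(z * ρ)) - 1)) • S ρ⁻¹ w := by
  -- subtract `Γ(σ)⁻¹ ∫_0^N t^{σ-1} S(t) w dt → x` and substitute `t = 1/ρ`
  let G : ℝ → X := fun t => (t ^ (σ - 1) * Real.exp (-(z / t)) - t ^ (σ - 1)) • S t w
  have e : ∀ ρ ∈ Ioi (0 : ℝ), (ρ ^ 2)⁻¹ • G ρ⁻¹ =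
      ((ρ ^ (1 + σ))⁻¹ * (Real.exp (-(z * ρ)) - 1)) • S ρ⁻¹ w := by
    intro ρ hρ
    have hρ0 : (0 : ℝ) < ρ := hρ
    simp only [G]
    rw [smul_smul, Real.inv_rpow hρ0.le, Real.rpow_sub_one hρ0.ne', Real.rpow_add hρ0,
      Real.rpow_one, div_inv_eq_mul]
    congr 1
    field_simp
  have hi := integrableOn_exp_sub_one_smul hσ₀ hσ₁ (continuousOn_apply_inv hS w)
    (norm_apply_inv_le hS w) hz
  rw [← integrableOn_congr_fun e measurableSet_Ioi, integrableOn_Ioi_comp_inv] at hi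
  rw [← setIntegral_congr_fun measurableSet_Ioi e, integral_Ioi_comp_inv]
  have h1 := (h.tendsto_poissonOp hS hσ₀ hσ₁ h0 hz).sub (tendsto_fracInt hS hσ₀ hσ₁ h h0)
  have h2 : Tendsto (fun N => (Real.Gamma σ)⁻¹ • ∫ t in Ioc 0 N, G t) atTop
      (𝓝 ((Real.Gamma σ)⁻¹ • ∫ t in Ioi (0 : ℝ), G t)) := by
    refine Tendsto.const_smul ?_ _
    have hc := (aecover_Iic (μ := volume.restrict (Ioi (0 : ℝ)))
      tendsto_id).integral_tendsto_of_countably_generated hi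
    refine hc.congr fun N => ?_
    rw [Measure.restrict_restrict measurableSet_Iic, inter_comm, Ioi_inter_Iic]
    rfl
  refine tendsto_nhds_unique h1 (h2.congr fun N => ?_)
  rw [fracInt, ← smul_sub, ← integral_sub (integrableOn_ext_integrand hS hσ₀ hz w N)
    (integrableOn_fracInt_integrand hS hσ₀ w N)]
  simp only [G, sub_smul]

lemma HasFracPow.tendsto_poissonOp_sub_self (hσ₀ : 0 < σ) (hσ₁ : σ < 1) {x w : X}
    (h : HasFracPow S σ x w) (h0 : Tendsto (fun t => S t x) atTop (𝓝 0)) :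
    Tendsto (fun z : ℝ => (z ^ σ)⁻¹ • (poissonOp S σ z x - x)) (𝓝[>] 0)
      (𝓝 ((Real.Gamma (-σ) / Real.Gamma σ) • w)) := by
  have h1 := (tendsto_exp_sub_one_smul hσ₀ hσ₁ (continuousOn_apply_inv hS w)
    (norm_apply_inv_le hS w) (tendsto_apply_inv hS w)).const_smul (Real.Gamma σ)⁻¹
  rw [smul_smul, inv_mul_eq_div] at h1
  refine h1.congr' ?_
  filter_upwards [self_mem_nhdsWithin] with z hz
  rw [h.poissonOp_sub_self hS hσ₀ hσ₁ h0 hz, smul_comm]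

lemma HasFracPow.poissonDeriv_eq (hσ₀ : 0 < σ) (hσ₁ : σ < 1) {x w : X}
    (h : HasFracPow S σ x w) (h0 : Tendsto (fun t => S t x) atTop (𝓝 0)) {z : ℝ} (hz : 0 < z) :
    poissonDeriv S σ x z = -((Real.Gamma σ)⁻¹ • laplace (1 - σ) (fun ρ => S ρ⁻¹ w) z) := by
  have h1 := ((hasDerivAt_exp_sub_one_smul hσ₀ hσ₁ (continuousOn_apply_inv hS w)
    (norm_apply_inv_le hS w) hz).const_smul (Real.Gamma σ)⁻¹).add_const x
  rw [smul_neg] at h1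
  refine (hasDerivAt_poissonOp hS hσ₀ hz x).unique (h1.congr_of_eventuallyEq ?_)
  filter_upwards [Ioi_mem_nhds hz] with r hr
  exact sub_eq_iff_eq_add.1 (h.poissonOp_sub_self hS hσ₀ hσ₁ h0 hr)

lemma HasFracPow.poissonDeriv₂_eq (hσ₀ : 0 < σ) (hσ₁ : σ < 1) {x w : X}
    (h : HasFracPow S σ x w) (h0 : Tendsto (fun t => S t x) atTop (𝓝 0)) {z : ℝ} (hz : 0 < z) :
    poissonDeriv₂ S σ x z = (Real.Gamma σ)⁻¹ • laplace (2 - σ) (fun ρ => S ρ⁻¹ w) z := by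
  have h1 := ((hasDerivAt_laplace_ofReal (β := 1 - σ) (by linarith) (continuousOn_apply_inv hS w)
    (norm_apply_inv_le hS w) hz).const_smul (Real.Gamma σ)⁻¹).neg
  rw [smul_neg, neg_neg, show 1 - σ + 1 = 2 - σ by ring] at h1
  refine (hasDerivAt_poissonDeriv hS hσ₀ hz x).unique (h1.congr_of_eventuallyEq ?_)
  filter_upwards [Ioi_mem_nhds hz] with r hr
  exact h.poissonDeriv_eq hS hσ₀ hσ₁ h0 hr

lemma HasFracPow.tendsto_poissonDeriv (hσ₀ : 0 < σ) (hσ₁ : σ < 1) {x w : X}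
    (h : HasFracPow S σ x w) (h0 : Tendsto (fun t => S t x) atTop (𝓝 0)) :
    Tendsto (fun z : ℝ => z ^ (1 - σ) • poissonDeriv S σ x z) (𝓝[>] 0)
      (𝓝 ((σ * Real.Gamma (-σ) / Real.Gamma σ) • w)) := by
  have h1 := (tendsto_rpow_smul_laplace (β := 1 - σ) (by linarith) (continuousOn_apply_inv hS w)
    (norm_apply_inv_le hS w) (tendsto_apply_inv hS w)).const_smul (-(Real.Gamma σ)⁻¹)
  rw [smul_smul, gamma_one_sub hσ₀,
    show -(Real.Gamma σ)⁻¹ * (-σ * Real.Gamma (-σ)) = σ * Real.Gamma (-σ) / Real.Gamma σ by ring]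
    at h1
  refine h1.congr' ?_
  filter_upwards [self_mem_nhdsWithin] with z hz
  rw [h.poissonDeriv_eq hS hσ₀ hσ₁ h0 hz]
  module

lemma HasFracPow.tendsto_poissonDeriv₂ (hσ₀ : 0 < σ) (hσ₁ : σ < 1) {x w : X}
    (h : HasFracPow S σ x w) (h0 : Tendsto (fun t => S t x) atTop (𝓝 0)) :
    Tendsto (fun z : ℝ => z ^ (2 - σ) • poissonDeriv₂ S σ x z) (𝓝[>] 0)
      (𝓝 (((1 - σ) * (-σ * Real.Gamma (-σ)) / Real.Gamma σ) • w)) := by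
  have h1 := (tendsto_rpow_smul_laplace (β := 2 - σ) (by linarith) (continuousOn_apply_inv hS w)
    (norm_apply_inv_le hS w) (tendsto_apply_inv hS w)).const_smul (Real.Gamma σ)⁻¹
  have e : Real.Gamma (2 - σ) = (1 - σ) * (-σ * Real.Gamma (-σ)) := by
    rw [← gamma_one_sub hσ₀, ← Real.Gamma_add_one (by linarith)]
    ring_nf
  rw [smul_smul, e, inv_mul_eq_div] at h1
  refine h1.congr' ?_
  filter_upwards [self_mem_nhdsWithin] with z hz
  rw [h.poissonDeriv₂_eq hS hσ₀ hσ₁ h0 hz, smul_comm]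

end PoissonLimits

/-! ### The extension in the variable `y` -/

section Extension

variable {X : Type*} [NormedAddCommGroup X] [NormedSpace ℂ X] [CompleteSpace X]
  {S A : ℝ → X →L[ℂ] X} {M σ : ℝ} (hS : IsAnalyticSemigroup S A M) {f : ℝ → X} {x w : X}

lemma tendsto_sq_div_four : Tendsto (fun y : ℝ => y ^ 2 / 4) (𝓝[>] 0) (𝓝[>] 0) := by
  refine tendsto_nhdsWithin_iff.2 ⟨?_, ?_⟩
  · have h : Continuous fun y : ℝ => y ^ 2 / 4 := by fun_prop
    have h0 := h.tendsto 0
    simp only [ne_eq, OfNat.ofNat_ne_zero, not_false_eq_true, zero_pow, zero_div] at h0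
    exact h0.mono_left nhdsWithin_le_nhds
  · filter_upwards [self_mem_nhdsWithin] with y hy
    have : (0 : ℝ) < y := hy
    exact mem_Ioi.2 (by positivity)

lemma sq_div_four_rpow {y : ℝ} (hy : 0 < y) (a : ℝ) : (y ^ 2 / 4) ^ a = y ^ (2 * a) / 4 ^ a := by
  rw [Real.div_rpow (by positivity) (by norm_num), Real.rpow_mul hy.le, Real.rpow_two]

lemma hasDerivAt_sq_div_four (y : ℝ) : HasDerivAt (fun y : ℝ => y ^ 2 / 4) (y / 2) y :=
  ((hasDerivAt_pow 2 y).div_const 4).congr_deriv (by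
    push_cast
    rw [pow_one]
    ring)

include hS

lemma integral_poisson_eq (hσ₀ : 0 < σ) {z : ℝ} (hz : 0 < z) (x : X) :
    IntegrableOn (fun t : ℝ => (Real.exp (-(z / t)) / t ^ (1 + σ)) • S t x) (Ioi 0) ∧
    poissonOp S σ z x = (z ^ σ / Real.Gamma σ) •
      ∫ t in Ioi (0 : ℝ), (Real.exp (-(z / t)) / t ^ (1 + σ)) • S t x := by
  have e : ∀ ρ ∈ Ioi (0 : ℝ), (ρ ^ 2)⁻¹ • (Real.exp (-(z / ρ⁻¹)) / ρ⁻¹ ^ (1 + σ)) • S ρ⁻¹ x =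
      (ρ ^ (σ - 1) * Real.exp (-(z * ρ))) • S ρ⁻¹ x := by
    intro ρ hρ
    have hρ0 : (0 : ℝ) < ρ := hρ
    rw [smul_smul, Real.inv_rpow hρ0.le, Real.rpow_sub_one hρ0.ne', Real.rpow_add hρ0,
      Real.rpow_one, div_inv_eq_mul]
    congr 1
    field_simp
  have hi := integrableOn_laplace_ofReal hσ₀ (continuousOn_apply_inv hS x)
    (norm_apply_inv_le hS x) hz
  rw [← integrableOn_congr_fun e measurableSet_Ioi, integrableOn_Ioi_comp_inv
    (G := fun t => (Real.exp (-(z / t)) / t ^ (1 + σ)) • S t x)] at hi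
  refine ⟨hi, ?_⟩
  rw [poissonOp_eq_laplace hS hσ₀ hz, laplace_ofReal, ← setIntegral_congr_fun measurableSet_Ioi e,
    integral_Ioi_comp_inv (fun t => (Real.exp (-(z / t)) / t ^ (1 + σ)) • S t x), smul_smul,
    inv_mul_eq_div]

lemma eqOn_complexExt (hσ₀ : 0 < σ) (hf : ∀ y, 0 < y → f y = poissonOp S σ (y ^ 2 / 4) x) :
    EqOn f (fun y : ℝ => (Real.Gamma σ)⁻¹ • complexExt σ (fun ρ => S ρ⁻¹ x) y) (Ioi 0) := by
  intro y hy
  have hy0 : (0 : ℝ) < y := hy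
  simp only
  rw [hf y hy, poissonOp_eq_laplace hS hσ₀ (by positivity), complexExt_ofReal hy0]

lemma contDiffOn_ext (hσ₀ : 0 < σ) (hf : ∀ y, 0 < y → f y = poissonOp S σ (y ^ 2 / 4) x)
    (n : WithTop ℕ∞) : ContDiffOn ℝ n f (Ioi 0) :=
  ((contDiffOn_complexExt hσ₀ (continuousOn_apply_inv hS x) (norm_apply_inv_le hS x) n).const_smul
    (Real.Gamma σ)⁻¹).congr (eqOn_complexExt hS hσ₀ hf)

lemma norm_iteratedDeriv_ext_le (hσ₀ : 0 < σ)
    (hf : ∀ y, 0 < y → f y = poissonOp S σ (y ^ 2 / 4) x) (n : ℕ) {y : ℝ} (hy : 0 < y) :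
    ‖iteratedDeriv n f y‖ ≤ n.factorial * 4 ^ σ * 4 ^ n * M / y ^ n * ‖x‖ := by
  have hg := Real.Gamma_pos_of_pos hσ₀
  have hc := continuousOn_apply_inv hS x
  have hb := norm_apply_inv_le hS x
  have e := iteratedDeriv_fun_const_smul
    ((contDiffOn_complexExt hσ₀ hc hb n).contDiffAt (Ioi_mem_nhds hy)) (Real.Gamma σ)⁻¹
  rw [((eqOn_complexExt hS hσ₀ hf).eventuallyEq_of_mem (Ioi_mem_nhds hy)).iteratedDeriv_eq n, e,
    norm_smul,
    Real.norm_of_nonneg (by positivity)]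
  calc _ ≤ (Real.Gamma σ)⁻¹ *
        (n.factorial * (4 ^ σ * Real.Gamma σ * (M * ‖x‖)) / (y / 4) ^ n) := by
        gcongr
        exact norm_iteratedDeriv_complexExt_le hσ₀ hc hb n hy
    _ = _ := by
        rw [div_pow]
        field_simp

lemma hasDerivAt_ext (hσ₀ : 0 < σ) (hf : ∀ y, 0 < y → f y = poissonOp S σ (y ^ 2 / 4) x) {y : ℝ}
    (hy : 0 < y) : HasDerivAt f ((y / 2) • poissonDeriv S σ x (y ^ 2 / 4)) y := by
  have h2 := (hasDerivAt_poissonOp hS hσ₀ (by positivity : 0 < y ^ 2 / 4) x).scomp y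
    (hasDerivAt_sq_div_four y)
  refine h2.congr_of_eventuallyEq ?_
  filter_upwards [Ioi_mem_nhds hy] with r hr using hf r hr

lemma iteratedDeriv_two_ext (hσ₀ : 0 < σ) (hf : ∀ y, 0 < y → f y = poissonOp S σ (y ^ 2 / 4) x)
    {y : ℝ} (hy : 0 < y) : iteratedDeriv 2 f y =
      (1 / 2 : ℝ) • poissonDeriv S σ x (y ^ 2 / 4) +
        (y ^ 2 / 4) • poissonDeriv₂ S σ x (y ^ 2 / 4) := by
  have h2 := (hasDerivAt_poissonDeriv hS hσ₀ (by positivity : 0 < y ^ 2 / 4) x).scomp y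
    (hasDerivAt_sq_div_four y)
  have h3 : HasDerivAt (fun y : ℝ => (y / 2) • poissonDeriv S σ x (y ^ 2 / 4))
      ((y / 2) • (y / 2) • poissonDeriv₂ S σ x (y ^ 2 / 4) +
        (1 / 2 : ℝ) • poissonDeriv S σ x (y ^ 2 / 4)) y :=
    ((hasDerivAt_id y).div_const 2).smul h2
  have h4 : deriv f =ᶠ[𝓝 y] fun y : ℝ => (y / 2) • poissonDeriv S σ x (y ^ 2 / 4) := by
    filter_upwards [Ioi_mem_nhds hy] with r hr using (hasDerivAt_ext hS hσ₀ hf hr).deriv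
  have h5 : iteratedDeriv 2 f = deriv (deriv f) := by rw [iteratedDeriv_succ, iteratedDeriv_one]
  rw [h5, h4.deriv_eq, h3.deriv]
  module

lemma tendsto_ext_zero (hσ₀ : 0 < σ) (hf : ∀ y, 0 < y → f y = poissonOp S σ (y ^ 2 / 4) x) :
    Tendsto f (𝓝[>] 0) (𝓝 x) := by
  refine ((tendsto_poissonOp_zero hS hσ₀ x).comp tendsto_sq_div_four).congr' ?_
  filter_upwards [self_mem_nhdsWithin] with y hy using (hf y hy).symm

lemma tendsto_ext_sub (hσ₀ : 0 < σ) (hσ₁ : σ < 1)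
    (hf : ∀ y, 0 < y → f y = poissonOp S σ (y ^ 2 / 4) x) (h : HasFracPow S σ x w)
    (h0 : Tendsto (fun t => S t x) atTop (𝓝 0)) :
    Tendsto (fun y : ℝ => (y ^ (2 * σ))⁻¹ • (f y - x)) (𝓝[>] 0)
      (𝓝 ((Real.Gamma (-σ) / (4 ^ σ * Real.Gamma σ)) • w)) := by
  have h1 := ((h.tendsto_poissonOp_sub_self hS hσ₀ hσ₁ h0).comp tendsto_sq_div_four).const_smul
    ((4 : ℝ) ^ σ)⁻¹
  rw [smul_smul, show ((4 : ℝ) ^ σ)⁻¹ * (Real.Gamma (-σ) / Real.Gamma σ) =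
    Real.Gamma (-σ) / (4 ^ σ * Real.Gamma σ) by field_simp] at h1
  refine h1.congr' ?_
  filter_upwards [self_mem_nhdsWithin] with y hy
  have hy0 : (0 : ℝ) < y := hy
  rw [Function.comp_apply, hf y hy0, sq_div_four_rpow hy0, smul_smul]
  congr 1
  field_simp

lemma tendsto_deriv_ext (hσ₀ : 0 < σ) (hσ₁ : σ < 1)
    (hf : ∀ y, 0 < y → f y = poissonOp S σ (y ^ 2 / 4) x) (h : HasFracPow S σ x w)
    (h0 : Tendsto (fun t => S t x) atTop (𝓝 0)) :
    Tendsto (fun y : ℝ => (1 / (2 * σ) * y ^ (1 - 2 * σ)) • deriv f y) (𝓝[>] 0)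
      (𝓝 ((Real.Gamma (-σ) / (4 ^ σ * Real.Gamma σ)) • w)) := by
  have h4 : (4 : ℝ) ^ (1 - σ) = 4 / 4 ^ σ := by
    rw [Real.rpow_sub (by norm_num), Real.rpow_one]
  have h1 := ((h.tendsto_poissonDeriv hS hσ₀ hσ₁ h0).comp tendsto_sq_div_four).const_smul
    ((4 : ℝ) ^ (1 - σ) / (4 * σ))
  rw [smul_smul, show (4 : ℝ) ^ (1 - σ) / (4 * σ) * (σ * Real.Gamma (-σ) / Real.Gamma σ) =
    Real.Gamma (-σ) / (4 ^ σ * Real.Gamma σ) by rw [h4]; field_simp] at h1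
  refine h1.congr' ?_
  filter_upwards [self_mem_nhdsWithin] with y hy
  have hy0 : (0 : ℝ) < y := hy
  have e : y ^ (2 * (1 - σ)) = y ^ (1 - 2 * σ) * y := by
    rw [← Real.rpow_add_one hy0.ne']
    ring_nf
  rw [Function.comp_apply, (hasDerivAt_ext hS hσ₀ hf hy0).deriv, sq_div_four_rpow hy0, e, smul_smul,
    smul_smul]
  congr 1
  field_simp
  norm_num

lemma tendsto_iteratedDeriv_two_ext (hσ₀ : 0 < σ) (hσ₁ : σ < 1)
    (hf : ∀ y, 0 < y → f y = poissonOp S σ (y ^ 2 / 4) x) (h : HasFracPow S σ x w)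
    (h0 : Tendsto (fun t => S t x) atTop (𝓝 0)) :
    Tendsto (fun y : ℝ => (1 / (2 * σ) * y ^ (2 - 2 * σ)) • iteratedDeriv 2 f y) (𝓝[>] 0)
      (𝓝 (((2 * σ - 1) / 4 ^ σ * (Real.Gamma (-σ) / Real.Gamma σ)) • w)) := by
  have h4 : (4 : ℝ) ^ (1 - σ) = 4 / 4 ^ σ := by
    rw [Real.rpow_sub (by norm_num), Real.rpow_one]
  have h1 := (((h.tendsto_poissonDeriv hS hσ₀ hσ₁ h0).comp tendsto_sq_div_four).const_smul
    ((4 : ℝ) ^ (1 - σ) / (4 * σ))).add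
    (((h.tendsto_poissonDeriv₂ hS hσ₀ hσ₁ h0).comp tendsto_sq_div_four).const_smul
    ((4 : ℝ) ^ (1 - σ) / (2 * σ)))
  rw [smul_smul, smul_smul, ← add_smul,
    show (4 : ℝ) ^ (1 - σ) / (4 * σ) * (σ * Real.Gamma (-σ) / Real.Gamma σ) +
      (4 : ℝ) ^ (1 - σ) / (2 * σ) * ((1 - σ) * (-σ * Real.Gamma (-σ)) / Real.Gamma σ) =
    (2 * σ - 1) / 4 ^ σ * (Real.Gamma (-σ) / Real.Gamma σ) by
      rw [h4]
      have := (Real.Gamma_pos_of_pos hσ₀).ne'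
      field_simp
      ring] at h1
  refine h1.congr' ?_
  filter_upwards [self_mem_nhdsWithin] with y hy
  have hy0 : (0 : ℝ) < y := hy
  have hz : 0 < y ^ 2 / 4 := by positivity
  have e : (y ^ 2 / 4) ^ (2 - σ) = (y ^ 2 / 4) ^ (1 - σ) * (y ^ 2 / 4) := by
    rw [← Real.rpow_add_one hz.ne']
    ring_nf
  have e' : y ^ (2 - 2 * σ) = y ^ (2 * (1 - σ)) := by ring_nf
  rw [Function.comp_apply, Function.comp_apply, iteratedDeriv_two_ext hS hσ₀ hf hy0, e,
    sq_div_four_rpow hy0, e']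
  have : (4 : ℝ) ^ (1 - σ) ≠ 0 := by positivity
  match_scalars <;> field_simp
  norm_num

end Extension

section Sectorial

variable {X : Type*} [NormedAddCommGroup X] [NormedSpace ℂ X] [CompleteSpace X]
  {T : X →ₗ.[ℂ] X} {α σ : ℝ} {x w : X}

omit [CompleteSpace X] in
lemma HasFracPow.fracPow_eq (h : HasFracPow (expNeg T α) σ x w) : fracPow T α σ x = w :=
  Tendsto.limUnder_eq h

omit [CompleteSpace X] in
lemma HasFracPow.mem_fracPowDomain (h : HasFracPow (expNeg T α) σ x w) :
    x ∈ fracPowDomain T α σ := ⟨w, h⟩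

omit [CompleteSpace X] in
lemma hasFracPow_of_mem_fracPowDomain (h : x ∈ fracPowDomain T α σ) :
    HasFracPow (expNeg T α) σ x (fracPow T α σ x) := by
  obtain ⟨w, hw⟩ := h
  have hw' : HasFracPow (expNeg T α) σ x w := hw
  rwa [hw'.fracPow_eq]

omit [CompleteSpace X] in
lemma extIntegrand_eq (y : ℝ) {t : ℝ} (ht : 0 < t) : extIntegrand T α σ x y t =
    (t ^ (σ - 1) * Real.exp (-(y ^ 2 / 4 / t))) • expNeg T α t (fracPow T α σ x) := by
  rw [extIntegrand, ContinuousLinearMap.map_smul_of_tower, smul_smul, div_div,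
    Real.rpow_sub_one ht.ne']
  congr 1
  ring

omit [CompleteSpace X] in
lemma integrableOn_extIntegrand {A : ℝ → X →L[ℂ] X} {M : ℝ}
    (hS : IsAnalyticSemigroup (expNeg T α) A M) (hσ₀ : 0 < σ) {y : ℝ} (hy : 0 < y) (N : ℝ) :
    IntegrableOn (extIntegrand T α σ x y) (Ioc 0 N) :=
  (integrableOn_congr_fun (fun _ ht => extIntegrand_eq y ht.1) measurableSet_Ioc).2
    (integrableOn_ext_integrand hS hσ₀ (by positivity) _ N)

lemma tendsto_extTrunc {A : ℝ → X →L[ℂ] X} {M : ℝ}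
    (hS : IsAnalyticSemigroup (expNeg T α) A M) (hσ₀ : 0 < σ) (hσ₁ : σ < 1)
    (h : x ∈ fracPowDomain T α σ) (h0 : Tendsto (fun t => expNeg T α t x) atTop (𝓝 0)) {y : ℝ}
    (hy : 0 < y) :
    Tendsto (extTrunc T α σ x y) atTop (𝓝 (poissonOp (expNeg T α) σ (y ^ 2 / 4) x)) := by
  refine ((hasFracPow_of_mem_fracPowDomain h).tendsto_poissonOp hS hσ₀ hσ₁ h0
    (by positivity)).congr fun N => ?_
  rw [extTrunc, setIntegral_congr_fun measurableSet_Ioc fun t ht => extIntegrand_eq y ht.1]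

lemma extension_eq {A : ℝ → X →L[ℂ] X} {M : ℝ}
    (hS : IsAnalyticSemigroup (expNeg T α) A M) (hσ₀ : 0 < σ) (hσ₁ : σ < 1)
    (h : x ∈ fracPowDomain T α σ) (h0 : Tendsto (fun t => expNeg T α t x) atTop (𝓝 0)) {y : ℝ}
    (hy : 0 < y) : extension T α σ x y = poissonOp (expNeg T α) σ (y ^ 2 / 4) x := by
  rw [extension, if_pos hy]
  exact (tendsto_extTrunc hS hσ₀ hσ₁ h h0 hy).limUnder_eq

end Sectorial

end SectorialOp

end

theorem theorem2p1 {X : Type*} [NormedAddCommGroup X] [NormedSpace ℂ X] [CompleteSpace X]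
    (T : X →ₗ.[ℂ] X) (ω : ℝ) (hω₀ : 0 ≤ ω) (hω : ω < Real.pi / 2) (hT : IsSectorial T ω)
    (α : ℝ) (hα₀ : ω < α) (hα : α < Real.pi / 2)
    (σ : ℝ) (hσ₀ : 0 < σ) (hσ₁ : σ < 1) :
    (∀ x₀ ∈ fracPowDomain T α σ, x₀ ∈ closure (Set.range fun u : T.domain => T u) →
      -- the integral defining `x(y)` converges
      (∀ y : ℝ, 0 < y →
        (∀ N : ℝ, IntegrableOn (extIntegrand T α σ x₀ y) (Ioc 0 N)) ∧
        Tendsto (extTrunc T α σ x₀ y) atTop (𝓝 (extension T α σ x₀ y))) ∧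
      -- `x` is smooth and solves the initial value problem
      ContDiffOn ℝ ((⊤ : ℕ∞) : WithTop ℕ∞) (extension T α σ x₀) (Ioi 0) ∧
      (∀ y : ℝ, 0 < y → extension T α σ x₀ y ∈ T.domain ∧
        -app T (extension T α σ x₀ y)
          + ((1 - 2 * σ) / y) • deriv (extension T α σ x₀) y
          + iteratedDeriv 2 (extension T α σ x₀) y = 0) ∧
      extension T α σ x₀ 0 = x₀ ∧
      Tendsto (extension T α σ x₀) (𝓝[>] 0) (𝓝 x₀) ∧
      -- the limits at `y = 0`
      Tendsto (fun y : ℝ => (y ^ (2 * σ))⁻¹ • (extension T α σ x₀ y - x₀)) (𝓝[>] 0)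
        (𝓝 ((Real.Gamma (-σ) / (4 ^ σ * Real.Gamma σ)) • fracPow T α σ x₀)) ∧
      Tendsto (fun y : ℝ => (1 / (2 * σ) * y ^ (1 - 2 * σ)) • deriv (extension T α σ x₀) y)
        (𝓝[>] 0) (𝓝 ((Real.Gamma (-σ) / (4 ^ σ * Real.Gamma σ)) • fracPow T α σ x₀)) ∧
      Tendsto
        (fun y : ℝ => (1 / (2 * σ) * y ^ (2 - 2 * σ)) • iteratedDeriv 2 (extension T α σ x₀) y)
        (𝓝[>] 0)
        (𝓝 (((2 * σ - 1) / 4 ^ σ * (Real.Gamma (-σ) / Real.Gamma σ)) • fracPow T α σ x₀)) ∧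
      -- the Poisson formulas
      (∀ y : ℝ, 0 < y →
        (IntegrableOn (fun t : ℝ =>
            (Real.exp (-(y ^ 2 / (4 * t))) / t ^ (1 + σ)) • expNeg T α t x₀) (Ioi 0) ∧
          extension T α σ x₀ y = (y ^ (2 * σ) / (4 ^ σ * Real.Gamma σ)) •
            ∫ t in Ioi (0 : ℝ),
              (Real.exp (-(y ^ 2 / (4 * t))) / t ^ (1 + σ)) • expNeg T α t x₀) ∧
        (IntegrableOn (fun r : ℝ =>
            (Real.exp (-r) / r ^ (1 - σ)) • expNeg T α (y ^ 2 / (4 * r)) x₀) (Ioi 0) ∧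
          extension T α σ x₀ y = (Real.Gamma σ)⁻¹ •
            ∫ r in Ioi (0 : ℝ),
              (Real.exp (-r) / r ^ (1 - σ)) • expNeg T α (y ^ 2 / (4 * r)) x₀)) ∧
      -- the limit of `T x(y)` for `x₀ ∈ D(T)`
      (x₀ ∈ T.domain →
        Tendsto (fun y : ℝ => app T (extension T α σ x₀ y)) (𝓝[>] 0) (𝓝 (app T x₀)))) ∧
    -- the bounds for the derivatives, with a constant independent of `x₀` and `y`
    (∀ n : ℕ, ∃ C : ℝ,
      ∀ x₀ ∈ fracPowDomain T α σ, x₀ ∈ closure (Set.range fun u : T.domain => T u) →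
        ∀ y : ℝ, 0 < y → ‖iteratedDeriv n (extension T α σ x₀) y‖ ≤ C / y ^ n * ‖x₀‖) ∧
    -- the bound for `T^σ x(y)`
    (∃ C : ℝ,
      ∀ x₀ ∈ fracPowDomain T α σ, x₀ ∈ closure (Set.range fun u : T.domain => T u) →
        ∀ y : ℝ, 0 < y → extension T α σ x₀ y ∈ fracPowDomain T α σ ∧
          ‖fracPow T α σ (extension T α σ x₀ y)‖ ≤ C * ‖fracPow T α σ x₀‖) := by
  obtain ⟨A, M, hS, hRA, hRS, hlim⟩ := hT.exists_isAnalyticSemigroup hω₀ hα₀ hα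
  have hres := hT.isResolventAt_neg_one hω₀ hα₀ hα
  have hRA' : ∀ t : ℝ, 0 < t → ∀ v, resolventOp T (-1) (expNeg T α t v + A t v) =
      -expNeg T α t v := fun t ht v => congrArg (fun B : X →L[ℂ] X => B v) (hRA t ht)
  have hRS' : ∀ t : ℝ, 0 < t → ∀ v, resolventOp T (-1) (expNeg T α t v) =
      expNeg T α t (resolventOp T (-1) v) := fun t ht v =>
    congrArg (fun B : X →L[ℂ] X => B v) (hRS t ht)
  refine ⟨fun x₀ hx₀ hx₀' => ?_, fun n => ⟨n.factorial * 4 ^ σ * 4 ^ n * M,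
    fun x₀ hx₀ hx₀' y hy => ?_⟩, M, fun x₀ hx₀ hx₀' y hy => ?_⟩
  · have h := hasFracPow_of_mem_fracPowDomain hx₀
    have h0 := hlim x₀ hx₀'
    have hf : ∀ y, 0 < y → extension T α σ x₀ y = poissonOp (expNeg T α) σ (y ^ 2 / 4) x₀ :=
      fun y hy => extension_eq hS hσ₀ hσ₁ hx₀ h0 hy
    refine ⟨fun y hy => ⟨integrableOn_extIntegrand hS hσ₀ hy, ?_⟩,
      contDiffOn_ext hS hσ₀ hf _, fun y hy => ?_, if_neg (lt_irrefl 0), tendsto_ext_zero hS hσ₀ hf,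
      tendsto_ext_sub hS hσ₀ hσ₁ hf h h0, tendsto_deriv_ext hS hσ₀ hσ₁ hf h h0,
      tendsto_iteratedDeriv_two_ext hS hσ₀ hσ₁ hf h h0, fun y hy => ⟨?_, ?_⟩, fun hd => ?_⟩
    · rw [hf y hy]
      exact tendsto_extTrunc hS hσ₀ hσ₁ hx₀ h0 hy
    · -- with `z = y² / 4` the equation reads `T φ = (1 - σ) φ' + z φ''`
      have hz : 0 < y ^ 2 / 4 := by positivity
      obtain ⟨hm, ha⟩ := hres.mem_domain_of_eq (resolvent_poissonOp hS hσ₀ hz x₀ hRA')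
      rw [(hasDerivAt_ext hS hσ₀ hf hy).deriv, iteratedDeriv_two_ext hS hσ₀ hf hy, hf y hy, ha]
      refine ⟨hm, ?_⟩
      have hy' := hy.ne'
      match_scalars <;> field_simp <;> ring
    · obtain ⟨hi, he⟩ := integral_poisson_eq hS hσ₀ (by positivity : 0 < y ^ 2 / 4) x₀
      simp only [div_div] at hi he
      refine ⟨hi, ?_⟩
      rw [hf y hy, he, sq_div_four_rpow hy, div_div]
    · have e : ∀ r ∈ Ioi (0 : ℝ),
          (Real.exp (-r) * r ^ (σ - 1)) • expNeg T α (y ^ 2 / 4 / r) x₀ =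
            (Real.exp (-r) / r ^ (1 - σ)) • expNeg T α (y ^ 2 / (4 * r)) x₀ := by
        intro r hr
        have hr0 : (0 : ℝ) < r := hr
        rw [div_div, ← neg_sub 1 σ, Real.rpow_neg hr0.le, div_eq_mul_inv (Real.exp (-r))]
      have hz : 0 < y ^ 2 / 4 := by positivity
      rw [← integrableOn_congr_fun e measurableSet_Ioi, ← setIntegral_congr_fun measurableSet_Ioi e]
      exact ⟨integrableOn_poissonOp_apply hS hσ₀ hz x₀, by
        rw [hf y hy, poissonOp_apply hS hσ₀ hz]⟩
    · refine ((tendsto_poissonOp_zero hS hσ₀ (app T x₀)).comp tendsto_sq_div_four).congr' ?_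
      filter_upwards [self_mem_nhdsWithin] with y hy
      have hy0 : (0 : ℝ) < y := hy
      have hz : 0 < y ^ 2 / 4 := by positivity
      have e := hres.eq_of_mem_domain hd
      have e' : resolventOp T (-1) (-poissonOp (expNeg T α) σ (y ^ 2 / 4) x₀ -
          poissonOp (expNeg T α) σ (y ^ 2 / 4) (app T x₀)) =
          poissonOp (expNeg T α) σ (y ^ 2 / 4) x₀ := by
        rw [← map_neg, ← map_sub, poissonOp_comm hS hσ₀ hz hRS', e]
      rw [Function.comp_apply, hf y hy0, (hres.mem_domain_of_eq e').2]
  · exact norm_iteratedDeriv_ext_le hS hσ₀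
      (fun y hy => extension_eq hS hσ₀ hσ₁ hx₀ (hlim x₀ hx₀') hy) n hy
  · have hz : 0 < y ^ 2 / 4 := by positivity
    have h := (hasFracPow_of_mem_fracPowDomain hx₀).clm_apply hS hσ₀
      (B := poissonOp (expNeg T α) σ (y ^ 2 / 4)) fun t ht v =>
        (poissonOp_comm hS hσ₀ hz (B := expNeg T α t) (fun s hs u => hS.apply_comm ht hs u) v).symm
    rw [extension_eq hS hσ₀ hσ₁ hx₀ (hlim x₀ hx₀') hy]
    refine ⟨h.mem_fracPowDomain, ?_⟩
    rw [h.fracPow_eq]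
    exact norm_poissonOp_apply_le hS hσ₀ hz _
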